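/- Let $(A,\mathfrak m)$ be an abstract local hypersurface of Krull dimension $3$, that is, a Noetherian local ring whose $\mathfrak m$-adic completion is isomorphic to $S/(f)$ for some regular local ring $S$ and some nonzero nonunit $f\in S$. Let $M$ and $N$ be finitely generated reflexive $A$-modules that are locally free on the punctured spectrum $\operatorname{Spec}A\setminus\{\mathfrak m\}$, and suppose that $\operatorname{Hom}_A(M,N)$ is a maximal Cohen–Macaulay $A$-module, i.e. it is zero or has depth $\dim A$. Write $M^*=\operatorname{Hom}_A(M,A)$ and let $\ell$ denote length. Then Hochster's theta invariant $$\theta^A(M^*,N)=\ell(\operatorname{Tor}^A_{2e+2}(M^*,N))-\ell(\operatorname{Tor}^A_{2e+1}(M^*,N)),\qquad e\in\mathbb{N},\ 2e\ge\dim A,$$ is well defined (both lengths are finite and the difference does not depend on $e$), and $$\theta^A(M^*,N)\le 0.$$ Moreover, $\theta^A(M^*,N)=0$ if and only if $M$ is free or $N$ is free. -/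

import Mathlib

universe u

open IsLocalRing CategoryTheory

noncomputable section

/-- An abstract (local) hypersurface: a Noetherian local ring whose completion at the maximal ideal
is isomorphic to `S ⧸ (f)` for a regular local ring `S` and a nonzero nonunit `f` of `S`. (A regular
local ring `A` is included: take `S = Â⟦X⟧` and `f = X`.) -/
def IsAbstractHypersurface (A : Type u) [CommRing A] [IsLocalRing A] : Prop :=
  IsNoetherianRing A ∧
    ∃ (S : Type u) (_ : CommRing S) (_ : IsRegularLocalRing S) (f : S),
      f ≠ 0 ∧ ¬ IsUnit f ∧
        Nonempty (AdicCompletion (maximalIdeal A) A ≃+* S ⧸ Ideal.span {f})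

/-- The depth of a module over a local ring: the supremum of the lengths of the regular
sequences on `M` contained in the maximal ideal. -/
def localDepth (A : Type u) [CommRing A] [IsLocalRing A]
    (M : Type u) [AddCommGroup M] [Module A M] : ℕ∞ :=
  ⨆ (rs : List A) (_ : ∀ r ∈ rs, r ∈ maximalIdeal A)
    (_ : RingTheory.Sequence.IsRegular M rs), (rs.length : ℕ∞)

/-- Maximal Cohen–Macaulay modules: finitely generated, and of depth `dim A` unless zero
(the zero module counts as maximal Cohen–Macaulay). -/
def IsMaximalCohenMacaulay (A : Type u) [CommRing A] [IsLocalRing A]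
    (M : Type u) [AddCommGroup M] [Module A M] : Prop :=
  Module.Finite A M ∧
    (Subsingleton M ∨ (localDepth A M : WithBot ℕ∞) = ringKrullDim A)

/-- `M` is locally free on `Spec A ∖ {𝔪}`: `M_𝔭` is a free `A_𝔭`-module for every prime `𝔭 ≠ 𝔪`. -/
def IsLocallyFreeOnPuncturedSpectrum (A : Type u) [CommRing A] [IsLocalRing A]
    (M : Type u) [AddCommGroup M] [Module A M] : Prop :=
  {closedPoint A}ᶜ ⊆ Module.freeLocus A M

/-- The length of `Tor_i^A(M, N)`. -/
def torLength (A : Type u) [CommRing A] (M N : Type u) [AddCommGroup M] [Module A M]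
    [AddCommGroup N] [Module A N] (i : ℕ) : ℕ∞ :=
  Module.length A (((Tor (ModuleCat.{u} A) i).obj (ModuleCat.of A M)).obj (ModuleCat.of A N))

/-- Hochster's theta invariant `θ^A(M, N)` is defined and equal to the integer `t`: for every `e`
with `2e ≥ dim A` the modules `Tor_{2e+2}^A(M, N)` and `Tor_{2e+1}^A(M, N)` have finite length, and
the difference of their lengths is `t`. -/
def HasHochsterTheta (A : Type u) [CommRing A] (M N : Type u) [AddCommGroup M] [Module A M]
    [AddCommGroup N] [Module A N] (t : ℤ) : Prop :=
  ∀ e : ℕ, ringKrullDim A ≤ ((2 * e : ℕ) : WithBot ℕ∞) →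
    ∃ p q : ℕ, torLength A M N (2 * e + 2) = p ∧ torLength A M N (2 * e + 1) = q ∧
      t = (p : ℤ) - (q : ℤ)

end

/-!
Completion changes neither the lengths of the modules `Tor` nor the hypotheses, so let `A` be a
hypersurface `R = S/(f)` with `S` regular of dimension four. A matrix factorization `(φ, ψ)` of `f`
gives an eventually 2-periodic resolution of `N`, and `θ(Y, N)` is the Herbrand difference of the
lengths of the two homology modules of `Y` under `φ` and `ψ`.

Let `0 → L → F → M → 0` be a minimal presentation. The cokernel of `F* → L*` has finite length, on
which `θ` vanishes since `dim R > 0`, so `θ(M*, N) = -θ(L*, N)`. As `Hom(M, N)` is maximal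
Cohen–Macaulay, every map `L → N` extends to `F`, which kills the odd homology of `L*`: this gives
`θ(M*, N) ≤ 0`. If `θ(M*, N) = 0`, the even homology vanishes as well, and the Künneth formula over
`S` makes the tensor product of `L*` with a syzygy `Y` of `N` a module of projective dimension at
most one over `S`. Comparing the ranks in the resulting minimal presentation forces `L*` or `Y` to
be free. If `L*` is free, so is `L`, and extending maps from `L` shows that `L` or `N` is zero. If
`Y` is free, applying `Hom(M, -)` to the free resolution of `N` keeps it exact and minimal, and the
projective dimension of `Hom(M, N)` over `S` forces `N` to be free or `M*` to vanish.
-/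

open Module

/-! ### Regular local rings -/

section RegularLocalRing

open RingTheory.Sequence
open scoped Pointwise

variable {S : Type u} [CommRing S]

lemma span_singleton_eq_smul_top (x : S) : Ideal.span {x} = x • (⊤ : Ideal S) := by
  simp [← Submodule.ideal_span_singleton_smul]

lemma exists_fin_span_eq_maximalIdeal [IsLocalRing S] [IsNoetherianRing S] {d : ℕ}
    (hd : (maximalIdeal S).spanFinrank = d) :
    ∃ y : Fin d → S, Ideal.span (Set.range y) = maximalIdeal S := by
  obtain ⟨s, hs, hspan⟩ :=
    Submodule.FG.exists_span_finset_card_eq_spanFinrank (maximalIdeal S).fg_of_isNoetherianRing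
  rw [← hd, ← hs]
  refine ⟨fun i => (s.equivFin.symm i : S), ?_⟩
  rw [Set.range_comp' Subtype.val (s.equivFin.symm), Set.range_eq_univ.2 (Equiv.surjective _)]
  simpa using hspan

lemma exists_span_sup_eq_maximalIdeal_of_notMem_sq [IsLocalRing S] {n : ℕ} {y : Fin (n + 1) → S}
    (hy : Ideal.span (Set.range y) = maximalIdeal S) {x : S} (hx : x ∈ maximalIdeal S)
    (hx2 : x ∉ maximalIdeal S ^ 2) :
    ∃ z : Fin n → S, Ideal.span {x} ⊔ Ideal.span (Set.range z) = maximalIdeal S := by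
  have hym : ∀ i, y i ∈ maximalIdeal S := fun i => hy ▸ Ideal.subset_span ⟨i, rfl⟩
  obtain ⟨c, hc⟩ := Ideal.mem_span_range_iff_exists_fun.1 (hy ▸ hx)
  obtain ⟨i, hi⟩ : ∃ i, IsUnit (c i) := by
    by_contra! h
    refine hx2 (hc ▸ pow_two (maximalIdeal S) ▸ ?_)
    exact Ideal.sum_mem _ fun i _ => Ideal.mul_mem_mul ((mem_maximalIdeal _).2 (h i)) (hym i)
  refine ⟨fun j => y (i.succAbove j), le_antisymm (sup_le ?_ ?_) ?_⟩
  · exact (Ideal.span_singleton_le_iff_mem _).2 hx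
  · exact Ideal.span_le.2 (Set.range_subset_iff.2 fun j => hym _)
  set J := Ideal.span {x} ⊔ Ideal.span (Set.range fun j => y (i.succAbove j))
  have hne : ∀ j, y (i.succAbove j) ∈ J := fun j =>
    Ideal.mem_sup_right (Ideal.subset_span ⟨j, rfl⟩)
  have hyi : c i * y i ∈ J := by
    rw [Fin.sum_univ_succAbove _ i] at hc
    rw [eq_sub_of_add_eq hc]
    exact J.sub_mem (Ideal.mem_sup_left (Ideal.mem_span_singleton_self x))
      (J.sum_mem fun k _ => J.mul_mem_left _ (hne k))
  rw [← hy, Ideal.span_le, Set.range_subset_iff]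
  exact (Fin.forall_iff_succAbove i).2 ⟨(Ideal.unit_mul_mem_iff_mem J hi).1 hyi, hne⟩

lemma isLocalRing_quotient_span_singleton [IsLocalRing S] {x : S} (hx : x ∈ maximalIdeal S) :
    IsLocalRing (S ⧸ Ideal.span {x}) := by
  have : Nontrivial (S ⧸ Ideal.span {x}) :=
    Ideal.Quotient.nontrivial_iff.2 (Ideal.span_singleton_ne_top hx)
  exact IsLocalRing.of_surjective' _ Ideal.Quotient.mk_surjective

lemma spanFinrank_maximalIdeal_quotient_le [IsLocalRing S] [IsNoetherianRing S] {d : ℕ}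
    (hd : (maximalIdeal S).spanFinrank = d + 1) {x : S} [IsLocalRing (S ⧸ Ideal.span {x})]
    (hx : x ∈ maximalIdeal S) (hx2 : x ∉ maximalIdeal S ^ 2) :
    (maximalIdeal (S ⧸ Ideal.span {x})).spanFinrank ≤ d := by
  obtain ⟨y, hy⟩ := exists_fin_span_eq_maximalIdeal hd
  obtain ⟨z, hz⟩ := exists_span_sup_eq_maximalIdeal_of_notMem_sq hy hx hx2
  have hmap : maximalIdeal (S ⧸ Ideal.span {x}) =
      (Ideal.span (Set.range z)).map (Ideal.Quotient.mk (Ideal.span {x})) := by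
    rw [← map_maximalIdeal_of_surjective _ Ideal.Quotient.mk_surjective, ← hz, Ideal.map_sup,
      Ideal.map_quotient_self, bot_sup_eq]
  calc (maximalIdeal (S ⧸ Ideal.span {x})).spanFinrank
      ≤ (Ideal.span (Set.range z)).spanFinrank :=
        hmap ▸ Ideal.spanFinrank_map_le_of_fg _ (Ideal.fg_of_isNoetherianRing _)
    _ ≤ (Set.range z).ncard := Submodule.spanFinrank_span_le_ncard_of_finite (Set.finite_range _)
    _ ≤ d := by simpa [← Set.image_univ] using Set.ncard_image_le (f := z) Set.finite_univ

lemma isRegularLocalRing_quotient_span_singleton [IsRegularLocalRing S] {d : ℕ}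
    (hd : (maximalIdeal S).spanFinrank = d + 1) {x : S} (hx : x ∈ maximalIdeal S)
    (hx2 : x ∉ maximalIdeal S ^ 2) :
    ∃ _ : IsRegularLocalRing (S ⧸ Ideal.span {x}),
      (maximalIdeal (S ⧸ Ideal.span {x})).spanFinrank = d := by
  have := isLocalRing_quotient_span_singleton hx
  have hle := spanFinrank_maximalIdeal_quotient_le hd hx hx2
  have hge : (d : WithBot ℕ∞) ≤ ringKrullDim (S ⧸ Ideal.span {x}) := by
    have hdim : ringKrullDim S ≤ ringKrullDim (S ⧸ Ideal.span {x}) + 1 := by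
      rw [span_singleton_eq_smul_top]
      exact ringKrullDim_le_ringKrullDim_quotSMulTop_succ hx
    rw [← IsRegularLocalRing.spanFinrank_maximalIdeal (R := S), hd] at hdim
    exact ENat.WithBot.add_le_add_one_right_iff.1 (by exact_mod_cast hdim)
  have hreg : IsRegularLocalRing (S ⧸ Ideal.span {x}) :=
    .of_spanFinrank_maximalIdeal_le _ (le_trans (by exact_mod_cast hle) hge)
  rw [← hreg.spanFinrank_maximalIdeal] at hge
  exact ⟨hreg, le_antisymm hle (by exact_mod_cast hge)⟩

lemma spanFinrank_maximalIdeal_eq_zero_of_le_sq [IsLocalRing S] [IsNoetherianRing S]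
    (h : maximalIdeal S ≤ maximalIdeal S ^ 2) : (maximalIdeal S).spanFinrank = 0 := by
  have hbot : maximalIdeal S = ⊥ :=
    Submodule.eq_bot_of_le_smul_of_le_jacobson_bot (maximalIdeal S) _
      (maximalIdeal S).fg_of_isNoetherianRing (by simpa [pow_two] using h)
      (maximalIdeal_le_jacobson _)
  rw [hbot, Submodule.spanFinrank_bot]

lemma spanFinrank_maximalIdeal_eq_zero_of_mem_minimalPrimes [IsRegularLocalRing S]
    (h : maximalIdeal S ∈ minimalPrimes S) : (maximalIdeal S).spanFinrank = 0 := by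
  have hdim := IsRegularLocalRing.spanFinrank_maximalIdeal (R := S)
  rw [← maximalIdeal_height_eq_ringKrullDim, Ideal.height_eq_zero_iff.2 h] at hdim
  exact_mod_cast hdim

lemma exists_notMem_sq_notMem_minimalPrimes [IsRegularLocalRing S]
    (hd : (maximalIdeal S).spanFinrank ≠ 0) :
    ∃ x ∈ maximalIdeal S, x ∉ maximalIdeal S ^ 2 ∧ ∀ p ∈ minimalPrimes S, x ∉ p := by
  classical
  by_contra! h
  let s : Finset (Ideal S) :=
    insert (maximalIdeal S ^ 2) (minimalPrimes.finite_of_isNoetherianRing S).toFinset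
  have hsub : (maximalIdeal S : Set S) ⊆ ⋃ i ∈ (s : Set (Ideal S)), (i : Set S) := by
    intro x hx
    by_cases hx2 : x ∈ maximalIdeal S ^ 2
    · exact Set.mem_biUnion (x := maximalIdeal S ^ 2) (by simp [s]) hx2
    · obtain ⟨p, hp, hxp⟩ := h x hx hx2
      exact Set.mem_biUnion (x := p) (by simp [s, hp]) hxp
  obtain ⟨i, hi, hmi⟩ := (Ideal.subset_union_prime (f := fun i : Ideal S => i)
    (maximalIdeal S ^ 2) (maximalIdeal S ^ 2) (fun i hi h1 _ => by
      simp only [s, Finset.mem_insert, Set.Finite.mem_toFinset] at hi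
      exact (hi.resolve_left h1).1.1)).1 hsub
  simp only [s, Finset.mem_insert, Set.Finite.mem_toFinset] at hi
  rcases hi with rfl | hi
  · exact hd (spanFinrank_maximalIdeal_eq_zero_of_le_sq hmi)
  · have hmin : maximalIdeal S = i := le_antisymm hmi (le_maximalIdeal hi.1.1.ne_top)
    exact hd (spanFinrank_maximalIdeal_eq_zero_of_mem_minimalPrimes (hmin ▸ hi))

/- A minimal prime `q` inside the prime `(x)` satisfies `q = x q` because `x ∉ q`, so `q = 0` by
Nakayama's lemma. -/
lemma isDomain_of_isPrime_span_singleton [IsLocalRing S] [IsNoetherianRing S] {x : S}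
    (hx : x ∈ maximalIdeal S) (hprime : (Ideal.span {x}).IsPrime)
    (hxp : ∀ p ∈ minimalPrimes S, x ∉ p) : IsDomain S := by
  obtain ⟨q, hq, hqx⟩ := Ideal.exists_minimalPrimes_le (I := (⊥ : Ideal S))
    (J := Ideal.span {x}) bot_le
  have hqp : q.IsPrime := hq.1.1
  have hq0 : q = ⊥ := by
    refine Submodule.eq_bot_of_le_smul_of_le_jacobson_bot (maximalIdeal S) _
      q.fg_of_isNoetherianRing (fun a ha => ?_) (maximalIdeal_le_jacobson _)
    obtain ⟨b, rfl⟩ := Ideal.mem_span_singleton'.1 (hqx ha)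
    rw [mul_comm]
    exact Submodule.smul_mem_smul hx ((hqp.mem_or_mem ha).resolve_right (hxp q hq))
  subst hq0
  exact IsDomain.of_bot_isPrime S

lemma exists_isWeaklyRegular_cons [IsLocalRing S] [IsDomain S] {x : S} (hx0 : x ≠ 0)
    [IsLocalRing (S ⧸ Ideal.span {x})] {rs : List (S ⧸ Ideal.span {x})}
    (hrs : IsWeaklyRegular (S ⧸ Ideal.span {x}) rs)
    (hspan : Ideal.ofList rs = maximalIdeal (S ⧸ Ideal.span {x})) :
    ∃ rs' : List S, IsWeaklyRegular S rs' ∧ Ideal.ofList rs' = maximalIdeal S ∧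
      rs'.length = rs.length + 1 := by
  obtain ⟨rs, rfl⟩ : ∃ l : List S, l.map (Ideal.Quotient.mk (Ideal.span {x})) = rs :=
    List.map_surjective_iff.2 Ideal.Quotient.mk_surjective rs
  refine ⟨x :: rs, ?_, ?_, by simp⟩
  · rw [isWeaklyRegular_cons_iff]
    refine ⟨IsSMulRegular.of_ne_zero hx0, ?_⟩
    exact ((Submodule.quotEquivOfEq _ _ (span_singleton_eq_smul_top x)).isWeaklyRegular_congr rs).1
      ((isWeaklyRegular_map_algebraMap_iff (S ⧸ Ideal.span {x}) (S ⧸ Ideal.span {x}) rs).1 hrs)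
  · have : IsLocalHom (Ideal.Quotient.mk (Ideal.span {x})) :=
      IsLocalHom.of_surjective _ Ideal.Quotient.mk_surjective
    have hcomap := congrArg (Ideal.comap (Ideal.Quotient.mk (Ideal.span {x}))) hspan
    rw [← Ideal.map_ofList, Ideal.comap_map_of_surjective _ Ideal.Quotient.mk_surjective,
      ← RingHom.ker_eq_comap_bot, Ideal.mk_ker, maximalIdeal_comap] at hcomap
    rw [Ideal.ofList_cons, sup_comm, hcomap]

theorem isDomain_and_exists_isWeaklyRegular (d : ℕ) (S : Type u) [CommRing S]
    [IsRegularLocalRing S] (hd : (maximalIdeal S).spanFinrank = d) :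
    IsDomain S ∧ ∃ rs : List S, IsWeaklyRegular S rs ∧ Ideal.ofList rs = maximalIdeal S ∧
      rs.length = d := by
  induction d generalizing S with
  | zero =>
    have hbot : maximalIdeal S = ⊥ := by
      rwa [Submodule.spanFinrank_eq_zero_iff_eq_bot
        (maximalIdeal S).fg_of_isNoetherianRing] at hd
    exact ⟨(isField_iff_maximalIdeal_eq.2 hbot).isDomain, [], IsWeaklyRegular.nil _ _,
      by simp [hbot], rfl⟩
  | succ d ih =>
    obtain ⟨x, hx, hx2, hxp⟩ := exists_notMem_sq_notMem_minimalPrimes (S := S) (by omega)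
    obtain ⟨hreg, hd'⟩ := isRegularLocalRing_quotient_span_singleton hd hx hx2
    obtain ⟨hdom, rs, hrs, hspan, rfl⟩ := ih (S ⧸ Ideal.span {x}) hd'
    have := isDomain_of_isPrime_span_singleton hx
      ((Ideal.Quotient.isDomain_iff_prime _).1 hdom) hxp
    have hx0 : x ≠ 0 := fun h => hx2 (h ▸ zero_mem _)
    exact ⟨this, exists_isWeaklyRegular_cons hx0 hrs hspan⟩

instance (priority := low) isDomain_of_isRegularLocalRing [IsRegularLocalRing S] : IsDomain S :=
  (isDomain_and_exists_isWeaklyRegular _ S rfl).1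

lemma exists_isWeaklyRegular_ofList_eq_maximalIdeal [IsRegularLocalRing S] :
    ∃ rs : List S, IsWeaklyRegular S rs ∧ Ideal.ofList rs = maximalIdeal S ∧
      rs.length = (maximalIdeal S).spanFinrank :=
  (isDomain_and_exists_isWeaklyRegular _ S rfl).2

end RegularLocalRing

/-! ### Projective dimension -/

/-- `ProjDimLT S Z n` says that the `S`-module `Z` has projective dimension less than `n`; it
unbundles the categorical notion, which is stated for objects of `ModuleCat S`. -/
def ProjDimLT (S : Type u) [CommRing S] (Z : Type u) [AddCommGroup Z] [Module S Z] (n : ℕ) : Prop :=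
  HasProjectiveDimensionLT (ModuleCat.of S Z) n

namespace ProjDimLT

variable {S : Type u} [CommRing S] {Z Z₁ Z₂ Z₃ : Type u} [AddCommGroup Z] [Module S Z]
  [AddCommGroup Z₁] [Module S Z₁] [AddCommGroup Z₂] [Module S Z₂] [AddCommGroup Z₃] [Module S Z₃]

lemma mono {n m : ℕ} (h : ProjDimLT S Z n) (hnm : n ≤ m) : ProjDimLT S Z m :=
  have : HasProjectiveDimensionLT (ModuleCat.of S Z) n := h
  hasProjectiveDimensionLT_of_ge _ n m hnm

lemma of_equiv {n : ℕ} (h : ProjDimLT S Z₁ n) (e : Z₁ ≃ₗ[S] Z₂) : ProjDimLT S Z₂ n :=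
  have : HasProjectiveDimensionLT (ModuleCat.of S Z₁) n := h
  hasProjectiveDimensionLT_of_iso e.toModuleIso n

lemma one_iff : ProjDimLT S Z 1 ↔ Module.Projective S Z := by
  rw [ProjDimLT, ← projective_iff_hasProjectiveDimensionLT_one]
  exact (IsProjective.iff_projective (R := S) Z).symm

lemma succ_of_projective [Module.Projective S Z] (n : ℕ) : ProjDimLT S Z (n + 1) :=
  (one_iff.2 inferInstance).mono (Nat.le_add_left 1 n)

lemma of_subsingleton [Subsingleton Z] (n : ℕ) : ProjDimLT S Z n :=
  mono (n := 0) ((hasProjectiveDimensionLT_zero_iff_isZero _).2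
    (ModuleCat.isZero_iff_subsingleton.2 ‹_›)) (Nat.zero_le n)

lemma lt_iff {n : ℕ} : ProjDimLT S Z n ↔ projectiveDimension (ModuleCat.of S Z) < n :=
  projectiveDimension_lt_iff.symm

section Exact

variable {f : Z₁ →ₗ[S] Z₂} {g : Z₂ →ₗ[S] Z₃} (hf : Function.Injective f)
  (hfg : Function.Exact f g) (hg : Function.Surjective g)

include hf hfg hg

lemma shortExact : (ShortComplex.mk (ModuleCat.ofHom f) (ModuleCat.ofHom g)
    (by rw [← ModuleCat.ofHom_comp, hfg.linearMap_comp_eq_zero]; rfl)).ShortExact where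
  exact := (ShortComplex.ShortExact.moduleCat_exact_iff_function_exact _).2 hfg
  mono_f := (ModuleCat.mono_iff_injective _).2 hf
  epi_g := (ModuleCat.epi_iff_surjective _).2 hg

lemma left {n : ℕ} (h₂ : ProjDimLT S Z₂ n) (h₃ : ProjDimLT S Z₃ (n + 1)) : ProjDimLT S Z₁ n :=
  (shortExact hf hfg hg).hasProjectiveDimensionLT_X₁ n h₂ h₃

lemma middle {n : ℕ} (h₁ : ProjDimLT S Z₁ n) (h₃ : ProjDimLT S Z₃ n) : ProjDimLT S Z₂ n :=
  (shortExact hf hfg hg).hasProjectiveDimensionLT_X₂ n h₁ h₃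

lemma right {n : ℕ} (h₁ : ProjDimLT S Z₁ n) (h₂ : ProjDimLT S Z₂ (n + 1)) :
    ProjDimLT S Z₃ (n + 1) :=
  (shortExact hf hfg hg).hasProjectiveDimensionLT_X₃ n h₁ h₂

end Exact

lemma ker {n : ℕ} {g : Z₂ →ₗ[S] Z₃} (hg : Function.Surjective g) [Module.Projective S Z₂]
    (h : ProjDimLT S Z₃ (n + 2)) : ProjDimLT S (LinearMap.ker g) (n + 1) :=
  left (Submodule.injective_subtype _) (LinearMap.exact_subtype_ker_map g) hg
    (succ_of_projective n) h

lemma of_ker {n : ℕ} {g : Z₂ →ₗ[S] Z₃} (hg : Function.Surjective g) [Module.Projective S Z₂]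
    (h : ProjDimLT S (LinearMap.ker g) n) : ProjDimLT S Z₃ (n + 1) :=
  right (Submodule.injective_subtype _) (LinearMap.exact_subtype_ker_map g) hg h
    (succ_of_projective n)

lemma prod {n : ℕ} (h₁ : ProjDimLT S Z₁ n) (h₂ : ProjDimLT S Z₂ n) :
    ProjDimLT S (Z₁ × Z₂) n :=
  middle LinearMap.inl_injective Function.Exact.inl_snd LinearMap.snd_surjective h₁ h₂

lemma pi {n : ℕ} (h : ProjDimLT S Z n) (k : ℕ) : ProjDimLT S (Fin k → Z) n := by
  induction k with
  | zero => exact of_subsingleton n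
  | succ k ih => exact (h.prod ih).of_equiv (Fin.consLinearEquiv S fun _ => Z)

lemma add_length_iff [IsLocalRing S] [IsNoetherianRing S] [Module.Finite S Z] {rs : List S}
    (reg : RingTheory.Sequence.IsWeaklyRegular Z rs) (hrs : ∀ r ∈ rs, r ∈ maximalIdeal S) {n : ℕ} :
    ProjDimLT S (Z ⧸ Ideal.ofList rs • (⊤ : Submodule S Z)) (n + rs.length) ↔
      ProjDimLT S Z n := by
  rcases subsingleton_or_nontrivial Z with hZ | hZ
  · exact ⟨fun _ => of_subsingleton _, fun _ => of_subsingleton _⟩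
  have : Nontrivial (ModuleCat.of S Z) := hZ
  have hpd : projectiveDimension (ModuleCat.of S (Z ⧸ Ideal.ofList rs • (⊤ : Submodule S Z))) =
      projectiveDimension (ModuleCat.of S Z) + rs.length :=
    ModuleCat.projectiveDimension_quotient_eq_add_length_of_isWeaklyRegular (.of S Z) rs reg hrs
  rw [lt_iff, lt_iff, hpd, Nat.cast_add, ← not_le, ENat.WithBot.add_le_add_natCast_right_iff,
    not_le]

end ProjDimLT

section Syzygy

open RingTheory.Sequence

lemma isWeaklyRegular_concat_of_exact {S : Type*} [CommRing S] {K F Z : Type*} [AddCommGroup K]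
    [Module S K] [AddCommGroup F] [Module S F] [AddCommGroup Z] [Module S Z] {f : K →ₗ[S] F}
    {g : F →ₗ[S] Z} (hf : Function.Injective f) (hfg : Function.Exact f g)
    (hg : Function.Surjective g) (rs : List S) (r : S) (hF : IsWeaklyRegular F (rs ++ [r]))
    (hZ : IsWeaklyRegular Z rs) : IsWeaklyRegular K (rs ++ [r]) := by
  induction rs generalizing K F Z with
  | nil =>
    simp only [List.nil_append, isWeaklyRegular_singleton_iff] at hF ⊢
    exact hF.of_injective f hf
  | cons x rs ih =>
    rw [List.cons_append, isWeaklyRegular_cons_iff] at hF ⊢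
    rw [isWeaklyRegular_cons_iff] at hZ
    refine ⟨hF.1.of_injective f hf, ?_⟩
    have hexact := QuotSMulTop.map_first_exact_on_four_term_exact_of_isSMulRegular_last
      ((LinearMap.exact_zero_iff_injective K f).2 hf) hfg hZ.1
    rw [map_zero, LinearMap.exact_zero_iff_injective] at hexact
    exact ih hexact (QuotSMulTop.map_exact x hfg hg) (QuotSMulTop.map_surjective x hg) hF.2 hZ.2

lemma isWeaklyRegular_pi {S : Type*} [CommRing S] {rs : List S} (h : IsWeaklyRegular S rs)
    (n : ℕ) : IsWeaklyRegular (Fin n → S) rs :=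
  ((TensorProduct.rid S (Fin n → S)).isWeaklyRegular_congr rs).1 h.isWeaklyRegular_lTensor

lemma isWeaklyRegular_take {S M : Type*} [CommRing S] [AddCommGroup M] [Module S M] {rs : List S}
    (h : IsWeaklyRegular M rs) (k : ℕ) : IsWeaklyRegular M (rs.take k) := by
  rw [← List.take_append_drop k rs, isWeaklyRegular_append_iff] at h
  exact h.1

end Syzygy

section RegularLocalRing

open RingTheory.Sequence

variable {S : Type u} [CommRing S] [IsRegularLocalRing S] {Z : Type u} [AddCommGroup Z] [Module S Z]

lemma projDimLT_residueField_iff {n : ℕ} :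
    ProjDimLT S (ResidueField S) n ↔ (maximalIdeal S).spanFinrank < n := by
  obtain ⟨rs, hrs, hspan, hlen⟩ := exists_isWeaklyRegular_ofList_eq_maximalIdeal (S := S)
  have hreg : IsRegular S rs := ⟨hrs, by simpa [hspan] using Ideal.IsPrime.ne_top'.symm⟩
  let e : Shrink.{u} (S ⧸ Ideal.ofList rs) ≃ₗ[S] ResidueField S :=
    (Shrink.linearEquiv S _).trans (Submodule.quotEquivOfEq _ _ hspan)
  calc ProjDimLT S (ResidueField S) n ↔ ProjDimLT S (Shrink.{u} (S ⧸ Ideal.ofList rs)) n :=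
        ⟨fun h => h.of_equiv e.symm, fun h => h.of_equiv e⟩
    _ ↔ (maximalIdeal S).spanFinrank < n := by
        rw [ProjDimLT.lt_iff, ModuleCat.projectiveDimension_quotient_eq_length rs hreg, hlen]
        exact_mod_cast Iff.rfl

lemma projDimLT_quotient_maximalIdeal_smul_top [Module.Finite S Z] :
    ProjDimLT S (Z ⧸ maximalIdeal S • (⊤ : Submodule S Z))
      ((maximalIdeal S).spanFinrank + 1) := by
  let _ : Field (S ⧸ maximalIdeal S) := Ideal.Quotient.field _
  have : Module.Finite (S ⧸ maximalIdeal S) (Z ⧸ maximalIdeal S • (⊤ : Submodule S Z)) :=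
    Module.Finite.of_restrictScalars_finite S _ _
  let b := Module.finBasis (S ⧸ maximalIdeal S) (Z ⧸ maximalIdeal S • (⊤ : Submodule S Z))
  have h : ProjDimLT S (S ⧸ maximalIdeal S) ((maximalIdeal S).spanFinrank + 1) :=
    projDimLT_residueField_iff.2 (Nat.lt_succ_self _)
  exact (h.pi _).of_equiv (b.equivFun.symm.restrictScalars S)

theorem projDimLT_of_isWeaklyRegular_take {rs : List S} (hrs : IsWeaklyRegular S rs)
    (hspan : Ideal.ofList rs = maximalIdeal S) (hlen : rs.length = (maximalIdeal S).spanFinrank)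
    (j : ℕ) [Module.Finite S Z] (hZ : IsWeaklyRegular Z (rs.take (rs.length - j))) :
    ProjDimLT S Z (j + 1) := by
  induction j generalizing Z with
  | zero =>
    rw [Nat.sub_zero, List.take_length] at hZ
    rw [← ProjDimLT.add_length_iff hZ fun r hr => hspan ▸ Ideal.subset_span hr, hlen, hspan,
      add_comm, zero_add]
    exact projDimLT_quotient_maximalIdeal_smul_top
  | succ j ih =>
    obtain ⟨n, g, hg⟩ := Module.Finite.exists_fin' S Z
    refine ProjDimLT.of_ker hg (ih ?_)
    rcases lt_or_ge j rs.length with hj | hj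
    · have htake : rs.take (rs.length - j) =
          rs.take (rs.length - (j + 1)) ++ [rs[rs.length - (j + 1)]] := by
        rw [show rs.length - j = rs.length - (j + 1) + 1 by omega, List.take_succ_eq_append_getElem]
      rw [htake]
      exact isWeaklyRegular_concat_of_exact (Submodule.injective_subtype _)
        (LinearMap.exact_subtype_ker_map g) hg _ _
        (htake ▸ isWeaklyRegular_take (isWeaklyRegular_pi hrs n) _) hZ
    · simp [Nat.sub_eq_zero_of_le hj]

theorem projDimLT_succ_spanFinrank_maximalIdeal [Module.Finite S Z] :
    ProjDimLT S Z ((maximalIdeal S).spanFinrank + 1) := by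
  obtain ⟨rs, hrs, hspan, hlen⟩ := exists_isWeaklyRegular_ofList_eq_maximalIdeal (S := S)
  exact projDimLT_of_isWeaklyRegular_take hrs hspan hlen _ (by simp [hlen])

lemma injective_liftQ_toSpanSingleton {R M : Type*} [CommRing R] [IsLocalRing R] [AddCommGroup M]
    [Module R M] {z : M} (hz : z ≠ 0)
    (hmz : maximalIdeal R ≤ LinearMap.ker (LinearMap.toSpanSingleton R M z)) :
    Function.Injective ((maximalIdeal R).liftQ (LinearMap.toSpanSingleton R M z) hmz) := by
  rw [← LinearMap.ker_eq_bot]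
  refine Submodule.ker_liftQ_eq_bot _ _ _ fun r hr => ?_
  by_contra hunit
  exact hz ((notMem_maximalIdeal.1 hunit).smul_eq_zero.1 hr)

/- A nonzero socle element embeds the residue field, whose projective dimension is maximal. -/
lemma not_projDimLT_of_smul_eq_zero [Module.Finite S Z] {z : Z} (hz : z ≠ 0)
    (hmz : ∀ r ∈ maximalIdeal S, r • z = 0) : ¬ ProjDimLT S Z (maximalIdeal S).spanFinrank := by
  intro h
  have hk : ProjDimLT S (S ⧸ maximalIdeal S) (maximalIdeal S).spanFinrank :=
    ProjDimLT.left (injective_liftQ_toSpanSingleton hz hmz) (LinearMap.exact_map_mkQ_range _)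
      (Submodule.mkQ_surjective _) h projDimLT_succ_spanFinrank_maximalIdeal
  exact lt_irrefl _ (projDimLT_residueField_iff.1 hk)

theorem subsingleton_of_projDimLT_of_pow_smul_eq_zero [Module.Finite S Z]
    (h : ProjDimLT S Z (maximalIdeal S).spanFinrank) {k : ℕ}
    (hk : ∀ r ∈ maximalIdeal S ^ k, ∀ z : Z, r • z = 0) : Subsingleton Z := by
  induction k with
  | zero => exact subsingleton_of_forall_eq 0 fun z => by simpa using hk 1 (by simp) z
  | succ k ih =>
    refine ih fun r hr z => ?_
    by_contra hrz
    refine not_projDimLT_of_smul_eq_zero hrz (fun s hs => ?_) h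
    rw [smul_smul]
    exact hk _ (pow_succ' (maximalIdeal S) k ▸ Ideal.mul_mem_mul hs hr) z

end RegularLocalRing

/-! ### Minimal covers -/

section MinimalCover

variable {R : Type*} [CommRing R] [IsLocalRing R] {Z : Type*} [AddCommGroup Z] [Module R Z]

open TensorProduct in
lemma exists_minimal_cover (R : Type*) [CommRing R] [IsLocalRing R] (Z : Type*) [AddCommGroup Z]
    [Module R Z] [Module.Finite R Z] :
    ∃ (n : ℕ) (π : (Fin n → R) →ₗ[R] Z), Function.Surjective π ∧
      ∀ v, π v = 0 → ∀ i, v i ∈ maximalIdeal R := by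
  let b := Module.finBasis (ResidueField R) (ResidueField R ⊗[R] Z)
  choose z hz using fun i => TensorProduct.mk_surjective R Z (ResidueField R)
    Ideal.Quotient.mk_surjective (b i)
  refine ⟨_, Fintype.linearCombination R z, ?_, fun v hv i => ?_⟩
  · rw [← LinearMap.range_eq_top, Fintype.range_linearCombination]
    exact span_eq_top_of_tmul_eq_basis z b hz
  · have hsum : ∑ j, residue R (v j) • b j = 0 := by
      simpa [Fintype.linearCombination_apply, TensorProduct.tmul_sum, ← hz,
        ← ResidueField.algebraMap_eq, algebraMap_smul]
        using congrArg (TensorProduct.mk R (ResidueField R) Z 1) hv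
    exact (residue_eq_zero_iff _).1 (Fintype.linearIndependent_iff.1 b.linearIndependent _ hsum i)

lemma injective_of_surjective_of_ker_le_smul_top {I : Ideal R} (hI : I ≤ maximalIdeal R)
    {P Q : Type*} [AddCommGroup P] [Module R P] [IsNoetherian R P] [AddCommGroup Q] [Module R Q]
    [Module.Projective R Q] {f : P →ₗ[R] Q} (hf : Function.Surjective f)
    (hker : LinearMap.ker f ≤ I • ⊤) : Function.Injective f := by
  obtain ⟨σ, hσ⟩ := Module.projective_lifting_property f LinearMap.id hf
  let p : P →ₗ[R] P := LinearMap.id - σ ∘ₗ f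
  have hp : LinearMap.range p ≤ LinearMap.ker f := by
    rintro _ ⟨x, rfl⟩
    simpa [p, sub_eq_zero] using (LinearMap.congr_fun hσ (f x)).symm
  rw [← LinearMap.ker_eq_bot]
  refine Submodule.eq_bot_of_le_smul_of_le_jacobson_bot I _ (IsNoetherian.noetherian _)
    (fun x hx => ?_) (hI.trans (maximalIdeal_le_jacobson _))
  have hpx : p x = x := by simp [p, LinearMap.mem_ker.1 hx]
  have hmem : p x ∈ (I • (⊤ : Submodule R P)).map p := Submodule.mem_map_of_mem (hker hx)
  rw [Submodule.map_smul'', Submodule.map_top, hpx] at hmem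
  exact Submodule.smul_mono le_rfl hp hmem

lemma mem_smul_top_pi_iff {R ι M : Type*} [CommRing R] [AddCommGroup M] [Module R M] [Finite ι]
    {I : Ideal R} {v : ι → M} :
    v ∈ I • (⊤ : Submodule R (ι → M)) ↔ ∀ i, v i ∈ I • (⊤ : Submodule R M) := by
  classical
  cases nonempty_fintype ι
  refine ⟨fun hv i => Submodule.smul_top_le_comap_smul_top I (LinearMap.proj i) hv, fun hv => ?_⟩
  rw [← Finset.univ_sum_single v]
  exact Submodule.sum_mem _ fun i _ =>
    Submodule.smul_top_le_comap_smul_top I (LinearMap.single R (fun _ => M) i) (hv i)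

lemma mk_mem_smul_top_prod {R P Q : Type*} [CommRing R] [AddCommGroup P] [Module R P]
    [AddCommGroup Q] [Module R Q] {I : Ideal R} {x : P} {y : Q} (hx : x ∈ I • (⊤ : Submodule R P))
    (hy : y ∈ I • (⊤ : Submodule R Q)) : (x, y) ∈ I • (⊤ : Submodule R (P × Q)) := by
  have h : LinearMap.inl R P Q x + LinearMap.inr R P Q y ∈ I • (⊤ : Submodule R (P × Q)) :=
    add_mem (Submodule.smul_top_le_comap_smul_top I _ hx)
      (Submodule.smul_top_le_comap_smul_top I _ hy)
  simpa using h

lemma mem_smul_top_fun_iff {R ι : Type*} [CommRing R] [Finite ι] {I : Ideal R} {v : ι → R} :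
    v ∈ I • (⊤ : Submodule R (ι → R)) ↔ ∀ i, v i ∈ I := by
  simp only [mem_smul_top_pi_iff, smul_eq_mul, Ideal.mul_top]

end MinimalCover

/-! ### Matrix factorizations -/

/-- `R` is the hypersurface `S ⧸ (f)` for a regular local ring `S` and a nonzero nonunit `f`. The
quotient map is the structure map of an `S`-algebra, so that `R` may be a completion. -/
structure IsHypersurfaceQuotient (S R : Type u) [CommRing S] [CommRing R] [Algebra S R]
    (f : S) : Prop where
  isRegularLocalRing : IsRegularLocalRing S
  surjective : Function.Surjective (algebraMap S R)
  algebraMap_eq_zero_iff : ∀ s, algebraMap S R s = 0 ↔ f ∣ s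
  ne_zero : f ≠ 0
  not_isUnit : ¬ IsUnit f

/-- `(Φ, Ψ)` is a matrix factorization of `f`. -/
structure IsMatrixFactorization {S : Type u} [CommRing S] (f : S) {n : ℕ}
    (Φ Ψ : Matrix (Fin n) (Fin n) S) : Prop where
  mul_eq : Φ * Ψ = f • 1
  mul_eq' : Ψ * Φ = f • 1

namespace IsMatrixFactorization

variable {S : Type u} [CommRing S] {f : S} {n : ℕ} {Φ Ψ : Matrix (Fin n) (Fin n) S}

lemma swap (h : IsMatrixFactorization f Φ Ψ) : IsMatrixFactorization f Ψ Φ :=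
  ⟨h.mul_eq', h.mul_eq⟩

lemma transpose (h : IsMatrixFactorization f Φ Ψ) :
    IsMatrixFactorization f Φ.transpose Ψ.transpose := by
  constructor
  · rw [← Matrix.transpose_mul, h.mul_eq', Matrix.transpose_smul, Matrix.transpose_one]
  · rw [← Matrix.transpose_mul, h.mul_eq, Matrix.transpose_smul, Matrix.transpose_one]

lemma mulVec_injective [IsDomain S] (hf : f ≠ 0) (h : IsMatrixFactorization f Φ Ψ)
    {v : Fin n → S} (hv : Φ.mulVec v = 0) : v = 0 := by
  have hfv : f • v = 0 := by
    rw [← Matrix.one_mulVec v, ← Matrix.smul_mulVec, ← h.mul_eq', ← Matrix.mulVec_mulVec, hv,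
      Matrix.mulVec_zero]
  exact (smul_eq_zero.1 hfv).resolve_left hf

end IsMatrixFactorization

section Presentation

variable {S : Type u} [CommRing S] {Z : Type u} [AddCommGroup Z] [Module S Z]

lemma exists_isMatrixFactorization_of_equiv_ker {f : S} (hfZ : ∀ z : Z, f • z = 0)
    {n : ℕ} {π : (Fin n → S) →ₗ[S] Z} (e : LinearMap.ker π ≃ₗ[S] (Fin n → S)) :
    ∃ Φ Ψ : Matrix (Fin n) (Fin n) S,
      IsMatrixFactorization f Φ Ψ ∧ LinearMap.range Φ.mulVecLin = LinearMap.ker π := by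
  let φ : (Fin n → S) →ₗ[S] (Fin n → S) := (LinearMap.ker π).subtype ∘ₗ e.symm.toLinearMap
  let ψ : (Fin n → S) →ₗ[S] (Fin n → S) := e.toLinearMap ∘ₗ
    (f • LinearMap.id).codRestrict _ fun v => by simp [hfZ]
  have hφψ : φ ∘ₗ ψ = f • LinearMap.id := LinearMap.ext fun v => by simp [φ, ψ]
  have hψφ : ψ ∘ₗ φ = f • LinearMap.id := by
    refine LinearMap.ext fun v => (Submodule.injective_subtype _).comp e.symm.injective ?_
    simpa [φ] using LinearMap.congr_fun hφψ (φ v)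
  refine ⟨LinearMap.toMatrix' φ, LinearMap.toMatrix' ψ, ⟨?_, ?_⟩, ?_⟩
  · rw [← LinearMap.toMatrix'_comp, hφψ, map_smul, LinearMap.toMatrix'_id]
  · rw [← LinearMap.toMatrix'_comp, hψφ, map_smul, LinearMap.toMatrix'_id]
  · rw [← Matrix.toLin'_apply', Matrix.toLin'_toMatrix', LinearMap.range_comp, LinearEquiv.range,
      Submodule.map_top, Submodule.range_subtype]

variable [IsNoetherianRing S] [IsDomain S]

-- The kernel lies between `f • P` and `P`.
lemma finrank_ker_eq_of_smul_eq_zero {f : S} (hf : f ≠ 0) (hfZ : ∀ z : Z, f • z = 0)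
    {P : Type*} [AddCommGroup P] [Module S P] [Module.Free S P] [Module.Finite S P]
    (π : P →ₗ[S] Z) : finrank S (LinearMap.ker π) = finrank S P := by
  refine le_antisymm (Submodule.finrank_le _) ?_
  let mulF : P →ₗ[S] LinearMap.ker π := (f • LinearMap.id).codRestrict _ fun v => by simp [hfZ]
  have hmulF : Function.Injective mulF := fun v w hvw =>
    smul_right_injective _ hf (congrArg Subtype.val hvw)
  exact LinearMap.finrank_le_finrank_of_injective hmulF

theorem exists_isMatrixFactorization [IsLocalRing S] {f : S} (hf : f ≠ 0)
    (hfZ : ∀ z : Z, f • z = 0) [Module.Finite S Z] (hZ : ProjDimLT S Z 2) :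
    ∃ (n : ℕ) (Φ Ψ : Matrix (Fin n) (Fin n) S) (π : (Fin n → S) →ₗ[S] Z),
      IsMatrixFactorization f Φ Ψ ∧ Function.Surjective π ∧ Function.Exact Φ.mulVecLin π ∧
      ∀ i j, Φ i j ∈ maximalIdeal S := by
  obtain ⟨n, π, hπ, hker⟩ := exists_minimal_cover S Z
  have hK : Module.Projective S (LinearMap.ker π) := ProjDimLT.one_iff.1 (hZ.ker hπ)
  have hfree : Module.Free S (LinearMap.ker π) := Module.free_of_flat_of_isLocalRing
  have hrank : finrank S (LinearMap.ker π) = n := by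
    rw [finrank_ker_eq_of_smul_eq_zero hf hfZ, finrank_fin_fun]
  obtain ⟨Φ, Ψ, hΦΨ, hrange⟩ := exists_isMatrixFactorization_of_equiv_ker hfZ
    (finBasisOfFinrankEq S _ hrank).equivFun
  refine ⟨n, Φ, Ψ, π, hΦΨ, hπ, LinearMap.exact_iff.2 hrange.symm, fun i j => ?_⟩
  have hcol : Φ.mulVec (Pi.single j 1) ∈ LinearMap.ker π := hrange ▸ LinearMap.mem_range_self _ _
  simpa using hker _ hcol i

end Presentation

/-! ### Herbrand differences of 2-periodic complexes -/

section MiddleHomology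

open LinearMap

variable {R : Type*} [CommRing R] {U V W : Type*} [AddCommGroup U] [Module R U]
  [AddCommGroup V] [Module R V] [AddCommGroup W] [Module R W]

/-- The homology `ker g / (ker g ∩ im f)` of a pair of composable linear maps. The composite is not
required to vanish. -/
abbrev MiddleHomology (f : U →ₗ[R] V) (g : V →ₗ[R] W) : Type _ :=
  ker g ⧸ (range f).comap (ker g).subtype

namespace MiddleHomology

variable {f : U →ₗ[R] V} {g : V →ₗ[R] W}

lemma nonempty_equiv {K H : Type*} [AddCommGroup K] [Module R K] [AddCommGroup H] [Module R H]
    {k : K →ₗ[R] V} {q : K →ₗ[R] H} (hk : Function.Injective k) (hkg : Function.Exact k g)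
    (hq : Function.Surjective q) (hfq : ∀ x, q x = 0 ↔ k x ∈ range f) :
    Nonempty (H ≃ₗ[R] MiddleHomology f g) := by
  let e : K ≃ₗ[R] ker g := (LinearEquiv.ofInjective k hk).trans
    (LinearEquiv.ofEq _ _ hkg.linearMap_ker_eq.symm)
  have hmap : (ker q).map e.toLinearMap = (range f).comap (ker g).subtype := by
    ext x
    obtain ⟨y, rfl⟩ := e.surjective x
    exact (Submodule.mem_map_equiv (e := e) _).trans (by rw [e.symm_apply_apply]; exact hfq y)
  exact ⟨(q.quotKerEquivOfSurjective hq).symm.trans (Submodule.Quotient.equiv _ _ e hmap)⟩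

lemma length_eq_of_equiv {U' V' W' : Type*} [AddCommGroup U'] [Module R U']
    [AddCommGroup V'] [Module R V'] [AddCommGroup W'] [Module R W']
    {f' : U' →ₗ[R] V'} {g' : V' →ₗ[R] W'} (e : V ≃ₗ[R] V') (hg : ∀ v, g v = 0 ↔ g' (e v) = 0)
    (hf : ∀ v, v ∈ range f ↔ e v ∈ range f') :
    Module.length R (MiddleHomology f g) = Module.length R (MiddleHomology f' g') := by
  have hexact : Function.Exact (e.toLinearMap ∘ₗ (ker g).subtype) g' := by
    intro v
    obtain ⟨w, rfl⟩ := e.surjective v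
    rw [← hg]
    exact ⟨fun hw => ⟨⟨w, hw⟩, rfl⟩, fun ⟨x, hx⟩ => e.injective hx ▸ x.2⟩
  obtain ⟨E⟩ := nonempty_equiv (f := f') (k := e.toLinearMap ∘ₗ (ker g).subtype)
    (e.injective.comp (Submodule.injective_subtype _)) hexact
    (Submodule.mkQ_surjective ((range f).comap (ker g).subtype)) fun x => by
      rw [Submodule.mkQ_apply, Submodule.Quotient.mk_eq_zero, Submodule.mem_comap]
      exact hf _
  exact E.length_eq

lemma length_eq_of_comm {U' V' W' : Type*} [AddCommGroup U'] [Module R U']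
    [AddCommGroup V'] [Module R V'] [AddCommGroup W'] [Module R W']
    {f' : U' →ₗ[R] V'} {g' : V' →ₗ[R] W'} (eU : U ≃ₗ[R] U') (eV : V ≃ₗ[R] V') (eW : W ≃ₗ[R] W')
    (hf : ∀ u, eV (f u) = f' (eU u)) (hg : ∀ v, eW (g v) = g' (eV v)) :
    Module.length R (MiddleHomology f g) = Module.length R (MiddleHomology f' g') := by
  refine length_eq_of_equiv eV (fun v => by rw [← hg, eW.map_eq_zero_iff]) fun v => ⟨?_, ?_⟩
  · rintro ⟨u, rfl⟩
    exact ⟨eU u, (hf u).symm⟩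
  · rintro ⟨u, hu⟩
    exact ⟨eU.symm u, eV.injective (by rw [hf, eU.apply_symm_apply, hu])⟩

lemma subsingleton_iff : Subsingleton (MiddleHomology f g) ↔ ker g ≤ range f := by
  rw [Submodule.Quotient.subsingleton_iff, Submodule.comap_subtype_eq_top]

lemma smul_eq_zero {a : R} (h : ∀ v, g v = 0 → a • v ∈ range f) (x : MiddleHomology f g) :
    a • x = 0 := by
  obtain ⟨v, rfl⟩ := Submodule.mkQ_surjective _ x
  rw [← map_smul, Submodule.mkQ_apply, Submodule.Quotient.mk_eq_zero]
  exact h v.1 v.2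

variable {a b : U →ₗ[R] U}

variable (a b) in
/-- The map `U / im b → ker b` induced by `a`. For a 2-periodic complex `(a, b)` its kernel and
cokernel are the two homology modules, so that the snake lemma yields their exact hexagon. -/
def quotRangeToKer (hab : ∀ x, a (b x) = 0) (hba : ∀ x, b (a x) = 0) :
    (U ⧸ range b) →ₗ[R] ker b :=
  (range b).liftQ (a.codRestrict _ hba) (by rintro _ ⟨x, rfl⟩; exact Subtype.ext (hab x))

variable (a b) in
/-- The inclusion of the homology `ker a / (ker a ∩ im b)` into `U / im b`. -/
def toQuotRange : MiddleHomology b a →ₗ[R] (U ⧸ range b) :=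
  Submodule.mapQ _ _ (ker a).subtype le_rfl

lemma injective_toQuotRange : Function.Injective (toQuotRange a b) := by
  rw [← ker_eq_bot]
  exact Submodule.ker_liftQ_eq_bot _ _ _ (by intro x hx; simpa using hx)

lemma exact_toQuotRange (hab : ∀ x, a (b x) = 0) (hba : ∀ x, b (a x) = 0) :
    Function.Exact (toQuotRange a b) (quotRangeToKer a b hab hba) := by
  intro x
  obtain ⟨x, rfl⟩ := Submodule.mkQ_surjective _ x
  constructor
  · intro hx
    exact ⟨Submodule.Quotient.mk ⟨x, congrArg Subtype.val hx⟩, rfl⟩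
  · rintro ⟨y, hy⟩
    obtain ⟨y, rfl⟩ := Submodule.mkQ_surjective _ y
    rw [← hy]
    exact Subtype.ext y.2

lemma exact_quotRangeToKer (hab : ∀ x, a (b x) = 0) (hba : ∀ x, b (a x) = 0) :
    Function.Exact (quotRangeToKer a b hab hba) (((range a).comap (ker b).subtype).mkQ) := by
  intro x
  rw [Submodule.mkQ_apply, Submodule.Quotient.mk_eq_zero]
  constructor
  · rintro ⟨y, hy⟩
    exact ⟨Submodule.Quotient.mk y, Subtype.ext hy⟩
  · rintro ⟨y, hy⟩
    obtain ⟨y, rfl⟩ := Submodule.mkQ_surjective _ y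
    exact ⟨y, congrArg Subtype.val hy⟩

end MiddleHomology

lemma length_eq_length_range_add_length_range {f : U →ₗ[R] V} {g : V →ₗ[R] W}
    (h : Function.Exact f g) :
    Module.length R V = Module.length R (range f) + Module.length R (range g) :=
  Module.length_eq_add_of_exact (range f).subtype g.rangeRestrict (Submodule.injective_subtype _)
    g.surjective_rangeRestrict
    (exact_iff.2 (by rw [ker_rangeRestrict, h.linearMap_ker_eq, Submodule.range_subtype]))

lemma exact_restrict_ker {U₁ U₂ U₃ W₁ W₂ W₃ : Type*} [AddCommGroup U₁] [Module R U₁]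
    [AddCommGroup U₂] [Module R U₂] [AddCommGroup U₃] [Module R U₃] [AddCommGroup W₁] [Module R W₁]
    [AddCommGroup W₂] [Module R W₂] [AddCommGroup W₃] [Module R W₃] {i : U₁ →ₗ[R] U₂}
    {p : U₂ →ₗ[R] U₃} {g₁ : U₁ →ₗ[R] W₁} {g₂ : U₂ →ₗ[R] W₂} {g₃ : U₃ →ₗ[R] W₃}
    {j : W₁ →ₗ[R] W₂} (hj : Function.Injective j) (hip : Function.Exact i p)
    (hi : ∀ x ∈ ker g₁, i x ∈ ker g₂) (hp : ∀ x ∈ ker g₂, p x ∈ ker g₃)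
    (hg : ∀ x, j (g₁ x) = g₂ (i x)) : Function.Exact (i.restrict hi) (p.restrict hp) := by
  intro x
  constructor
  · intro hx
    obtain ⟨w, hw⟩ := (hip x.1).1 (congrArg Subtype.val hx)
    exact ⟨⟨w, hj (by rw [hg, hw, x.2, map_zero])⟩, Subtype.ext hw⟩
  · rintro ⟨w, rfl⟩
    exact Subtype.ext (hip.apply_apply_eq_zero w.1)

/-- A short exact sequence `0 → (U₁, a₁, b₁) → (U₂, a₂, b₂) → (U₃, a₃, b₃) → 0` of 2-periodic
complexes, with maps `i` and `p`. -/
structure IsPeriodicShortExact {U₁ U₂ U₃ : Type*} [AddCommGroup U₁] [Module R U₁]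
    [AddCommGroup U₂] [Module R U₂] [AddCommGroup U₃] [Module R U₃]
    (i : U₁ →ₗ[R] U₂) (p : U₂ →ₗ[R] U₃) (a₁ b₁ : U₁ →ₗ[R] U₁) (a₂ b₂ : U₂ →ₗ[R] U₂)
    (a₃ b₃ : U₃ →ₗ[R] U₃) : Prop where
  injective : Function.Injective i
  exact : Function.Exact i p
  surjective : Function.Surjective p
  map_a₁ : ∀ x, i (a₁ x) = a₂ (i x)
  map_b₁ : ∀ x, i (b₁ x) = b₂ (i x)
  map_a₂ : ∀ x, p (a₂ x) = a₃ (p x)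
  map_b₂ : ∀ x, p (b₂ x) = b₃ (p x)
  a₁_b₁ : ∀ x, a₁ (b₁ x) = 0
  b₁_a₁ : ∀ x, b₁ (a₁ x) = 0
  a₂_b₂ : ∀ x, a₂ (b₂ x) = 0
  b₂_a₂ : ∀ x, b₂ (a₂ x) = 0
  a₃_b₃ : ∀ x, a₃ (b₃ x) = 0
  b₃_a₃ : ∀ x, b₃ (a₃ x) = 0

namespace IsPeriodicShortExact

variable {U₁ U₂ U₃ : Type*} [AddCommGroup U₁] [Module R U₁] [AddCommGroup U₂] [Module R U₂]
  [AddCommGroup U₃] [Module R U₃] {i : U₁ →ₗ[R] U₂} {p : U₂ →ₗ[R] U₃}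
  {a₁ b₁ : U₁ →ₗ[R] U₁} {a₂ b₂ : U₂ →ₗ[R] U₂} {a₃ b₃ : U₃ →ₗ[R] U₃}

lemma swap (h : IsPeriodicShortExact i p a₁ b₁ a₂ b₂ a₃ b₃) :
    IsPeriodicShortExact i p b₁ a₁ b₂ a₂ b₃ a₃ :=
  ⟨h.injective, h.exact, h.surjective, h.map_b₁, h.map_a₁, h.map_b₂, h.map_a₂, h.b₁_a₁, h.a₁_b₁,
    h.b₂_a₂, h.a₂_b₂, h.b₃_a₃, h.a₃_b₃⟩

variable (h : IsPeriodicShortExact i p a₁ b₁ a₂ b₂ a₃ b₃)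
include h

lemma map_ker_left : ∀ x ∈ ker a₁, i x ∈ ker a₂ := fun x hx => by
  rw [mem_ker, ← h.map_a₁, hx, map_zero]

lemma map_ker_right : ∀ x ∈ ker a₂, p x ∈ ker a₃ := fun x hx => by
  rw [mem_ker, ← h.map_a₂, hx, map_zero]

lemma range_le_comap_left : range b₁ ≤ (range b₂).comap i := by
  rintro _ ⟨x, rfl⟩
  exact ⟨i x, (h.map_b₁ x).symm⟩

lemma range_le_comap_right : range b₂ ≤ (range b₃).comap p := by
  rintro _ ⟨x, rfl⟩
  exact ⟨p x, (h.map_b₂ x).symm⟩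

/-- The map induced by `i` on the homology `ker a / im b`. -/
def mapLeft : MiddleHomology b₁ a₁ →ₗ[R] MiddleHomology b₂ a₂ :=
  Submodule.mapQ _ _ (i.restrict h.map_ker_left) fun _ hx => h.range_le_comap_left hx

/-- The map induced by `p` on the homology `ker a / im b`. -/
def mapRight : MiddleHomology b₂ a₂ →ₗ[R] MiddleHomology b₃ a₃ :=
  Submodule.mapQ _ _ (p.restrict h.map_ker_right) fun _ hx => h.range_le_comap_right hx

lemma exact_restrict_ker : Function.Exact (i.restrict h.map_ker_left)
    (p.restrict h.map_ker_right) :=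
  _root_.exact_restrict_ker h.injective h.exact _ _ h.map_a₁

lemma exact_mapLeft_mapRight : Function.Exact h.mapLeft h.mapRight := by
  refine (h.exact_restrict_ker.exact_mapQ_iff _ _).2 ?_
  rintro _ ⟨⟨x, rfl⟩, z, hz⟩
  obtain ⟨y, rfl⟩ := h.surjective z
  exact ⟨⟨b₂ y, h.a₂_b₂ y⟩, ⟨y, rfl⟩, Subtype.ext ((h.map_b₂ y).trans hz)⟩

lemma exact_mapQ_range : Function.Exact (Submodule.mapQ _ _ i h.range_le_comap_left)
    (Submodule.mapQ _ _ p h.range_le_comap_right) := by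
  refine (h.exact.exact_mapQ_iff _ _).2 ?_
  rintro _ ⟨-, z, rfl⟩
  obtain ⟨y, rfl⟩ := h.surjective z
  exact ⟨b₂ y, ⟨y, rfl⟩, h.map_b₂ y⟩

lemma exists_connecting : ∃ δ : MiddleHomology b₃ a₃ →ₗ[R] MiddleHomology a₁ b₁,
    Function.Exact h.mapRight δ ∧ Function.Exact δ h.swap.mapLeft := by
  have hsurj : Function.Surjective (Submodule.mapQ _ _ p h.range_le_comap_right) :=
    range_eq_top.1 (by
      rw [Submodule.range_mapQ, range_eq_top.2 h.surjective, Submodule.map_top,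
        Submodule.range_mkQ])
  have hinj : Function.Injective (i.restrict h.swap.map_ker_left) := fun x y hxy =>
    Subtype.ext (h.injective (congrArg Subtype.val hxy))
  have h₁₂ : i.restrict h.swap.map_ker_left ∘ₗ
      MiddleHomology.quotRangeToKer a₁ b₁ h.a₁_b₁ h.b₁_a₁ =
      MiddleHomology.quotRangeToKer a₂ b₂ h.a₂_b₂ h.b₂_a₂ ∘ₗ
        Submodule.mapQ _ _ i h.range_le_comap_left := by
    ext x
    exact h.map_a₁ x
  have h₂₃ : p.restrict h.swap.map_ker_right ∘ₗ
      MiddleHomology.quotRangeToKer a₂ b₂ h.a₂_b₂ h.b₂_a₂ =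
      MiddleHomology.quotRangeToKer a₃ b₃ h.a₃_b₃ h.b₃_a₃ ∘ₗ
        Submodule.mapQ _ _ p h.range_le_comap_right := by
    ext x
    exact h.map_a₂ x
  exact ⟨SnakeLemma.δ' _ _ _ _ _ h.exact_mapQ_range _ _ h.swap.exact_restrict_ker h₁₂ h₂₃ _
      (MiddleHomology.exact_toQuotRange h.a₃_b₃ h.b₃_a₃) _
      (MiddleHomology.exact_quotRangeToKer h.a₁_b₁ h.b₁_a₁) hsurj hinj,
    SnakeLemma.exact_δ'_right _ _ _ _ _ h.exact_mapQ_range _ _ h.swap.exact_restrict_ker h₁₂ h₂₃ _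
      (MiddleHomology.exact_toQuotRange h.a₂_b₂ h.b₂_a₂) _ _ _ _ hsurj hinj h.mapRight
      (by ext; rfl) MiddleHomology.injective_toQuotRange,
    SnakeLemma.exact_δ'_left _ _ _ _ _ h.exact_mapQ_range _ _ h.swap.exact_restrict_ker h₁₂ h₂₃ _
      _ _ _ _ (MiddleHomology.exact_quotRangeToKer h.a₂_b₂ h.b₂_a₂) hsurj hinj h.swap.mapLeft
      (by ext; rfl) (Submodule.mkQ_surjective _)⟩

theorem length_homology_add :
    Module.length R (MiddleHomology b₂ a₂) + Module.length R (MiddleHomology a₁ b₁) +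
        Module.length R (MiddleHomology a₃ b₃) =
      Module.length R (MiddleHomology b₁ a₁) + Module.length R (MiddleHomology b₃ a₃) +
        Module.length R (MiddleHomology a₂ b₂) := by
  obtain ⟨δ, hδ, hδ'⟩ := h.exists_connecting
  obtain ⟨ε, hε, hε'⟩ := h.swap.exists_connecting
  rw [length_eq_length_range_add_length_range h.exact_mapLeft_mapRight,
    length_eq_length_range_add_length_range h.swap.exact_mapLeft_mapRight,
    length_eq_length_range_add_length_range hδ, length_eq_length_range_add_length_range hδ',
    length_eq_length_range_add_length_range hε, length_eq_length_range_add_length_range hε']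
  abel

end IsPeriodicShortExact

end MiddleHomology

/-! ### Exact pairs of matrices -/

section MatrixAct

variable {R : Type*} [CommRing R] {ι κ μ : Type*} [Fintype κ] [Fintype μ]
  {X X' : Type*} [AddCommGroup X] [Module R X] [AddCommGroup X'] [Module R X']

variable (X) in
/-- The linear map `X^κ → X^ι` given by a matrix with entries in the base ring. -/
def matrixAct (A : Matrix ι κ R) : (κ → X) →ₗ[R] (ι → X) :=
  LinearMap.pi fun i => ∑ j, A i j • LinearMap.proj j

lemma matrixAct_apply (A : Matrix ι κ R) (v : κ → X) (i : ι) :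
    matrixAct X A v i = ∑ j, A i j • v j := by
  simp [matrixAct]

lemma matrixAct_mul (A : Matrix ι κ R) (B : Matrix κ μ R) (v : μ → X) :
    matrixAct X (A * B) v = matrixAct X A (matrixAct X B v) := by
  ext i
  simp only [matrixAct_apply, Matrix.mul_apply, Finset.sum_smul, Finset.smul_sum, smul_smul]
  exact Finset.sum_comm

lemma matrixAct_add (A B : Matrix ι κ R) (v : κ → X) :
    matrixAct X (A + B) v = matrixAct X A v + matrixAct X B v := by
  ext i
  simp [matrixAct_apply, add_smul, Finset.sum_add_distrib]

@[simp]
lemma matrixAct_zero (v : κ → X) : matrixAct X (0 : Matrix ι κ R) v = 0 := by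
  ext i
  simp [matrixAct_apply]

lemma matrixAct_smul_one [DecidableEq κ] (r : R) (v : κ → X) :
    matrixAct X (r • (1 : Matrix κ κ R)) v = r • v := by
  ext i
  simp [matrixAct_apply, Matrix.one_apply]

lemma compLeft_matrixAct (g : X →ₗ[R] X') (A : Matrix ι κ R) (v : κ → X) :
    g.compLeft ι (matrixAct X A v) = matrixAct X' A (g.compLeft κ v) := by
  ext i
  simp [matrixAct_apply, map_sum]

lemma matrixAct_eq_mulVec (A : Matrix ι κ R) (v : κ → R) : matrixAct R A v = A.mulVec v := by
  ext i
  simp [matrixAct_apply, Matrix.mulVec, dotProduct]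

lemma exists_eq_mul_of_forall_col_mem_range {ν : Type*} {B : Matrix ι κ R} {G : Matrix ι ν R}
    (h : ∀ j, (fun i => G i j) ∈ Set.range B.mulVec) : ∃ W : Matrix κ ν R, G = B * W := by
  choose w hw using h
  exact ⟨Matrix.of fun i j => w j i, Matrix.ext fun i j => (congrFun (hw j) i).symm⟩

lemma exists_eq_mul_of_exact {ν : Type*} {A : Matrix ι κ R} {B : Matrix κ μ R}
    (h : Function.Exact B.mulVec A.mulVec) {G : Matrix κ ν R} (hG : A * G = 0) :
    ∃ W : Matrix μ ν R, G = B * W :=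
  exists_eq_mul_of_forall_col_mem_range fun j =>
    (h _).1 (funext fun i => congrFun (congrFun hG i) j)

end MatrixAct

/-- `(φ, ψ)` is a pair of square matrices giving an exact 2-periodic complex whose transpose is
exact, too. These are the reductions modulo `f` of the matrix factorizations of `f`. -/
structure IsExactPair {R : Type*} [CommRing R] {n : ℕ} (φ ψ : Matrix (Fin n) (Fin n) R) :
    Prop where
  exact : Function.Exact ψ.mulVec φ.mulVec
  exact' : Function.Exact φ.mulVec ψ.mulVec
  exact_transpose : Function.Exact ψ.transpose.mulVec φ.transpose.mulVec
  exact_transpose' : Function.Exact φ.transpose.mulVec ψ.transpose.mulVec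

namespace IsExactPair

variable {R : Type*} [CommRing R] {n : ℕ} {φ ψ : Matrix (Fin n) (Fin n) R}

lemma swap (h : IsExactPair φ ψ) : IsExactPair ψ φ :=
  ⟨h.exact', h.exact, h.exact_transpose', h.exact_transpose⟩

lemma transpose (h : IsExactPair φ ψ) : IsExactPair φ.transpose ψ.transpose :=
  ⟨h.exact_transpose, h.exact_transpose', h.exact, h.exact'⟩

lemma mul_eq_zero (h : IsExactPair φ ψ) : φ * ψ = 0 :=
  Matrix.mulVec_injective (funext fun v => by
    rw [← Matrix.mulVec_mulVec, h.exact.apply_apply_eq_zero, Matrix.zero_mulVec])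

lemma exists_eq_mul_left {κ : Type*} (h : IsExactPair φ ψ)
    {G : Matrix (Fin n) κ R} (hG : φ * G = 0) : ∃ W : Matrix (Fin n) κ R, G = ψ * W :=
  exists_eq_mul_of_exact h.exact hG

lemma exists_eq_mul_right {κ : Type*} (h : IsExactPair φ ψ)
    {G : Matrix κ (Fin n) R} (hG : G * φ = 0) : ∃ W : Matrix κ (Fin n) R, G = W * ψ := by
  obtain ⟨W, hW⟩ := h.transpose.exists_eq_mul_left (G := G.transpose)
    (by rw [← Matrix.transpose_mul, hG, Matrix.transpose_zero])
  exact ⟨W.transpose, by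
    rw [← Matrix.transpose_transpose G, hW, Matrix.transpose_mul, Matrix.transpose_transpose]⟩

lemma matrixAct_matrixAct (h : IsExactPair φ ψ) (X : Type*) [AddCommGroup X] [Module R X]
    (v : Fin n → X) : matrixAct X φ (matrixAct X ψ v) = 0 := by
  rw [← matrixAct_mul, h.mul_eq_zero, matrixAct_zero]

end IsExactPair

namespace IsMatrixFactorization

variable {S R : Type u} [CommRing S] [CommRing R] [Algebra S R] {f : S} {n : ℕ}
  {Φ Ψ : Matrix (Fin n) (Fin n) S}

lemma exact_map (hR : IsHypersurfaceQuotient S R f) (h : IsMatrixFactorization f Φ Ψ) :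
    Function.Exact (Ψ.map (algebraMap S R)).mulVec (Φ.map (algebraMap S R)).mulVec := by
  have := hR.isRegularLocalRing
  have hf0 : algebraMap S R f = 0 := (hR.algebraMap_eq_zero_iff f).2 dvd_rfl
  have hmul : Φ.map (algebraMap S R) * Ψ.map (algebraMap S R) = 0 := by
    rw [← Matrix.map_mul, h.mul_eq, Matrix.map_smul' _ _ _ (map_mul _), hf0, zero_smul]
  intro v
  constructor
  · intro hv
    choose w hw using fun i => hR.surjective (v i)
    obtain rfl : algebraMap S R ∘ w = v := funext hw
    have hdvd : ∀ i, f ∣ Φ.mulVec w i := fun i => (hR.algebraMap_eq_zero_iff _).1 (by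
      rw [RingHom.map_mulVec]
      exact congrFun hv i)
    choose u hu using hdvd
    have hw : Φ.mulVec (w - Ψ.mulVec u) = 0 := by
      rw [Matrix.mulVec_sub, Matrix.mulVec_mulVec, h.mul_eq, Matrix.smul_mulVec,
        Matrix.one_mulVec, sub_eq_zero]
      exact funext hu
    refine ⟨algebraMap S R ∘ u, ?_⟩
    rw [sub_eq_zero.1 (h.mulVec_injective hR.ne_zero hw)]
    ext i
    exact (RingHom.map_mulVec (algebraMap S R) Ψ u i).symm
  · rintro ⟨w, rfl⟩
    rw [Matrix.mulVec_mulVec, hmul, Matrix.zero_mulVec]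

lemma isExactPair (hR : IsHypersurfaceQuotient S R f) (h : IsMatrixFactorization f Φ Ψ) :
    IsExactPair (Φ.map (algebraMap S R)) (Ψ.map (algebraMap S R)) :=
  ⟨h.exact_map hR, h.swap.exact_map hR, h.transpose.exact_map hR, h.transpose.swap.exact_map hR⟩

end IsMatrixFactorization

/-! ### The theta invariant of an exact pair of matrices -/

section PairTheta

variable {R : Type u} [CommRing R] {n : ℕ} (φ ψ : Matrix (Fin n) (Fin n) R)

/-- The homology `ker φ / im ψ` on `X^n`. -/
abbrev PairHomology (X : Type*) [AddCommGroup X] [Module R X] : Type _ :=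
  MiddleHomology (matrixAct X ψ) (matrixAct X φ)

/-- The two homology modules of the pair have finite length for all finitely generated coefficient
modules, so that `pairTheta` does not involve the junk value `ENat.toNat ⊤ = 0`. -/
def HasFiniteHomology : Prop :=
  ∀ (X : Type u) [AddCommGroup X] [Module R X] [Module.Finite R X],
    Module.length R (PairHomology φ ψ X) ≠ ⊤ ∧ Module.length R (PairHomology ψ φ X) ≠ ⊤

/-- The difference of the lengths of the two homology modules: Hochster's theta invariant in terms
of a 2-periodic resolution. -/
noncomputable def pairTheta (X : Type*) [AddCommGroup X] [Module R X] : ℤ :=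
  (Module.length R (PairHomology φ ψ X)).toNat - (Module.length R (PairHomology ψ φ X)).toNat

variable {φ ψ}

lemma exact_compLeft {X₁ X₂ X₃ : Type*} [AddCommGroup X₁] [Module R X₁] [AddCommGroup X₂]
    [Module R X₂] [AddCommGroup X₃] [Module R X₃] {i : X₁ →ₗ[R] X₂} {p : X₂ →ₗ[R] X₃}
    (hip : Function.Exact i p) (ι : Type*) : Function.Exact (i.compLeft ι) (p.compLeft ι) :=
  LinearMap.exact_iff.2 (by
    rw [LinearMap.ker_compLeft, LinearMap.range_compLeft, hip.linearMap_ker_eq])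

namespace IsExactPair

section ShortExact

variable {X₁ X₂ X₃ : Type u} [AddCommGroup X₁] [Module R X₁] [AddCommGroup X₂] [Module R X₂]
  [AddCommGroup X₃] [Module R X₃] {i : X₁ →ₗ[R] X₂} {p : X₂ →ₗ[R] X₃}

lemma isPeriodicShortExact (h : IsExactPair φ ψ) (hi : Function.Injective i)
    (hip : Function.Exact i p) (hp : Function.Surjective p) :
    IsPeriodicShortExact (i.compLeft (Fin n)) (p.compLeft (Fin n)) (matrixAct X₁ φ)
      (matrixAct X₁ ψ) (matrixAct X₂ φ) (matrixAct X₂ ψ) (matrixAct X₃ φ) (matrixAct X₃ ψ) where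
  injective := hi.comp_left
  exact := exact_compLeft hip _
  surjective := hp.comp_left
  map_a₁ := compLeft_matrixAct i φ
  map_b₁ := compLeft_matrixAct i ψ
  map_a₂ := compLeft_matrixAct p φ
  map_b₂ := compLeft_matrixAct p ψ
  a₁_b₁ := h.matrixAct_matrixAct X₁
  b₁_a₁ := h.swap.matrixAct_matrixAct X₁
  a₂_b₂ := h.matrixAct_matrixAct X₂
  b₂_a₂ := h.swap.matrixAct_matrixAct X₂
  a₃_b₃ := h.matrixAct_matrixAct X₃
  b₃_a₃ := h.swap.matrixAct_matrixAct X₃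

lemma pairTheta_add (h : IsExactPair φ ψ) (hfin : HasFiniteHomology φ ψ) [Module.Finite R X₁]
    [Module.Finite R X₂] [Module.Finite R X₃] (hi : Function.Injective i)
    (hip : Function.Exact i p) (hp : Function.Surjective p) :
    pairTheta φ ψ X₂ = pairTheta φ ψ X₁ + pairTheta φ ψ X₃ := by
  have hadd := (h.isPeriodicShortExact hi hip hp).length_homology_add
  obtain ⟨a₁, b₁⟩ := hfin X₁
  obtain ⟨a₂, b₂⟩ := hfin X₂
  obtain ⟨a₃, b₃⟩ := hfin X₃
  unfold pairTheta
  lift Module.length R (PairHomology φ ψ X₁) to ℕ using a₁ with x₁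
  lift Module.length R (PairHomology φ ψ X₂) to ℕ using a₂ with x₂
  lift Module.length R (PairHomology φ ψ X₃) to ℕ using a₃ with x₃
  lift Module.length R (PairHomology ψ φ X₁) to ℕ using b₁ with y₁
  lift Module.length R (PairHomology ψ φ X₂) to ℕ using b₂ with y₂
  lift Module.length R (PairHomology ψ φ X₃) to ℕ using b₃ with y₃
  norm_cast at hadd
  simp only [ENat.toNat_natCast]
  omega

lemma pairTheta_quotSMulTop (h : IsExactPair φ ψ) (hfin : HasFiniteHomology φ ψ) {x : R}
    [Module.Finite R X₁] (hx : IsSMulRegular X₁ x) : pairTheta φ ψ (QuotSMulTop x X₁) = 0 := by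
  have := h.pairTheta_add hfin (i := LinearMap.lsmul R X₁ x) hx
    (LinearMap.exact_lsmul_mkQ_smul_top X₁ x) (Submodule.mkQ_surjective _)
  simpa using this

end ShortExact

lemma subsingleton_of_free (h : IsExactPair φ ψ) (X : Type*) [AddCommGroup X]
    [Module R X] [Module.Free R X] [Module.Finite R X] : Subsingleton (PairHomology φ ψ X) := by
  rw [MiddleHomology.subsingleton_iff]
  intro v hv
  let b := Module.Free.chooseBasis R X
  have hcoord : ∀ k, (b.coord k).compLeft (Fin n) v ∈ Set.range ψ.mulVec := fun k =>
    (h.exact _).1 (by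
      rw [← matrixAct_eq_mulVec, ← compLeft_matrixAct, LinearMap.mem_ker.1 hv, map_zero])
  choose w hw using hcoord
  refine ⟨fun j => ∑ k, w k j • b k, funext fun i => b.ext_elem fun k => ?_⟩
  have hk := congrFun (hw k) i
  simp only [LinearMap.compLeft_apply, Function.comp_apply, Basis.coord_apply] at hk
  rw [← hk]
  simp [matrixAct_apply, Matrix.mulVec, dotProduct, Finsupp.single_apply]

end IsExactPair

lemma length_pairHomology_congr {X₁ X₂ : Type*} [AddCommGroup X₁] [Module R X₁]
    [AddCommGroup X₂] [Module R X₂] (e : X₁ ≃ₗ[R] X₂) :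
    Module.length R (PairHomology φ ψ X₁) = Module.length R (PairHomology φ ψ X₂) := by
  have hnat : ∀ (A : Matrix (Fin n) (Fin n) R) (v : Fin n → X₁),
      LinearEquiv.piCongrRight (fun _ : Fin n => e) (matrixAct X₁ A v) =
        matrixAct X₂ A (LinearEquiv.piCongrRight (fun _ : Fin n => e) v) :=
    fun A v => compLeft_matrixAct e.toLinearMap A v
  refine MiddleHomology.length_eq_of_equiv (LinearEquiv.piCongrRight fun _ => e)
    (fun v => by rw [← hnat, LinearEquiv.map_eq_zero_iff]) (fun v => ⟨?_, ?_⟩)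
  · rintro ⟨w, rfl⟩
    exact ⟨_, (hnat ψ w).symm⟩
  · rintro ⟨w, hw⟩
    refine ⟨(LinearEquiv.piCongrRight fun _ => e).symm w,
      (LinearEquiv.piCongrRight (fun _ : Fin n => e)).injective ?_⟩
    rw [hnat, LinearEquiv.apply_symm_apply, hw]

lemma pairTheta_congr {X₁ X₂ : Type*} [AddCommGroup X₁] [Module R X₁] [AddCommGroup X₂]
    [Module R X₂] (e : X₁ ≃ₗ[R] X₂) : pairTheta φ ψ X₁ = pairTheta φ ψ X₂ := by
  rw [pairTheta, pairTheta, length_pairHomology_congr e, length_pairHomology_congr e]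

lemma pairTheta_eq_zero_of_subsingleton {X : Type*} [AddCommGroup X] [Module R X]
    [Subsingleton X] : pairTheta φ ψ X = 0 := by
  simp [pairTheta]

lemma IsExactPair.pairTheta_eq_zero_of_free (h : IsExactPair φ ψ) (X : Type*) [AddCommGroup X]
    [Module R X] [Module.Free R X] [Module.Finite R X] : pairTheta φ ψ X = 0 := by
  have := h.subsingleton_of_free X
  have := h.swap.subsingleton_of_free X
  simp [pairTheta]

section FiniteLength

variable [IsLocalRing R]

lemma IsExactPair.pairTheta_eq_length_mul (h : IsExactPair φ ψ) (hfin : HasFiniteHomology φ ψ)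
    {E : Type u} [AddCommGroup E] [Module R E] (hE : IsFiniteLength R E) :
    pairTheta φ ψ E = (Module.length R E).toNat * pairTheta φ ψ (R ⧸ maximalIdeal R) := by
  induction hE with
  | of_subsingleton => simp [pairTheta_eq_zero_of_subsingleton]
  | @of_simple_quotient M _ _ N _ hN ih =>
    have hM : IsFiniteLength R M := .of_simple_quotient hN
    have := (isFiniteLength_iff_isNoetherian_isArtinian.1 hN).1
    have := (isFiniteLength_iff_isNoetherian_isArtinian.1 hM).1
    rw [h.pairTheta_add hfin (Submodule.injective_subtype N) (LinearMap.exact_subtype_mkQ N)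
      (Submodule.mkQ_surjective _), ih,
      Module.length_eq_add_of_exact N.subtype N.mkQ (Submodule.injective_subtype _)
      (Submodule.mkQ_surjective _) (LinearMap.exact_subtype_mkQ N)]
    obtain ⟨I, hI, ⟨e⟩⟩ := isSimpleModule_iff_quot_maximal.1 ‹IsSimpleModule R (M ⧸ N)›
    obtain rfl := IsLocalRing.eq_maximalIdeal hI
    rw [pairTheta_congr e, Module.length_eq_one_iff.2 ‹IsSimpleModule R (M ⧸ N)›,
      ENat.toNat_add (Module.length_ne_top_iff.2 hN) (by simp)]
    simp [add_mul]

variable [IsNoetherianRing R]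

lemma isArtinianRing_quotient_maximalIdeal_pow {R : Type*} [CommRing R] [IsLocalRing R]
    [IsNoetherianRing R] (k : ℕ) : IsArtinianRing (R ⧸ maximalIdeal R ^ k) := by
  rcases subsingleton_or_nontrivial (R ⧸ maximalIdeal R ^ k) with _ | _
  · infer_instance
  have := IsLocalRing.of_surjective' (Ideal.Quotient.mk (maximalIdeal R ^ k))
    Ideal.Quotient.mk_surjective
  refine isArtinianRing_iff_isNilpotent_maximalIdeal _ |>.2 ⟨k, ?_⟩
  rw [← map_maximalIdeal_of_surjective _ Ideal.Quotient.mk_surjective, ← Ideal.map_pow,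
    Ideal.map_quotient_self, Ideal.zero_eq_bot]

lemma isFiniteLength_of_pow_le_annihilator {R : Type*} [CommRing R] [IsLocalRing R]
    [IsNoetherianRing R] {k : ℕ} {T : Type*} [AddCommGroup T] [Module R T] [Module.Finite R T]
    (h : maximalIdeal R ^ k ≤ Module.annihilator R T) : IsFiniteLength R T := by
  have htors : Module.IsTorsionBySet R T (maximalIdeal R ^ k : Ideal R) := fun t r =>
    Module.mem_annihilator.1 (h r.2) t
  let _ := htors.module
  have := htors.isScalarTower (S := R)
  have := isArtinianRing_quotient_maximalIdeal_pow (R := R) k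
  have : Module.Finite (R ⧸ maximalIdeal R ^ k) T := .of_restrictScalars_finite R _ _
  rw [← Module.length_ne_top_iff,
    Module.length_eq_of_surjective (R := R ⧸ maximalIdeal R ^ k) Ideal.Quotient.mk_surjective,
    Module.length_ne_top_iff, isFiniteLength_iff_isNoetherian_isArtinian]
  exact ⟨inferInstance, inferInstance⟩

lemma exists_isSMulRegular_isFiniteLength_quotSMulTop {R : Type*} [CommRing R] [IsLocalRing R]
    [IsNoetherianRing R] (hdim : ∃ p : Ideal R, p.IsPrime ∧ p ≠ maximalIdeal R) :
    ∃ p : Ideal R, p.IsPrime ∧ ∃ x ∈ maximalIdeal R, IsSMulRegular (R ⧸ p) x ∧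
      IsFiniteLength R (QuotSMulTop x (R ⧸ p)) := by
  obtain ⟨p, ⟨hp, hpm⟩, hmax⟩ := set_has_maximal_iff_noetherian.2 ‹IsNoetherianRing R›
    {p : Ideal R | p.IsPrime ∧ p ≠ maximalIdeal R} hdim
  obtain ⟨x, hx, hxp⟩ := SetLike.exists_of_lt (lt_of_le_of_ne (le_maximalIdeal hp.ne_top) hpm)
  have hreg : IsSMulRegular (R ⧸ p) x := by
    rw [← isSMulRegular_algebraMap_iff (R ⧸ p)]
    exact IsSMulRegular.of_ne_zero (mt Ideal.Quotient.eq_zero_iff_mem.1 hxp)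
  have hrad : maximalIdeal R ≤ (Module.annihilator R (QuotSMulTop x (R ⧸ p))).radical := by
    rw [Ideal.radical_eq_sInf]
    refine le_sInf fun q ⟨hq, hqprime⟩ => ?_
    by_contra hqm
    have hpann : p ≤ Module.annihilator R (QuotSMulTop x (R ⧸ p)) :=
      (Ideal.annihilator_quotient (I := p)).ge.trans
        (LinearMap.annihilator_le_of_surjective _ (Submodule.mkQ_surjective _))
    refine hmax q ⟨hqprime, fun h => hqm h.ge⟩ (lt_of_le_of_ne (hpann.trans hq) ?_)
    rintro rfl
    exact hxp (hq (QuotSMulTop.mem_annihilator _ x))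
  obtain ⟨k, hk⟩ := Ideal.exists_pow_le_of_le_radical_of_fg hrad
    (maximalIdeal R).fg_of_isNoetherianRing
  exact ⟨p, hp, x, hx, hreg, isFiniteLength_of_pow_le_annihilator hk⟩

theorem IsExactPair.pairTheta_eq_zero_of_isFiniteLength (h : IsExactPair φ ψ)
    (hfin : HasFiniteHomology φ ψ) (hdim : ∃ p : Ideal R, p.IsPrime ∧ p ≠ maximalIdeal R)
    {E : Type u} [AddCommGroup E] [Module R E] (hE : IsFiniteLength R E) :
    pairTheta φ ψ E = 0 := by
  obtain ⟨p, hp, x, hx, hreg, hlen⟩ := exists_isSMulRegular_isFiniteLength_quotSMulTop hdim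
  have hnontriv := nontrivial_quotSMulTop_of_mem_maximalIdeal (R ⧸ p) hx
  have hmul := (h.pairTheta_eq_length_mul hfin hlen).symm.trans (h.pairTheta_quotSMulTop hfin hreg)
  rw [_root_.mul_eq_zero, Nat.cast_eq_zero, ENat.toNat_eq_zero] at hmul
  have hresidue : pairTheta φ ψ (R ⧸ maximalIdeal R) = 0 :=
    hmul.resolve_left (not_or.2 ⟨Module.length_pos.ne', Module.length_ne_top_iff.2 hlen⟩)
  rw [h.pairTheta_eq_length_mul hfin hE, hresidue, mul_zero]

end FiniteLength

end PairTheta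

/-! ### Tor-independent maximal Cohen–Macaulay modules over a hypersurface -/

/-- `X` is a cokernel of the square matrix `A`. -/
def IsCokerOf {S : Type*} [CommRing S] {p : ℕ} (A : Matrix (Fin p) (Fin p) S) (X : Type*)
    [AddCommGroup X] [Module S X] : Prop :=
  ∃ π : (Fin p → S) →ₗ[S] X, Function.Surjective π ∧ Function.Exact A.mulVecLin π

namespace IsCokerOf

variable {S X Y : Type*} [CommRing S] {p : ℕ} {A : Matrix (Fin p) (Fin p) S}
  [AddCommGroup X] [Module S X] [AddCommGroup Y] [Module S Y]

lemma nonempty_equiv (hX : IsCokerOf A X) (hY : IsCokerOf A Y) : Nonempty (X ≃ₗ[S] Y) := by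
  obtain ⟨π, hπ, hAπ⟩ := hX
  obtain ⟨ρ, hρ, hAρ⟩ := hY
  exact ⟨(π.quotKerEquivOfSurjective hπ).symm.trans ((Submodule.quotEquivOfEq _ _
    (hAπ.linearMap_ker_eq.trans hAρ.linearMap_ker_eq.symm)).trans
    (ρ.quotKerEquivOfSurjective hρ))⟩

protected lemma finite (hX : IsCokerOf A X) : Module.Finite S X :=
  let ⟨π, hπ, _⟩ := hX
  .of_surjective π hπ

end IsCokerOf

namespace IsMatrixFactorization

variable {S : Type u} [CommRing S] {f : S} {p : ℕ} {A B : Matrix (Fin p) (Fin p) S}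
  {X : Type u} [AddCommGroup X] [Module S X]

lemma mul_right_cancel [IsDomain S] (hf : f ≠ 0) (h : IsMatrixFactorization f A B)
    {κ : Type*} {U V : Matrix κ (Fin p) S} (hUV : U * A = V * A) : U = V := by
  have := congrArg (· * B) hUV
  simp only [Matrix.mul_assoc, h.mul_eq, Matrix.mul_smul, Matrix.mul_one] at this
  exact Matrix.ext fun i j => mul_left_cancel₀ hf (congrFun (congrFun this i) j)

lemma smul_eq_zero_of_isCokerOf (h : IsMatrixFactorization f A B) (hX : IsCokerOf A X) (x : X) :
    f • x = 0 := by
  obtain ⟨π, hπ, hAπ⟩ := hX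
  obtain ⟨v, rfl⟩ := hπ x
  rw [← map_smul, ← hAπ.apply_apply_eq_zero (B.mulVec v), Matrix.mulVecLin_apply,
    Matrix.mulVec_mulVec, h.mul_eq, Matrix.smul_mulVec, Matrix.one_mulVec]

lemma matrixAct_matrixAct (h : IsMatrixFactorization f A B) (hX : ∀ x : X, f • x = 0)
    (v : Fin p → X) : matrixAct X A (matrixAct X B v) = 0 := by
  rw [← matrixAct_mul, h.mul_eq, matrixAct_smul_one]
  exact funext fun i => hX (v i)

lemma projDimLT_two [IsDomain S] (hf : f ≠ 0) (h : IsMatrixFactorization f A B)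
    (hX : IsCokerOf A X) : ProjDimLT S X 2 := by
  obtain ⟨π, hπ, hAπ⟩ := hX
  have hinj : Function.Injective A.mulVecLin :=
    (injective_iff_map_eq_zero _).2 fun v hv => h.mulVec_injective hf hv
  exact ProjDimLT.right (n := 1) hinj hAπ hπ (ProjDimLT.one_iff.2 inferInstance)
    ((ProjDimLT.one_iff.2 inferInstance).mono one_le_two)

end IsMatrixFactorization

section Hypersurface

variable {S R : Type u} [CommRing S] [CommRing R] [Algebra S R] {f : S} {p : ℕ}
  {A B : Matrix (Fin p) (Fin p) S} {X : Type u} [AddCommGroup X] [Module S X] [Module R X]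
  [IsScalarTower S R X]

lemma IsHypersurfaceQuotient.smul_eq_zero (hR : IsHypersurfaceQuotient S R f) (x : X) :
    f • x = 0 := by
  rw [← algebraMap_smul R, (hR.algebraMap_eq_zero_iff f).2 dvd_rfl, zero_smul]

lemma IsMatrixFactorization.exact_comp_algebraMap_iff (hR : IsHypersurfaceQuotient S R f)
    (h : IsMatrixFactorization f A B) (ρ : (Fin p → R) →ₗ[R] X) :
    Function.Exact A.mulVecLin
        (ρ.restrictScalars S ∘ₗ (Algebra.linearMap S R).compLeft (Fin p)) ↔
      Function.Exact (A.map (algebraMap S R)).mulVecLin ρ := by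
  have hmap (v : Fin p → S) : (A.map (algebraMap S R)).mulVecLin (algebraMap S R ∘ v) =
      algebraMap S R ∘ A.mulVecLin v := funext fun i => (RingHom.map_mulVec _ A v i).symm
  have hlift (v : Fin p → R) : ∃ w : Fin p → S, algebraMap S R ∘ w = v :=
    hR.surjective.comp_left v
  have hrange (v : Fin p → S) : algebraMap S R ∘ v ∈ Set.range (A.map (algebraMap S R)).mulVecLin ↔
      v ∈ Set.range A.mulVecLin := by
    refine ⟨fun ⟨w, hw⟩ => ?_, fun ⟨w, hw⟩ => ⟨algebraMap S R ∘ w, by rw [hmap, hw]⟩⟩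
    obtain ⟨w, rfl⟩ := hlift w
    have hdvd (i) : f ∣ v i - A.mulVec w i := (hR.algebraMap_eq_zero_iff _).1 (by
      rw [map_sub, sub_eq_zero]
      exact congrFun (hw.symm.trans (hmap w)) i)
    choose u hu using hdvd
    refine ⟨w + B.mulVec u, ?_⟩
    rw [map_add, Matrix.mulVecLin_apply, Matrix.mulVecLin_apply, Matrix.mulVec_mulVec, h.mul_eq,
      Matrix.smul_mulVec, Matrix.one_mulVec]
    exact funext fun i => eq_sub_iff_add_eq'.1 (hu i).symm
  constructor
  · intro hex v
    obtain ⟨v, rfl⟩ := hlift v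
    exact (hex v).trans (hrange v).symm
  · exact fun hex v => (hex _).trans (hrange v)

lemma IsMatrixFactorization.isCokerOf_map_iff (hR : IsHypersurfaceQuotient S R f)
    (h : IsMatrixFactorization f A B) :
    IsCokerOf (A.map (algebraMap S R)) X ↔ IsCokerOf A X := by
  constructor
  · rintro ⟨ρ, hρ, hAρ⟩
    exact ⟨_, hρ.comp hR.surjective.comp_left, (h.exact_comp_algebraMap_iff hR ρ).2 hAρ⟩
  · rintro ⟨π, hπ, hAπ⟩
    let ρ := Fintype.linearCombination R fun i => π (Pi.single i 1)
    have hρ : ρ.restrictScalars S ∘ₗ (Algebra.linearMap S R).compLeft (Fin p) = π := by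
      ext i
      simp [ρ, Fintype.linearCombination_apply, Pi.single_apply, apply_ite]
    exact ⟨ρ, fun x => (hπ x).imp' _ fun v hv => (LinearMap.congr_fun hρ v).trans hv,
      (h.exact_comp_algebraMap_iff hR ρ).1 (hρ ▸ hAπ)⟩

lemma IsMatrixFactorization.projective_of_isUnit (hR : IsHypersurfaceQuotient S R f)
    (h : IsMatrixFactorization f A B) (hB : IsUnit B) (hX : IsCokerOf A X) :
    Module.Projective R X := by
  obtain ⟨ρ, hρ, hAρ⟩ := (h.isCokerOf_map_iff hR).2 hX
  have hA : A.map (algebraMap S R) = 0 :=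
    (hB.map (algebraMap S R).mapMatrix).mul_left_eq_zero.1 (h.isExactPair hR).mul_eq_zero
  have hinj : Function.Injective ρ := by
    rw [← LinearMap.ker_eq_bot, hAρ.linearMap_ker_eq, hA, Matrix.mulVecLin_zero,
      LinearMap.range_zero]
  exact .of_equiv (LinearEquiv.ofBijective ρ ⟨hinj, hρ⟩)

lemma matrixAct_map_algebraMap {ι κ : Type*} [Fintype κ] (C : Matrix ι κ S) (v : κ → X) :
    matrixAct X (C.map (algebraMap S R)) v = matrixAct X C v := by
  ext i
  simp [matrixAct_apply]

lemma subsingleton_pairHomology_map_algebraMap_iff :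
    Subsingleton (PairHomology (A.map (algebraMap S R)) (B.map (algebraMap S R)) X) ↔
      Subsingleton (PairHomology A B X) := by
  simp only [MiddleHomology.subsingleton_iff, SetLike.le_def, LinearMap.mem_ker,
    LinearMap.mem_range, matrixAct_map_algebraMap]

end Hypersurface

section LocalAlgebra

variable {S : Type*} [CommRing S] [IsLocalRing S]

lemma isUnit_of_forall_mulVec_mem {p : ℕ} {B : Matrix (Fin p) (Fin p) S}
    (h : ∀ u, (∀ i, B.mulVec u i ∈ maximalIdeal S) → ∀ i, u i ∈ maximalIdeal S) : IsUnit B := by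
  have hinj : Function.Injective (B.map (residue S)).mulVec := by
    refine (injective_iff_map_eq_zero (B.map (residue S)).mulVecLin).2 fun v hv => ?_
    obtain ⟨u, rfl⟩ := (residue_surjective (R := S)).comp_left v
    refine funext fun i => (residue_eq_zero_iff _).2 (h u (fun j => ?_) i)
    rw [← residue_eq_zero_iff, RingHom.map_mulVec]
    exact congrFun hv j
  rw [Matrix.mulVec_injective_iff_isUnit, Matrix.isUnit_iff_isUnit_det,
    ← RingHom.mapMatrix_apply, ← RingHom.map_det] at hinj
  exact (Matrix.isUnit_iff_isUnit_det B).2 (isUnit_of_map_unit _ _ hinj)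

variable [IsNoetherianRing S] [IsDomain S] {F P₁ P₀ : Type*}
  [AddCommGroup F] [Module S F] [Module.Free S F] [Module.Finite S F]
  [AddCommGroup P₁] [Module S P₁] [Module.Free S P₁] [Module.Finite S P₁]
  [AddCommGroup P₀] [Module S P₀]

/- The kernel of `Θ` is a free direct summand of `P₁`, so by Nakayama `q` maps onto it, and
isomorphically because the ranks agree. -/
lemma mem_smul_top_of_apply_mem_smul_top {Θ : P₁ →ₗ[S] P₀} {q : F →ₗ[S] P₁}
    (hproj : Module.Projective S (LinearMap.range Θ)) (hΘq : Θ ∘ₗ q = 0)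
    (hker : LinearMap.ker Θ ≤ LinearMap.range q ⊔ maximalIdeal S • ⊤)
    (hrank : finrank S F + finrank S (LinearMap.range Θ) = finrank S P₁) {x : F}
    (hx : q x ∈ maximalIdeal S • (⊤ : Submodule S P₁)) :
    x ∈ maximalIdeal S • (⊤ : Submodule S F) := by
  obtain ⟨s, hs⟩ := Module.projective_lifting_property Θ.rangeRestrict LinearMap.id
    Θ.surjective_rangeRestrict
  have hΘs (y : P₁) : Θ (s (Θ.rangeRestrict y)) = Θ y :=
    congrArg Subtype.val (LinearMap.congr_fun hs (Θ.rangeRestrict y))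
  let r : P₁ →ₗ[S] LinearMap.ker Θ :=
    (LinearMap.id - s ∘ₗ Θ.rangeRestrict).codRestrict _ fun y => by simp [hΘs]
  have hr (y : LinearMap.ker Θ) : r y = y := by
    have : Θ.rangeRestrict y = 0 := Subtype.ext y.2
    exact Subtype.ext (by simp [r, this])
  let q' : F →ₗ[S] LinearMap.ker Θ := q.codRestrict _ fun y => LinearMap.congr_fun hΘq y
  have hrq (y : F) : r (q y) = q' y := hr (q' y)
  have hsurj : Function.Surjective q' := by
    rw [← LinearMap.range_eq_top, eq_top_iff]
    refine Submodule.le_of_le_smul_of_le_jacobson_bot (IsNoetherian.noetherian _)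
      (maximalIdeal_le_jacobson _) fun y _ => ?_
    obtain ⟨_, ⟨z, rfl⟩, w, hw, hzw⟩ := Submodule.mem_sup.1 (hker y.2)
    rw [← hr y, ← hzw, map_add, hrq]
    exact Submodule.add_mem_sup (LinearMap.mem_range_self _ _)
      (Submodule.smul_top_le_comap_smul_top _ r hw)
  have : Module.Projective S (LinearMap.ker Θ) :=
    .of_split (LinearMap.ker Θ).subtype r (LinearMap.ext hr)
  have : Module.Free S (LinearMap.ker Θ) := Module.free_of_flat_of_isLocalRing
  have hfinrank : finrank S F = finrank S (LinearMap.ker Θ) := by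
    have := Submodule.finrank_quotient_add_finrank (LinearMap.ker Θ)
    have := Θ.quotKerEquivRange.finrank_eq
    omega
  have hbij : Function.Bijective q' :=
    OrzechProperty.bijective_of_surjective_of_finrank_le q' hsurj hfinrank.le
  let e := LinearEquiv.ofBijective q' hbij
  have hqx := Submodule.smul_top_le_comap_smul_top _ (e.symm.toLinearMap ∘ₗ r) hx
  rwa [Submodule.mem_comap, LinearMap.comp_apply, hrq, LinearEquiv.coe_coe,
    ← LinearEquiv.ofBijective_apply q' (hf := hbij), LinearEquiv.symm_apply_apply] at hqx

end LocalAlgebra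

section Matrices

variable {R ι κ μ : Type*} [CommRing R] {I : Ideal R}

lemma matrix_mem_smul_top_iff [Finite ι] [Finite κ] {C : Matrix ι κ R} :
    C ∈ I • (⊤ : Submodule R (Matrix ι κ R)) ↔ ∀ i j, C i j ∈ I :=
  mem_smul_top_pi_iff.trans (forall_congr' fun _ => mem_smul_top_fun_iff)

lemma mul_apply_mem_of_left [Fintype κ] {C : Matrix ι κ R} (hC : ∀ i j, C i j ∈ I)
    (D : Matrix κ μ R) (i : ι) (j : μ) : (C * D) i j ∈ I :=
  Ideal.sum_mem _ fun k _ => Ideal.mul_mem_right _ _ (hC i k)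

lemma mul_apply_mem_of_right [Fintype κ] {D : Matrix κ μ R} (hD : ∀ i j, D i j ∈ I)
    (C : Matrix ι κ R) (i : ι) (j : μ) : (C * D) i j ∈ I :=
  Ideal.sum_mem _ fun k _ => Ideal.mul_mem_left _ _ (hD k j)

end Matrices

section TorIndependent

variable {S : Type u} [CommRing S] {f : S} {n p : ℕ}
  {Φ Ψ : Matrix (Fin n) (Fin n) S} {A B : Matrix (Fin p) (Fin p) S}
  {X Y : Type u} [AddCommGroup X] [Module S X] [AddCommGroup Y] [Module S Y]

/-- A linear map out of `Fin p → S`, applied to each row of a matrix. -/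
def mapRows (ι : Type*) (π : (Fin p → S) →ₗ[S] X) : Matrix ι (Fin p) S →ₗ[S] ι → X :=
  π.compLeft ι

lemma mapRows_surjective (ι : Type*) {π : (Fin p → S) →ₗ[S] X} (hπ : Function.Surjective π) :
    Function.Surjective (mapRows ι π) :=
  hπ.comp_left

lemma matrixAct_mapRows {ι κ : Type*} [Fintype κ] (π : (Fin p → S) →ₗ[S] X) (C : Matrix ι κ S)
    (V : Matrix κ (Fin p) S) : matrixAct X C (mapRows κ π V) = mapRows ι π (C * V) := by
  refine (compLeft_matrixAct π C V).symm.trans (congrArg (mapRows ι π) ?_)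
  ext i j
  exact (congrFun (matrixAct_apply C V i) j).trans (by simp [Matrix.mul_apply])

lemma mapRows_eq_zero_iff {π : (Fin p → S) →ₗ[S] X} (hAπ : Function.Exact A.mulVecLin π)
    {ι : Type*} {V : Matrix ι (Fin p) S} :
    mapRows ι π V = 0 ↔ ∃ U : Matrix ι (Fin p) S, V = U * A.transpose := by
  have hrow (i) : π (V i) = 0 ↔ ∃ u, A.mulVec u = V i := hAπ (V i)
  constructor
  · intro hV
    choose u hu using fun i => (hrow i).1 (congrFun hV i)
    exact ⟨Matrix.of u, funext fun i => by rw [← hu i, ← Matrix.vecMul_transpose]; rfl⟩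
  · rintro ⟨U, rfl⟩
    exact funext fun i => (hrow i).2 ⟨U i, by rw [← Matrix.vecMul_transpose]; rfl⟩

lemma mapRows_mem_range_matrixAct_iff {π : (Fin p → S) →ₗ[S] X} (hπ : Function.Surjective π)
    (hAπ : Function.Exact A.mulVecLin π) {ι κ : Type*} [Fintype κ] {C : Matrix ι κ S}
    {V : Matrix ι (Fin p) S} : mapRows ι π V ∈ LinearMap.range (matrixAct X C) ↔
      ∃ (U : Matrix ι (Fin p) S) (W : Matrix κ (Fin p) S), V = U * A.transpose + C * W := by
  constructor
  · rintro ⟨w, hw⟩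
    obtain ⟨W, rfl⟩ := mapRows_surjective κ hπ w
    rw [matrixAct_mapRows, eq_comm, ← sub_eq_zero, ← map_sub] at hw
    obtain ⟨U, hU⟩ := (mapRows_eq_zero_iff hAπ).1 hw
    exact ⟨U, W, sub_eq_iff_eq_add.1 hU⟩
  · rintro ⟨U, W, rfl⟩
    refine ⟨mapRows κ π W, ?_⟩
    rw [map_add, (mapRows_eq_zero_iff hAπ).2 ⟨U, rfl⟩, zero_add, matrixAct_mapRows]

namespace ProjDimLT

lemma two_of_periodic {Z Z' P : Type u}
    [AddCommGroup Z] [Module S Z] [AddCommGroup Z'] [Module S Z'] [AddCommGroup P] [Module S P]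
    {i : Z' →ₗ[S] P} {q : P →ₗ[S] Z} {i' : Z →ₗ[S] P} {q' : P →ₗ[S] Z'}
    (hi : Function.Injective i) (hiq : Function.Exact i q) (hq : Function.Surjective q)
    (hi' : Function.Injective i') (hiq' : Function.Exact i' q') (hq' : Function.Surjective q')
    (hP : ProjDimLT S P 2) (d : ℕ) (hZ : ProjDimLT S Z d) (hZ' : ProjDimLT S Z' d) :
    ProjDimLT S Z 2 ∧ ProjDimLT S Z' 2 := by
  induction d with
  | zero => exact ⟨hZ.mono (by omega), hZ'.mono (by omega)⟩
  | succ d ih =>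
    rcases le_or_gt (d + 1) 2 with hd | hd
    · exact ⟨hZ.mono hd, hZ'.mono hd⟩
    · exact ih (.left hi' hiq' hq' (hP.mono (by omega)) hZ')
        (.left hi hiq hq (hP.mono (by omega)) hZ)

end ProjDimLT

lemma exists_injective_exact_mkQ (h : Subsingleton (PairHomology Φ Ψ X))
    (hΦΨ : ∀ v, matrixAct X Φ (matrixAct X Ψ v) = 0) :
    ∃ i : ((Fin n → X) ⧸ LinearMap.range (matrixAct X Ψ)) →ₗ[S] (Fin n → X),
      Function.Injective i ∧ Function.Exact i (LinearMap.range (matrixAct X Φ)).mkQ := by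
  refine ⟨Submodule.liftQ _ (matrixAct X Φ) (LinearMap.range_le_iff_comap.2
    (eq_top_iff.2 fun v _ => hΦΨ v)), ?_, ?_⟩
  · rw [← LinearMap.ker_eq_bot]
    exact Submodule.ker_liftQ_eq_bot _ _ _ (MiddleHomology.subsingleton_iff.1 h)
  · rw [LinearMap.exact_iff, Submodule.range_liftQ, Submodule.ker_mkQ]

variable (Φ A) in
/-- The relations `(U, V) ↦ U Aᵀ + Φ V` presenting the tensor product of the cokernels of `Φ` and
`A`, the free modules being written as spaces of matrices. -/
def tensorRelations : Matrix (Fin n) (Fin p) S × Matrix (Fin n) (Fin p) S →ₗ[S]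
    Matrix (Fin n) (Fin p) S :=
  (mulRightLinearMap (Fin n) S A.transpose).coprod (mulLeftLinearMap (Fin p) S Φ)

lemma tensorRelations_apply (U V : Matrix (Fin n) (Fin p) S) :
    tensorRelations Φ A (U, V) = U * A.transpose + Φ * V := rfl

lemma range_tensorRelations {π : (Fin p → S) →ₗ[S] X} (hπ : Function.Surjective π)
    (hAπ : Function.Exact A.mulVecLin π) :
    LinearMap.range (tensorRelations Φ A) =
      LinearMap.ker ((LinearMap.range (matrixAct X Φ)).mkQ ∘ₗ mapRows (Fin n) π) := by
  ext V
  rw [LinearMap.mem_ker, LinearMap.comp_apply, Submodule.mkQ_apply, Submodule.Quotient.mk_eq_zero,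
    mapRows_mem_range_matrixAct_iff hπ hAπ]
  exact ⟨fun ⟨⟨U, W⟩, h⟩ => ⟨U, W, h.symm⟩, fun ⟨U, W, h⟩ => ⟨(U, W), h.symm⟩⟩

variable (Ψ B) in
/-- The syzygies `W ↦ (-W Bᵀ, Ψ W)` of `tensorRelations`. -/
def tensorSyzygies : Matrix (Fin n) (Fin p) S →ₗ[S]
    Matrix (Fin n) (Fin p) S × Matrix (Fin n) (Fin p) S :=
  (-mulRightLinearMap (Fin n) S B.transpose).prod (mulLeftLinearMap (Fin p) S Ψ)

lemma tensorSyzygies_apply (W : Matrix (Fin n) (Fin p) S) :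
    tensorSyzygies Ψ B W = (-(W * B.transpose), Ψ * W) := rfl

lemma tensorRelations_comp_tensorSyzygies (hA : IsMatrixFactorization f A B)
    (hΦ : IsMatrixFactorization f Φ Ψ) : tensorRelations Φ A ∘ₗ tensorSyzygies Ψ B = 0 := by
  refine LinearMap.ext fun W => ?_
  rw [LinearMap.comp_apply, tensorSyzygies_apply, tensorRelations_apply, Matrix.neg_mul,
    Matrix.mul_assoc, hA.transpose.mul_eq', ← Matrix.mul_assoc, hΦ.mul_eq]
  simp

lemma ker_tensorRelations_le [IsDomain S] (hf : f ≠ 0) (hA : IsMatrixFactorization f A B)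
    (hΦ : IsMatrixFactorization f Φ Ψ) {π : (Fin p → S) →ₗ[S] X} (hπ : Function.Surjective π)
    (hAπ : Function.Exact A.mulVecLin π) {I : Ideal S} (hAI : ∀ i j, A i j ∈ I)
    (hΦI : ∀ i j, Φ i j ∈ I) (h : Subsingleton (PairHomology Φ Ψ X)) :
    LinearMap.ker (tensorRelations Φ A) ≤ LinearMap.range (tensorSyzygies Ψ B) ⊔ I • ⊤ := by
  rintro ⟨U, V⟩ hUV
  rw [LinearMap.mem_ker, tensorRelations_apply] at hUV
  have hV : matrixAct X Φ (mapRows _ π V) = 0 := by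
    rw [matrixAct_mapRows]
    exact (mapRows_eq_zero_iff hAπ).2 ⟨-U, by rw [Matrix.neg_mul, eq_neg_of_add_eq_zero_right hUV]⟩
  obtain ⟨U', W, rfl⟩ := (mapRows_mem_range_matrixAct_iff hπ hAπ).1
    (MiddleHomology.subsingleton_iff.1 h hV)
  have hU : U = -(W * B.transpose) + -(Φ * U') := by
    refine hA.transpose.mul_right_cancel hf ?_
    rw [eq_neg_of_add_eq_zero_left hUV, Matrix.mul_add, Matrix.add_mul, Matrix.neg_mul,
      Matrix.neg_mul, Matrix.mul_assoc W, hA.transpose.mul_eq', ← Matrix.mul_assoc Φ Ψ, hΦ.mul_eq]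
    simp [Matrix.mul_assoc, add_comm]
  have hsplit : (U, U' * A.transpose + Ψ * W) =
      tensorSyzygies Ψ B W + (-(Φ * U'), U' * A.transpose) := by
    rw [tensorSyzygies_apply, Prod.mk_add_mk, ← hU, add_comm]
  rw [hsplit]
  exact Submodule.add_mem_sup (LinearMap.mem_range_self _ _) (mk_mem_smul_top_prod
    (matrix_mem_smul_top_iff.2 fun i j => neg_mem (mul_apply_mem_of_left hΦI U' i j))
    (matrix_mem_smul_top_iff.2 (mul_apply_mem_of_right (fun i j => hAI j i) U')))

variable [IsRegularLocalRing S]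

lemma projDimLT_two_quotient_range_matrixAct [Module.Finite S X] (hX : ProjDimLT S X 2)
    (h : Subsingleton (PairHomology Φ Ψ X)) (h' : Subsingleton (PairHomology Ψ Φ X))
    (hΦΨ : ∀ v, matrixAct X Φ (matrixAct X Ψ v) = 0)
    (hΨΦ : ∀ v, matrixAct X Ψ (matrixAct X Φ v) = 0) :
    ProjDimLT S ((Fin n → X) ⧸ LinearMap.range (matrixAct X Φ)) 2 := by
  obtain ⟨i, hi, hiq⟩ := exists_injective_exact_mkQ h hΦΨ
  obtain ⟨i', hi', hiq'⟩ := exists_injective_exact_mkQ h' hΨΦ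
  exact (ProjDimLT.two_of_periodic hi hiq (Submodule.mkQ_surjective _) hi' hiq'
    (Submodule.mkQ_surjective _) (hX.pi n) _ projDimLT_succ_spanFinrank_maximalIdeal
    projDimLT_succ_spanFinrank_maximalIdeal).1


lemma projective_range_tensorRelations (hf : f ≠ 0)
    (hA : IsMatrixFactorization f A B) (hΦ : IsMatrixFactorization f Φ Ψ)
    {π : (Fin p → S) →ₗ[S] X} (hπ : Function.Surjective π) (hAπ : Function.Exact A.mulVecLin π)
    (h : Subsingleton (PairHomology Φ Ψ X)) (h' : Subsingleton (PairHomology Ψ Φ X)) :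
    Module.Projective S (LinearMap.range (tensorRelations Φ A)) := by
  have hX := hA.projDimLT_two hf ⟨π, hπ, hAπ⟩
  have : Module.Finite S X := .of_surjective π hπ
  have hfX := hA.smul_eq_zero_of_isCokerOf ⟨π, hπ, hAπ⟩
  have hZ := projDimLT_two_quotient_range_matrixAct hX h h' (hΦ.matrixAct_matrixAct hfX)
    (hΦ.swap.matrixAct_matrixAct hfX)
  have hsurj : Function.Surjective
      ((LinearMap.range (matrixAct X Φ)).mkQ ∘ₗ mapRows (Fin n) π) :=
    (Submodule.mkQ_surjective _).comp (mapRows_surjective (Fin n) hπ)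
  rw [range_tensorRelations hπ hAπ]
  exact ProjDimLT.one_iff.1 (hZ.ker hsurj)

theorem isUnit_or_isUnit_of_subsingleton_pairHomology (hf : f ≠ 0)
    (hA : IsMatrixFactorization f A B) (hΦ : IsMatrixFactorization f Φ Ψ)
    {π : (Fin p → S) →ₗ[S] X} (hπ : Function.Surjective π) (hAπ : Function.Exact A.mulVecLin π)
    (hAm : ∀ i j, A i j ∈ maximalIdeal S) (hΦm : ∀ i j, Φ i j ∈ maximalIdeal S)
    (h : Subsingleton (PairHomology Φ Ψ X)) (h' : Subsingleton (PairHomology Ψ Φ X)) :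
    IsUnit B ∨ IsUnit Ψ := by
  have hproj := projective_range_tensorRelations hf hA hΦ hπ hAπ h h'
  have hfX := hA.smul_eq_zero_of_isCokerOf ⟨π, hπ, hAπ⟩
  have hrank : finrank S (Matrix (Fin n) (Fin p) S) +
      finrank S (LinearMap.range (tensorRelations Φ A)) =
      finrank S (Matrix (Fin n) (Fin p) S × Matrix (Fin n) (Fin p) S) := by
    rw [range_tensorRelations hπ hAπ, finrank_prod, finrank_ker_eq_of_smul_eq_zero hf]
    refine fun z => ?_
    obtain ⟨x, rfl⟩ := Submodule.mkQ_surjective _ z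
    rw [← map_smul, show f • x = 0 from funext fun i => hfX (x i), map_zero]
  by_contra! hBΨ
  obtain ⟨u, hBu, j, hj⟩ := by simpa using mt isUnit_of_forall_mulVec_mem hBΨ.1
  obtain ⟨v, hΨv, i, hi⟩ := by simpa using mt isUnit_of_forall_mulVec_mem hBΨ.2
  have hsyz : tensorSyzygies Ψ B (Matrix.vecMulVec v u) ∈ maximalIdeal S • (⊤ : Submodule S _) := by
    rw [tensorSyzygies_apply, Matrix.vecMulVec_mul, Matrix.mul_vecMulVec, Matrix.vecMul_transpose]
    exact mk_mem_smul_top_prod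
      (matrix_mem_smul_top_iff.2 fun i j => neg_mem (Ideal.mul_mem_left _ _ (hBu j)))
      (matrix_mem_smul_top_iff.2 fun i j => Ideal.mul_mem_right _ _ (hΨv i))
  have hmem := mem_smul_top_of_apply_mem_smul_top hproj (tensorRelations_comp_tensorSyzygies hA hΦ)
    (ker_tensorRelations_le hf hA hΦ hπ hAπ hAm hΦm h) hrank hsyz
  exact ((maximalIdeal.isMaximal S).isPrime.mem_or_mem (matrix_mem_smul_top_iff.1 hmem i j)).elim
    (by simpa using hi) (by simpa using hj)

theorem projective_or_projective_of_subsingleton_pairHomology {R : Type u} [CommRing R]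
    [Algebra S R] [Module R X] [IsScalarTower S R X] [Module R Y] [IsScalarTower S R Y]
    (hR : IsHypersurfaceQuotient S R f) (hΦ : IsMatrixFactorization f Φ Ψ)
    (hΦm : ∀ i j, Φ i j ∈ maximalIdeal S) (hY : IsCokerOf (Φ.map (algebraMap S R)) Y)
    [Module.Finite S X] (hX : ProjDimLT S X 2)
    (h : Subsingleton (PairHomology (Φ.map (algebraMap S R)) (Ψ.map (algebraMap S R)) X))
    (h' : Subsingleton (PairHomology (Ψ.map (algebraMap S R)) (Φ.map (algebraMap S R)) X)) :
    Module.Projective R X ∨ Module.Projective R Y := by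
  rw [subsingleton_pairHomology_map_algebraMap_iff] at h h'
  obtain ⟨p, A, B, π, hA, hπ, hAπ, hAm⟩ :=
    exists_isMatrixFactorization hR.ne_zero hR.smul_eq_zero hX
  exact (isUnit_or_isUnit_of_subsingleton_pairHomology hR.ne_zero hA hΦ hπ hAπ hAm
      hΦm h h').imp
    (fun hB => hA.projective_of_isUnit hR hB ⟨π, hπ, hAπ⟩)
    fun hΨ => hΦ.projective_of_isUnit hR hΨ ((hΦ.isCokerOf_map_iff hR).1 hY)

end TorIndependent

/-! ### Extending homomorphisms from a syzygy -/

section FactorsThroughFree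

variable {R M N : Type*} [CommRing R] [AddCommGroup M] [Module R M] [AddCommGroup N] [Module R N]

variable (R M) in
/-- Multiplication by `r` on `M` factors through a finite free module. -/
def SMulFactorsThroughFree (r : R) : Prop :=
  ∃ (n : ℕ) (u : M →ₗ[R] (Fin n → R)) (v : (Fin n → R) →ₗ[R] M), ∀ x, v (u x) = r • x

/-- The restriction of homomorphisms from `F` to the kernel of `q`; when `q` is onto `M` and `F` is
free, its cokernel is `Ext¹(M, N)`. -/
abbrev resKer {F : Type*} [AddCommGroup F] [Module R F] (q : F →ₗ[R] M) (N : Type*)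
    [AddCommGroup N] [Module R N] : (F →ₗ[R] N) →ₗ[R] (LinearMap.ker q →ₗ[R] N) :=
  LinearMap.lcomp R N (LinearMap.ker q).subtype

lemma exact_lcomp_resKer {F : Type*} [AddCommGroup F] [Module R F] {q : F →ₗ[R] M}
    (hq : Function.Surjective q) : Function.Exact (LinearMap.lcomp R N q) (resKer q N) :=
  LinearMap.exact_lcomp_of_exact_of_surjective N (LinearMap.exact_subtype_ker_map q) hq

lemma SMulFactorsThroughFree.exists_smul_eq_of_ker {r : R} (h : SMulFactorsThroughFree R M r)
    {F : Type*} [AddCommGroup F] [Module R F] {q : F →ₗ[R] M} (hq : Function.Surjective q) :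
    ∃ s : F →ₗ[R] LinearMap.ker q, ∀ x : LinearMap.ker q, s x = r • x := by
  obtain ⟨n, u, v, huv⟩ := h
  obtain ⟨v', hv'⟩ := Module.projective_lifting_property q v hq
  have hqv (x) : q (v' x) = v x := LinearMap.congr_fun hv' x
  let s : F →ₗ[R] F := r • LinearMap.id - v' ∘ₗ u ∘ₗ q
  have hs (x : F) : s x ∈ LinearMap.ker q := by simp [s, hqv, huv]
  exact ⟨s.codRestrict _ hs, fun x => Subtype.ext (by simp [s])⟩

lemma SMulFactorsThroughFree.smul_mem_range_resKer {r : R} (h : SMulFactorsThroughFree R M r)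
    {F : Type*} [AddCommGroup F] [Module R F] {q : F →ₗ[R] M} (hq : Function.Surjective q)
    (g : LinearMap.ker q →ₗ[R] N) : r • g ∈ LinearMap.range (resKer q N) := by
  obtain ⟨s, hs⟩ := h.exists_smul_eq_of_ker hq
  exact ⟨g ∘ₗ s, LinearMap.ext fun x => by simp [hs]⟩

end FactorsThroughFree

section Tower

namespace ProjDimLT

variable {S R : Type u} [CommRing S] [CommRing R] [Algebra S R] {Z₁ Z₂ Z₃ : Type u}
  [AddCommGroup Z₁] [Module S Z₁] [Module R Z₁] [IsScalarTower S R Z₁]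
  [AddCommGroup Z₂] [Module S Z₂] [Module R Z₂] [IsScalarTower S R Z₂]
  [AddCommGroup Z₃] [Module S Z₃] [Module R Z₃] [IsScalarTower S R Z₃]
  {i : Z₁ →ₗ[R] Z₂} {p : Z₂ →ₗ[R] Z₃}

lemma left_of_tower (hi : Function.Injective i) (hip : Function.Exact i p)
    (hp : Function.Surjective p) {n : ℕ} (h₂ : ProjDimLT S Z₂ n) (h₃ : ProjDimLT S Z₃ (n + 1)) :
    ProjDimLT S Z₁ n :=
  left (f := i.restrictScalars S) (g := p.restrictScalars S) hi hip hp h₂ h₃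

lemma right_of_tower (hi : Function.Injective i) (hip : Function.Exact i p)
    (hp : Function.Surjective p) {n : ℕ} (h₁ : ProjDimLT S Z₁ n) (h₂ : ProjDimLT S Z₂ (n + 1)) :
    ProjDimLT S Z₃ (n + 1) :=
  right (f := i.restrictScalars S) (g := p.restrictScalars S) hi hip hp h₁ h₂

lemma of_exact_of_spanFinrank_eq [IsRegularLocalRing S] {k : ℕ}
    (hd : (maximalIdeal S).spanFinrank = k + 1) [Module.Finite S Z₃] (hi : Function.Injective i)
    (hip : Function.Exact i p) (h₂ : ProjDimLT S Z₂ k) (h₃ : ProjDimLT S Z₃ k) :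
    ProjDimLT S Z₁ k := by
  have hrange : ProjDimLT S (LinearMap.range p) (k + 1) :=
    left_of_tower (Submodule.injective_subtype _) (LinearMap.exact_subtype_mkQ _)
      (Submodule.mkQ_surjective (LinearMap.range p)) (h₃.mono (by omega))
      (hd ▸ projDimLT_succ_spanFinrank_maximalIdeal)
  exact left_of_tower hi (p := p.rangeRestrict)
    (fun v => Iff.trans (by simp [Subtype.ext_iff]) (hip v)) p.surjective_rangeRestrict h₂ hrange

lemma linearMap_fin {k : ℕ} (hN : ProjDimLT S Z₁ k) (m : ℕ) :
    ProjDimLT S ((Fin m → R) →ₗ[R] Z₁) k :=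
  (hN.pi m).of_equiv ((Module.piEquiv (Fin m) R Z₁).restrictScalars S)

end ProjDimLT

namespace IsHypersurfaceQuotient

variable {S R : Type u} [CommRing S] [CommRing R] [Algebra S R] {f : S}

lemma isNoetherianRing (hR : IsHypersurfaceQuotient S R f) : IsNoetherianRing R :=
  let := hR.isRegularLocalRing
  isNoetherianRing_of_surjective S R _ hR.surjective

lemma finite (hR : IsHypersurfaceQuotient S R f) : Module.Finite S R :=
  .of_surjective (Algebra.linearMap S R) hR.surjective

lemma finite_of_finite (hR : IsHypersurfaceQuotient S R f) (X : Type*) [AddCommGroup X]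
    [Module S X] [Module R X] [IsScalarTower S R X] [Module.Finite R X] : Module.Finite S X :=
  have := hR.finite
  .trans R X

lemma projDimLT_two_self (hR : IsHypersurfaceQuotient S R f) : ProjDimLT S R 2 := by
  let := hR.isRegularLocalRing
  refine ProjDimLT.right (f := LinearMap.mulLeft S f) (g := Algebra.linearMap S R) (n := 1)
    (mul_right_injective₀ hR.ne_zero) (fun s => ?_) hR.surjective
    (ProjDimLT.one_iff.2 inferInstance) ((ProjDimLT.one_iff.2 inferInstance).mono one_le_two)
  rw [Algebra.linearMap_apply, hR.algebraMap_eq_zero_iff]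
  exact ⟨fun ⟨t, ht⟩ => ⟨t, ht.symm⟩, fun ⟨t, ht⟩ => ⟨t, ht.symm⟩⟩

lemma projDimLT_two_fin (hR : IsHypersurfaceQuotient S R f) (n : ℕ) :
    ProjDimLT S (Fin n → R) 2 :=
  hR.projDimLT_two_self.pi n

section

variable {M : Type u} [AddCommGroup M] [Module S M] [Module R M] [IsScalarTower S R M]

lemma projDimLT_two_ker (hR : IsHypersurfaceQuotient S R f) (hM : ProjDimLT S M 3) {m : ℕ}
    {q : (Fin m → R) →ₗ[R] M} (hq : Function.Surjective q) :
    ProjDimLT S (LinearMap.ker q) 2 :=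
  ProjDimLT.left_of_tower (Submodule.injective_subtype _) (LinearMap.exact_subtype_ker_map q) hq
    (hR.projDimLT_two_fin m) hM

lemma projDimLT_of_isWeaklyRegular [IsRegularLocalRing S] [IsLocalRing R]
    (hR : IsHypersurfaceQuotient S R f)
    [Module.Finite R M] {n : ℕ} {rs : List R}
    (hd : (maximalIdeal S).spanFinrank + 1 = n + rs.length)
    (hrs : ∀ r ∈ rs, r ∈ maximalIdeal R) (reg : RingTheory.Sequence.IsWeaklyRegular M rs) :
    ProjDimLT S M n := by
  have := hR.finite_of_finite M
  obtain ⟨ss, rfl⟩ : ∃ ss : List S, ss.map (algebraMap S R) = rs :=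
    (List.map_surjective_iff.2 hR.surjective) rs
  rw [RingTheory.Sequence.isWeaklyRegular_map_algebraMap_iff] at reg
  rw [List.length_map] at hd
  refine (ProjDimLT.add_length_iff reg fun s hs => ?_).1
    (hd ▸ projDimLT_succ_spanFinrank_maximalIdeal)
  exact fun hunit => hrs _ (List.mem_map_of_mem hs) (hunit.map (algebraMap S R))

lemma projDimLT_of_exact_fin [IsRegularLocalRing S] (hR : IsHypersurfaceQuotient S R f) {k : ℕ}
    (hd : (maximalIdeal S).spanFinrank = k + 3) {a b : ℕ} {i : M →ₗ[R] (Fin a → R)}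
    {g : (Fin a → R) →ₗ[R] (Fin b → R)} (hi : Function.Injective i) (hig : Function.Exact i g) :
    ProjDimLT S M (k + 2) := by
  have := hR.finite
  exact ProjDimLT.of_exact_of_spanFinrank_eq hd hi hig ((hR.projDimLT_two_fin a).mono (by omega))
    ((hR.projDimLT_two_fin b).mono (by omega))

end

variable {M N : Type u} [AddCommGroup M] [Module R M] [AddCommGroup N] [Module S N] [Module R N]
  [IsScalarTower S R N] [IsRegularLocalRing S] [IsNoetherianRing R]

lemma projDimLT_linearMap (hR : IsHypersurfaceQuotient S R f) {k : ℕ}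
    (hd : (maximalIdeal S).spanFinrank = k + 1) [Module.Finite R M] [Module.Finite R N]
    (hN : ProjDimLT S N k) : ProjDimLT S (M →ₗ[R] N) k := by
  obtain ⟨m, q, hq⟩ := Module.Finite.exists_fin' R M
  obtain ⟨m', q', hq'⟩ := Module.Finite.exists_fin' R (LinearMap.ker q)
  have := hR.finite_of_finite ((Fin m' → R) →ₗ[R] N)
  have hq'N : Function.Injective (LinearMap.lcomp R N q') :=
    LinearMap.lcomp_injective_of_surjective q' hq'
  refine ProjDimLT.of_exact_of_spanFinrank_eq hd (i := LinearMap.lcomp R N q)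
    (p := LinearMap.lcomp R N q' ∘ₗ resKer q N) (LinearMap.lcomp_injective_of_surjective q hq)
    (fun g => ?_) (hN.linearMap_fin m) (hN.linearMap_fin m')
  exact (map_eq_zero_iff _ hq'N).trans (exact_lcomp_resKer hq g)

lemma projDimLT_coker_resKer (hR : IsHypersurfaceQuotient S R f) {k : ℕ}
    (hd : (maximalIdeal S).spanFinrank = k + 2) [Module.Finite R N] (hN : ProjDimLT S N (k + 1))
    (hMN : ProjDimLT S (M →ₗ[R] N) k) {m : ℕ} {q : (Fin m → R) →ₗ[R] M}
    (hq : Function.Surjective q) :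
    ProjDimLT S ((LinearMap.ker q →ₗ[R] N) ⧸ LinearMap.range (resKer q N)) (k + 2) := by
  have hrange : ProjDimLT S (LinearMap.range (resKer q N)) (k + 1) :=
    .right_of_tower (LinearMap.lcomp_injective_of_surjective q hq)
      (p := (resKer q N).rangeRestrict)
      (fun g => Iff.trans (by simp [Subtype.ext_iff]) (exact_lcomp_resKer hq g))
      (LinearMap.surjective_rangeRestrict _) hMN (hN.linearMap_fin m)
  exact .right_of_tower (Submodule.injective_subtype _) (LinearMap.exact_subtype_mkQ _)
    (Submodule.mkQ_surjective _) hrange ((hR.projDimLT_linearMap hd hN).mono (by omega))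

/- `Ext¹(M, N)` has finite length because `M` is locally free on the punctured spectrum, and
positive depth because `Hom(M, N)` has depth at least three; hence it vanishes. -/
theorem range_resKer_eq_top [IsLocalRing R]
    (hR : IsHypersurfaceQuotient S R f) {k : ℕ} (hd : (maximalIdeal S).spanFinrank = k + 2)
    [Module.Finite R N] (hN : ProjDimLT S N (k + 1)) (hMN : ProjDimLT S (M →ₗ[R] N) k) {l : ℕ}
    (hl : ∀ r ∈ maximalIdeal R ^ l, SMulFactorsThroughFree R M r) {m : ℕ}
    {q : (Fin m → R) →ₗ[R] M} (hq : Function.Surjective q) :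
    LinearMap.range (resKer q N) = ⊤ := by
  have := hR.finite_of_finite ((LinearMap.ker q →ₗ[R] N) ⧸ LinearMap.range (resKer q N))
  rw [← Submodule.Quotient.subsingleton_iff]
  refine subsingleton_of_projDimLT_of_pow_smul_eq_zero (k := l)
    (hd ▸ hR.projDimLT_coker_resKer hd hN hMN hq) fun s hs z => ?_
  obtain ⟨g, rfl⟩ := Submodule.mkQ_surjective _ z
  rw [← algebraMap_smul R, ← map_smul, Submodule.mkQ_apply, Submodule.Quotient.mk_eq_zero]
  refine (hl _ ?_).smul_mem_range_resKer hq g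
  rw [← map_maximalIdeal_of_surjective (algebraMap S R) hR.surjective, ← Ideal.map_pow]
  exact Ideal.mem_map_of_mem _ hs

end IsHypersurfaceQuotient

end Tower

/-! ### Homology with coefficients in a dual module -/

section Dual

variable {R : Type*} [CommRing R] {p n c : ℕ} {α β : Matrix (Fin p) (Fin p) R}
  {φ ψ : Matrix (Fin n) (Fin n) R} {L : Type*} [AddCommGroup L] [Module R L]
  {π : (Fin p → R) →ₗ[R] L}

/-- The coordinates of the restriction to `R^p` of linear forms on `L`, an embedding of the dual
of `L` into `R^p` when `π` is surjective. -/
noncomputable def dualCoords (π : (Fin p → R) →ₗ[R] L) : Dual R L →ₗ[R] (Fin p → R) :=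
  (Module.piEquiv (Fin p) R R).symm.toLinearMap ∘ₗ LinearMap.lcomp R R π

lemma dualCoords_injective (hπ : Function.Surjective π) : Function.Injective (dualCoords π) :=
  (Module.piEquiv (Fin p) R R).symm.injective.comp (LinearMap.lcomp_injective_of_surjective π hπ)

lemma lcomp_piEquiv (α : Matrix (Fin p) (Fin p) R) (x : Fin p → R) :
    LinearMap.lcomp R R α.mulVecLin (Module.piEquiv (Fin p) R R x) =
      Module.piEquiv (Fin p) R R (α.transpose.mulVec x) := by
  ext i
  simp [Module.piEquiv_apply_apply, Matrix.mulVec, dotProduct, Pi.single_apply]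

lemma exact_dualCoords (hαπ : Function.Exact α.mulVecLin π) (hπ : Function.Surjective π) :
    Function.Exact (dualCoords π) α.transpose.mulVecLin := by
  intro x
  have hx := LinearMap.exact_lcomp_of_exact_of_surjective R hαπ hπ (Module.piEquiv (Fin p) R R x)
  rw [lcomp_piEquiv, LinearEquiv.map_eq_zero_iff] at hx
  refine hx.trans (exists_congr fun g => ?_)
  exact (LinearEquiv.symm_apply_eq _).symm

lemma IsExactPair.isCokerOf_of_exact (h : IsExactPair φ ψ) {j : L →ₗ[R] (Fin n → R)}
    (hj : Function.Injective j) (hjφ : Function.Exact j φ.mulVecLin) : IsCokerOf φ L := by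
  have hψ (v : Fin n → R) : ψ.mulVecLin v ∈ LinearMap.range j :=
    (hjφ _).1 (h.exact.apply_apply_eq_zero v)
  let π := (LinearEquiv.ofInjective j hj).symm.toLinearMap ∘ₗ ψ.mulVecLin.codRestrict _ hψ
  have hjπ (v : Fin n → R) : j (π v) = ψ.mulVec v :=
    congrArg Subtype.val ((LinearEquiv.ofInjective j hj).apply_symm_apply ⟨_, hψ v⟩)
  refine ⟨π, fun y => ?_, fun v => ?_⟩
  · obtain ⟨v, hv⟩ := (h.exact _).1 (hjφ.apply_apply_eq_zero y)
    exact ⟨v, hj ((hjπ v).trans hv)⟩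
  · rw [← map_eq_zero_iff j hj, hjπ]
    exact h.exact' v

lemma IsExactPair.isCokerOf_dual (h : IsExactPair α β) (hL : IsCokerOf α L) :
    IsCokerOf α.transpose (Dual R L) := by
  obtain ⟨π, hπ, hαπ⟩ := hL
  exact h.transpose.isCokerOf_of_exact (dualCoords_injective hπ) (exact_dualCoords hαπ hπ)

lemma IsExactPair.projective_of_dual (h : IsExactPair α β) (hL : IsCokerOf α L)
    (hp : Module.Projective R (Dual R L)) : Module.Projective R L := by
  have hdual := h.isCokerOf_dual hL
  have hbidual := h.transpose.isCokerOf_dual hdual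
  rw [Matrix.transpose_transpose] at hbidual
  have := hdual.finite
  obtain ⟨e⟩ := hbidual.nonempty_equiv hL
  exact .of_equiv e

/-- The matrix whose rows are the coordinates of a family of linear forms. -/
noncomputable def dualRows (n : ℕ) (π : (Fin p → R) →ₗ[R] L) :
    (Fin n → Dual R L) →ₗ[R] Matrix (Fin n) (Fin p) R :=
  (dualCoords π).compLeft (Fin n)

lemma dualRows_injective (hπ : Function.Surjective π) : Function.Injective (dualRows n π) :=
  (dualCoords_injective hπ).comp_left

lemma dualRows_matrixAct (C : Matrix (Fin n) (Fin c) R) (v : Fin c → Dual R L) :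
    dualRows n π (matrixAct _ C v) = C * dualRows c π v := by
  refine (compLeft_matrixAct (dualCoords π) C v).trans ?_
  ext i j
  simp only [matrixAct_apply, Matrix.mul_apply, Finset.sum_apply, Pi.smul_apply, smul_eq_mul]
  rfl

lemma exact_dualRows (hαπ : Function.Exact α.mulVecLin π) (hπ : Function.Surjective π) :
    Function.Exact (dualRows n π) (· * α) := by
  intro G
  have hrow (i : Fin n) : (G * α) i = 0 ↔ ∃ g, dualCoords π g = G i := by
    rw [Matrix.mul_apply_eq_vecMul, ← Matrix.mulVec_transpose]
    exact exact_dualCoords hαπ hπ (G i)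
  calc G * α = 0 ↔ ∀ i, (G * α) i = 0 := funext_iff
    _ ↔ ∃ v : Fin n → Dual R L, ∀ i, dualCoords π (v i) = G i :=
      (forall_congr' hrow).trans Classical.skolem
    _ ↔ G ∈ Set.range (dualRows n π) := exists_congr fun v => funext_iff.symm

lemma subsingleton_pairHomology_dual (hαπ : Function.Exact α.mulVecLin π)
    (hπ : Function.Surjective π)
    (h : ∀ G : Matrix (Fin n) (Fin p) R, G * α = 0 → φ * G = 0 →
      ∃ W : Matrix (Fin n) (Fin p) R, W * α = 0 ∧ G = ψ * W) :
    Subsingleton (PairHomology φ ψ (Dual R L)) := by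
  rw [MiddleHomology.subsingleton_iff]
  intro v hv
  obtain ⟨W, hW, hvW⟩ := h (dualRows n π v) ((exact_dualRows hαπ hπ).apply_apply_eq_zero v)
    (by rw [← dualRows_matrixAct, LinearMap.mem_ker.1 hv, map_zero])
  obtain ⟨w, rfl⟩ := (exact_dualRows hαπ hπ W).1 hW
  exact ⟨w, dualRows_injective hπ (by rw [dualRows_matrixAct, hvW])⟩

end Dual

/-! ### Consequences of liftings for the homology of an exact pair -/

section Lifting

variable {R : Type*} [CommRing R] {p n c : ℕ} {α β : Matrix (Fin p) (Fin p) R}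
  {φ ψ : Matrix (Fin n) (Fin n) R} {L N : Type*} [AddCommGroup L] [Module R L]
  [AddCommGroup N] [Module R N]

lemma exists_eq_mul_of_exact_linearMap {κ : Type*} {ι : Matrix (Fin c) (Fin n) R}
    {ε : (Fin c → R) →ₗ[R] N} (hιε : Function.Exact ι.mulVecLin ε) {G : Matrix (Fin c) κ R}
    (hG : ∀ j, ε (G.col j) = 0) : ∃ W : Matrix (Fin n) κ R, G = ι * W :=
  exists_eq_mul_of_forall_col_mem_range fun j => (hιε _).1 (hG j)

lemma IsCokerOf.exists_exact {ε : (Fin c → R) →ₗ[R] N} (hφ : IsCokerOf φ (LinearMap.ker ε)) :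
    ∃ ι : Matrix (Fin c) (Fin n) R,
      Function.Exact φ.mulVec ι.mulVec ∧ Function.Exact ι.mulVecLin ε := by
  obtain ⟨π, hπ, hφπ⟩ := hφ
  let ι := LinearMap.toMatrix' ((LinearMap.ker ε).subtype ∘ₗ π)
  have hι (v : Fin n → R) : ι.mulVec v = π v := LinearMap.toMatrix'_mulVec _ v
  refine ⟨ι, fun v => ?_, fun x => ⟨fun hx => ?_, ?_⟩⟩
  · rw [hι, Submodule.coe_eq_zero]
    exact hφπ v
  · obtain ⟨v, hv⟩ := hπ ⟨x, hx⟩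
    exact ⟨v, (hι v).trans (congrArg Subtype.val hv)⟩
  · rintro ⟨v, rfl⟩
    exact (congrArg ε (hι v)).trans (π v).2

lemma exists_mul_mul_eq_smul {ε : (Fin c → R) →ₗ[R] N} (hε : Function.Surjective ε)
    (hφ : IsCokerOf φ (LinearMap.ker ε)) {r : R} (hr : SMulFactorsThroughFree R N r) :
    ∃ H : Matrix (Fin n) (Fin n) R, φ * H * φ = r • φ := by
  obtain ⟨π, hπ, hφπ⟩ := hφ
  obtain ⟨s, hs⟩ := hr.exists_smul_eq_of_ker hε
  obtain ⟨σ, hσ⟩ := Module.projective_lifting_property π s hπ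
  let T := LinearMap.toMatrix' (σ ∘ₗ (LinearMap.ker ε).subtype ∘ₗ π)
  have hT (v : Fin n → R) : T.mulVec v = σ (π v) := LinearMap.toMatrix'_mulVec _ v
  have hπT (v : Fin n → R) : π (T.mulVec v) = r • π v := by
    rw [hT, ← hs]
    exact LinearMap.congr_fun hσ _
  obtain ⟨H, hH⟩ := exists_eq_mul_of_exact_linearMap hφπ (G := r • 1 - T) fun j => by
    rw [← Matrix.mulVec_single_one, Matrix.sub_mulVec, map_sub, hπT, Matrix.smul_mulVec,
      Matrix.one_mulVec, map_smul, sub_self]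
  have hTφ : T * φ = 0 := Matrix.mulVec_injective (funext fun v => by
    rw [← Matrix.mulVec_mulVec, hT, ← Matrix.mulVecLin_apply, hφπ.apply_apply_eq_zero,
      Submodule.coe_zero, map_zero, Matrix.zero_mulVec])
  exact ⟨H, by rw [← hH, Matrix.sub_mul, hTφ, sub_zero, Matrix.smul_mul, Matrix.one_mul]⟩

lemma IsExactPair.exists_smul_one_eq (h : IsExactPair φ ψ) {r : R}
    {H : Matrix (Fin n) (Fin n) R} (hH : φ * H * φ = r • φ) :
    ∃ H', r • 1 = H * φ + ψ * H' ∧ ψ * H' * ψ = r • ψ := by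
  obtain ⟨H', hH'⟩ := h.exists_eq_mul_left (G := r • 1 - H * φ)
    (by rw [Matrix.mul_sub, ← Matrix.mul_assoc, hH, Matrix.mul_smul, Matrix.mul_one, sub_self])
  refine ⟨H', by rw [← hH', add_sub_cancel], ?_⟩
  rw [← hH', Matrix.sub_mul, Matrix.mul_assoc, h.mul_eq_zero, Matrix.mul_zero, sub_zero,
    Matrix.smul_mul, Matrix.one_mul]

lemma smul_mem_range_matrixAct {r : R} {H H' : Matrix (Fin n) (Fin n) R}
    (hr : r • 1 = H * φ + ψ * H') {v : Fin n → N} (hv : matrixAct N φ v = 0) :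
    r • v ∈ LinearMap.range (matrixAct N ψ) :=
  ⟨matrixAct N H' v, by
    rw [← matrixAct_smul_one, hr, matrixAct_add, matrixAct_mul, matrixAct_mul, hv, map_zero,
      zero_add]⟩

lemma length_pairHomology_ne_top [IsLocalRing R] [IsNoetherianRing R] [Module.Finite R N] {k : ℕ}
    (hk : ∀ r ∈ maximalIdeal R ^ k, ∃ H H' : Matrix (Fin n) (Fin n) R, r • 1 = H * φ + ψ * H') :
    Module.length R (PairHomology φ ψ N) ≠ ⊤ := by
  rw [Module.length_ne_top_iff]
  refine isFiniteLength_of_pow_le_annihilator (k := k) fun r hr => ?_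
  obtain ⟨H, H', hH⟩ := hk r hr
  exact Module.mem_annihilator.2
    (MiddleHomology.smul_eq_zero fun v hv => smul_mem_range_matrixAct hH hv)

/- Multiplication by `r` is null-homotopic on the periodic complex when it factors through a free
module on the module resolved by that complex. -/
lemma IsExactPair.exists_homotopy (h : IsExactPair φ ψ) {ε : (Fin c → R) →ₗ[R] N}
    (hε : Function.Surjective ε) (hφ : IsCokerOf φ (LinearMap.ker ε)) {r : R}
    (hr : SMulFactorsThroughFree R N r) :
    (∃ H H' : Matrix (Fin n) (Fin n) R, r • 1 = H * φ + ψ * H') ∧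
      ∃ H H' : Matrix (Fin n) (Fin n) R, r • 1 = H * ψ + φ * H' := by
  obtain ⟨H, hH⟩ := exists_mul_mul_eq_smul hε hφ hr
  obtain ⟨H', hHH', hH'⟩ := h.exists_smul_one_eq hH
  obtain ⟨H'', hH'', -⟩ := h.swap.exists_smul_one_eq hH'
  exact ⟨⟨H, H', hHH'⟩, H', H'', hH''⟩

lemma IsExactPair.hasFiniteHomology {R N : Type u} [CommRing R] [AddCommGroup N] [Module R N]
    {φ ψ : Matrix (Fin n) (Fin n) R} [IsLocalRing R] [IsNoetherianRing R] (h : IsExactPair φ ψ)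
    {ε : (Fin c → R) →ₗ[R] N} (hε : Function.Surjective ε) (hφ : IsCokerOf φ (LinearMap.ker ε))
    {k : ℕ} (hk : ∀ r ∈ maximalIdeal R ^ k, SMulFactorsThroughFree R N r) :
    HasFiniteHomology φ ψ := fun _ _ _ _ =>
  ⟨length_pairHomology_ne_top fun r hr => (h.exists_homotopy hε hφ (hk r hr)).1,
    length_pairHomology_ne_top fun r hr => (h.exists_homotopy hε hφ (hk r hr)).2⟩

lemma subsingleton_pairHomology_of_one_eq {H H' : Matrix (Fin n) (Fin n) R}
    (h : 1 = H * φ + ψ * H') : Subsingleton (PairHomology φ ψ N) :=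
  MiddleHomology.subsingleton_iff.2 fun v hv =>
    one_smul R v ▸ smul_mem_range_matrixAct (by rw [one_smul, h]) hv

lemma IsExactPair.pairTheta_eq_zero_of_free_of_isCokerOf [Nontrivial R] (h : IsExactPair φ ψ)
    {ε : (Fin c → R) →ₗ[R] N} (hε : Function.Surjective ε) (hφ : IsCokerOf φ (LinearMap.ker ε))
    [Module.Free R N] (X : Type*) [AddCommGroup X] [Module R X] : pairTheta φ ψ X = 0 := by
  have : Module.Finite R N := .of_surjective ε hε
  let e := (Module.finBasis R N).equivFun
  obtain ⟨⟨H, H', hH⟩, G, G', hG⟩ := h.exists_homotopy hε hφ (r := 1)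
    ⟨_, e.toLinearMap, e.symm.toLinearMap, fun x => by simp⟩
  rw [one_smul] at hH hG
  have := subsingleton_pairHomology_of_one_eq (N := X) hH
  have := subsingleton_pairHomology_of_one_eq (N := X) hG
  simp [pairTheta]

lemma exists_eq_add_mul_of_lift {π : (Fin p → R) →ₗ[R] L} (hπ : Function.Surjective π)
    (hαπ : Function.Exact α.mulVecLin π) {ι : Matrix (Fin c) (Fin n) R} {ε : (Fin c → R) →ₗ[R] N}
    (hιε : Function.Exact ι.mulVecLin ε)
    (hlift : ∀ g : L →ₗ[R] N, ∃ g' : L →ₗ[R] (Fin c → R), ε ∘ₗ g' = g)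
    {G₁ : Matrix (Fin n) (Fin p) R} {G₂ : Matrix (Fin c) (Fin p) R} (hG : ι * G₁ = G₂ * α) :
    ∃ (Q : Matrix (Fin c) (Fin p) R) (P : Matrix (Fin n) (Fin p) R),
      Q * α = 0 ∧ G₂ = Q + ι * P := by
  obtain ⟨g, hg⟩ := (LinearMap.exact_lcomp_of_exact_of_surjective N hαπ hπ
    (ε ∘ₗ G₂.mulVecLin)).1 (LinearMap.ext fun v => by
      simp only [LinearMap.lcomp_apply, LinearMap.comp_apply, Matrix.mulVecLin_apply,
        Matrix.mulVec_mulVec, ← hG, LinearMap.zero_apply]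
      rw [← Matrix.mulVec_mulVec]
      exact hιε.apply_apply_eq_zero _)
  obtain ⟨g', rfl⟩ := hlift g
  let Q := LinearMap.toMatrix' (g' ∘ₗ π)
  have hQ (v : Fin p → R) : Q.mulVec v = g' (π v) := LinearMap.toMatrix'_mulVec _ v
  have hQα : Q * α = 0 := Matrix.mulVec_injective (funext fun v => by
    rw [← Matrix.mulVec_mulVec, hQ, ← Matrix.mulVecLin_apply, hαπ.apply_apply_eq_zero, map_zero,
      Matrix.zero_mulVec])
  obtain ⟨P, hP⟩ := exists_eq_mul_of_exact_linearMap hιε (G := G₂ - Q) fun j => by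
    rw [← Matrix.mulVec_single_one, Matrix.sub_mulVec, map_sub, hQ, sub_eq_zero]
    exact (LinearMap.congr_fun hg _).symm
  exact ⟨Q, P, hQα, by rw [← hP, add_sub_cancel]⟩

theorem subsingleton_pairHomology_dual_of_lift (hα : IsExactPair α β) (hφ : IsExactPair φ ψ)
    (hL : IsCokerOf α L) {ε : (Fin c → R) →ₗ[R] N} (hφε : IsCokerOf φ (LinearMap.ker ε))
    (hlift : ∀ g : L →ₗ[R] N, ∃ g' : L →ₗ[R] (Fin c → R), ε ∘ₗ g' = g) :
    Subsingleton (PairHomology ψ φ (Dual R L)) := by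
  obtain ⟨π, hπ, hαπ⟩ := hL
  obtain ⟨ι, hφι, hιε⟩ := hφε.exists_exact
  have hιφ : ι * φ = 0 := Matrix.mulVec_injective (funext fun v => by
    rw [← Matrix.mulVec_mulVec, hφι.apply_apply_eq_zero, Matrix.zero_mulVec])
  refine subsingleton_pairHomology_dual hαπ hπ fun G hGα hψG => ?_
  obtain ⟨G₁, rfl⟩ := hα.exists_eq_mul_right hGα
  obtain ⟨K, hK⟩ := hφ.swap.exists_eq_mul_left hψG
  obtain ⟨G₂, hG₂⟩ := hα.swap.exists_eq_mul_right (G := ι * G₁)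
    (by rw [Matrix.mul_assoc, hK, ← Matrix.mul_assoc, hιφ, Matrix.zero_mul])
  obtain ⟨Q, P, hQα, rfl⟩ := exists_eq_add_mul_of_lift hπ hαπ hιε hlift hG₂
  obtain ⟨W, hW⟩ := exists_eq_mul_of_exact hφι (G := G₁ - P * α) (by
    rw [Matrix.mul_sub, hG₂, Matrix.add_mul, hQα, zero_add, Matrix.mul_assoc, sub_self])
  refine ⟨W * β, by rw [Matrix.mul_assoc, hα.swap.mul_eq_zero, Matrix.mul_zero], ?_⟩
  rw [← Matrix.mul_assoc, ← hW, Matrix.sub_mul, Matrix.mul_assoc, hα.mul_eq_zero, Matrix.mul_zero,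
    sub_zero]

end Lifting

section CompPi

variable {R M N : Type*} [CommRing R] [AddCommGroup M] [Module R M] [AddCommGroup N] [Module R N]
  {m c s : ℕ} {q : (Fin m → R) →ₗ[R] M} {ε : (Fin c → R) →ₗ[R] N} {β : Matrix (Fin c) (Fin s) R}

lemma exists_lift_of_range_resKer_eq_top (hres : LinearMap.range (resKer q N) = ⊤)
    (hε : Function.Surjective ε) (g : LinearMap.ker q →ₗ[R] N) :
    ∃ g' : (Fin m → R) →ₗ[R] (Fin c → R), ε ∘ₗ g' ∘ₗ (LinearMap.ker q).subtype = g := by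
  obtain ⟨g₀, rfl⟩ := LinearMap.range_eq_top.1 hres g
  obtain ⟨g', rfl⟩ := Module.projective_lifting_property ε g₀ hε
  exact ⟨g', rfl⟩

lemma injective_of_subsingleton_ker {F : Type*} [AddCommGroup F] [Module R F] {p : F →ₗ[R] M}
    (h : Subsingleton (LinearMap.ker p)) : Function.Injective p :=
  LinearMap.ker_eq_bot.1 (Submodule.subsingleton_iff_eq_bot.1 h)

lemma exists_mulVecLin_comp_eq {L : Type*} [AddCommGroup L] [Module R L]
    (hβ : Function.Injective β.mulVecLin) (hβε : Function.Exact β.mulVecLin ε)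
    {D : L →ₗ[R] (Fin c → R)} (hD : ε ∘ₗ D = 0) :
    ∃ D' : L →ₗ[R] (Fin s → R), β.mulVecLin ∘ₗ D' = D :=
  ⟨_, LinearMap.codRestrictOfInjective_comp D _ hβ
    fun x => (hβε _).1 (LinearMap.congr_fun hD x)⟩

/-- The natural map `(M*)ᶜ = Hom(M, Rᶜ) → Hom(M, N)` induced by `ε : Rᶜ → N`. -/
def compPi (M : Type*) [AddCommGroup M] [Module R M] (ε : (Fin c → R) →ₗ[R] N) :
    (Fin c → Dual R M) →ₗ[R] (M →ₗ[R] N) where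
  toFun h := ε ∘ₗ LinearMap.pi h
  map_add' g h := LinearMap.ext fun x => map_add ε (fun j => g j x) fun j => h j x
  map_smul' r h := LinearMap.ext fun x => map_smul ε r fun j => h j x

lemma pi_matrixAct_dual (β : Matrix (Fin c) (Fin s) R) (u : Fin s → Dual R M) :
    LinearMap.pi (matrixAct (Dual R M) β u) = β.mulVecLin ∘ₗ LinearMap.pi u := by
  ext x i
  simp [matrixAct_apply, Matrix.mulVec, dotProduct]

lemma pi_injective : Function.Injective fun u : Fin s → Dual R M => LinearMap.pi u :=
  fun _ _ h => funext fun k => LinearMap.ext fun x => congrFun (LinearMap.congr_fun h x) k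

lemma matrixAct_dual_injective (hβ : Function.Injective β.mulVecLin) :
    Function.Injective (matrixAct (Dual R M) β) := fun u v h => pi_injective <| by
  have h' := congrArg (fun w : Fin c → Dual R M => LinearMap.pi w) h
  simp only [pi_matrixAct_dual] at h'
  exact (LinearMap.cancel_left hβ).1 h'

lemma exact_matrixAct_compPi (hβ : Function.Injective β.mulVecLin)
    (hβε : Function.Exact β.mulVecLin ε) :
    Function.Exact (matrixAct (Dual R M) β) (compPi M ε) := fun h => by
  constructor
  · intro hh
    obtain ⟨D, hD⟩ := exists_mulVecLin_comp_eq hβ hβε hh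
    let u : Fin s → Dual R M := fun k => LinearMap.proj k ∘ₗ D
    exact ⟨u, pi_injective ((pi_matrixAct_dual β u).trans hD)⟩
  · rintro ⟨u, rfl⟩
    refine LinearMap.ext fun x => ?_
    change ε (LinearMap.pi (matrixAct (Dual R M) β u) x) = 0
    rw [pi_matrixAct_dual]
    exact hβε.apply_apply_eq_zero _

lemma compPi_surjective (hq : Function.Surjective q) (hε : Function.Surjective ε)
    (hβ : Function.Injective β.mulVecLin) (hβε : Function.Exact β.mulVecLin ε)
    (hres : LinearMap.range (resKer q R) = ⊤) : Function.Surjective (compPi M ε) := by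
  intro g
  obtain ⟨G, hG⟩ := Module.projective_lifting_property ε (g ∘ₗ q) hε
  obtain ⟨D, hD⟩ := exists_mulVecLin_comp_eq hβ hβε (D := G ∘ₗ (LinearMap.ker q).subtype) (by
    rw [← LinearMap.comp_assoc, hG, LinearMap.comp_assoc, LinearMap.comp_ker_subtype,
      LinearMap.comp_zero])
  choose H hH using fun k => LinearMap.range_eq_top.1 hres (LinearMap.proj k ∘ₗ D)
  obtain ⟨g', hg'⟩ := (exact_lcomp_resKer hq (G - β.mulVecLin ∘ₗ LinearMap.pi H)).1 (by
    have hHD : LinearMap.pi H ∘ₗ (LinearMap.ker q).subtype = D :=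
      LinearMap.ext fun x => funext fun k => LinearMap.congr_fun (hH k) x
    rw [map_sub, LinearMap.lcomp_apply', LinearMap.lcomp_apply', LinearMap.comp_assoc, hHD, hD,
      sub_self])
  refine ⟨fun j => LinearMap.proj j ∘ₗ g', (LinearMap.cancel_right hq).1 ?_⟩
  refine (congrArg (ε ∘ₗ ·) hg').trans ?_
  rw [LinearMap.comp_sub, hG, ← LinearMap.comp_assoc, hβε.linearMap_comp_eq_zero,
    LinearMap.zero_comp, sub_zero]

end CompPi

section FreeSyzygy

variable {R M N : Type*} [CommRing R] [IsLocalRing R] [AddCommGroup M] [Module R M]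
  [AddCommGroup N] [Module R N] {m c s : ℕ}
  {q : (Fin m → R) →ₗ[R] M} {ε : (Fin c → R) →ₗ[R] N} {β : Matrix (Fin c) (Fin s) R}

lemma apply_mem_smul_top_of_range_resKer_eq_top
    (hqm : ∀ v, q v = 0 → ∀ i, v i ∈ maximalIdeal R) (hres : LinearMap.range (resKer q N) = ⊤)
    (g : LinearMap.ker q →ₗ[R] N) (x : LinearMap.ker q) :
    g x ∈ maximalIdeal R • (⊤ : Submodule R N) := by
  obtain ⟨g', rfl⟩ := LinearMap.range_eq_top.1 hres g
  exact Submodule.smul_top_le_comap_smul_top _ g' (mem_smul_top_fun_iff.2 (hqm x x.2))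

lemma apply_mem_maximalIdeal_of_exact (hεm : ∀ v, ε v = 0 → ∀ i, v i ∈ maximalIdeal R)
    (hβε : Function.Exact β.mulVecLin ε) (j : Fin c) (k : Fin s) : β j k ∈ maximalIdeal R :=
  hεm (β.col k) (Matrix.mulVec_single_one β k ▸ hβε.apply_apply_eq_zero _) j

end FreeSyzygy

section FreeSyzygy

variable {R : Type u} [CommRing R] [IsLocalRing R] [IsNoetherianRing R] {M N : Type u}
  [AddCommGroup M] [Module R M] [AddCommGroup N] [Module R N] {m n c s : ℕ}
  {q : (Fin m → R) →ₗ[R] M} {ε : (Fin c → R) →ₗ[R] N} {β : Matrix (Fin c) (Fin s) R}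

lemma isFiniteLength_coker_resKer [Module.Finite R N] {k : ℕ}
    (hk : ∀ r ∈ maximalIdeal R ^ k, SMulFactorsThroughFree R M r) (hq : Function.Surjective q) :
    IsFiniteLength R ((LinearMap.ker q →ₗ[R] N) ⧸ LinearMap.range (resKer q N)) := by
  refine isFiniteLength_of_pow_le_annihilator (k := k) fun r hr =>
    Module.mem_annihilator.2 fun z => ?_
  obtain ⟨g, rfl⟩ := Submodule.mkQ_surjective _ z
  rw [← map_smul, Submodule.mkQ_apply, Submodule.Quotient.mk_eq_zero]
  exact (hk r hr).smul_mem_range_resKer hq g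

/- In `0 → M* → F* → L* → Ext¹(M, R) → 0` theta vanishes on the free module `F*` and on the module
`Ext¹(M, R)` of finite length. -/
lemma IsExactPair.pairTheta_dual_eq_neg {φ ψ : Matrix (Fin n) (Fin n) R} (h : IsExactPair φ ψ)
    (hfin : HasFiniteHomology φ ψ) (hdim : ∃ p : Ideal R, p.IsPrime ∧ p ≠ maximalIdeal R) {k : ℕ}
    [Module.Finite R M] (hk : ∀ r ∈ maximalIdeal R ^ k, SMulFactorsThroughFree R M r)
    (hq : Function.Surjective q) :
    pairTheta φ ψ (Dual R M) = - pairTheta φ ψ (Dual R (LinearMap.ker q)) := by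
  have hexact : Function.Exact (LinearMap.lcomp R R q) (resKer q R).rangeRestrict :=
    fun g => Iff.trans (by simp [Subtype.ext_iff]) (exact_lcomp_resKer hq g)
  have hrange := h.pairTheta_add hfin (X₃ := LinearMap.range (resKer q R))
    (LinearMap.lcomp_injective_of_surjective q hq) hexact (LinearMap.surjective_rangeRestrict _)
  have hcoker := h.pairTheta_add hfin (Submodule.injective_subtype (LinearMap.range (resKer q R)))
    (LinearMap.exact_subtype_mkQ _) (Submodule.mkQ_surjective _)
  rw [h.pairTheta_eq_zero_of_free] at hrange
  rw [h.pairTheta_eq_zero_of_isFiniteLength hfin hdim (isFiniteLength_coker_resKer hk hq)] at hcoker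
  unfold Dual
  linarith

lemma subsingleton_ker_or_of_projective_ker [Module.Finite R N]
    (hqm : ∀ v, q v = 0 → ∀ i, v i ∈ maximalIdeal R) (hres : LinearMap.range (resKer q N) = ⊤)
    [Module.Projective R (LinearMap.ker q)] : Subsingleton (LinearMap.ker q) ∨ Subsingleton N := by
  have : Module.Free R (LinearMap.ker q) := Module.free_of_flat_of_isLocalRing
  let b := Module.finBasis R (LinearMap.ker q)
  rcases isEmpty_or_nonempty (Fin (Module.finrank R (LinearMap.ker q))) with _ | ⟨⟨i⟩⟩
  · exact .inl b.repr.toEquiv.subsingleton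
  · have htop : (⊤ : Submodule R N) ≤ maximalIdeal R • ⊤ := fun x _ => by
      simpa using apply_mem_smul_top_of_range_resKer_eq_top hqm hres (b.constr R fun _ => x) (b i)
    have := Submodule.eq_bot_of_le_smul_of_le_jacobson_bot (maximalIdeal R) _
      Module.Finite.fg_top htop (maximalIdeal_le_jacobson _)
    exact .inr ((Submodule.subsingleton_iff R).1 (subsingleton_of_bot_eq_top this.symm))

lemma exists_injective_mulVecLin_exact [Module.Projective R (LinearMap.ker ε)] :
    ∃ (s : ℕ) (β : Matrix (Fin c) (Fin s) R),
      Function.Injective β.mulVecLin ∧ Function.Exact β.mulVecLin ε := by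
  have : Module.Free R (LinearMap.ker ε) := Module.free_of_flat_of_isLocalRing
  let e := (Module.finBasis R (LinearMap.ker ε)).equivFun
  let β := LinearMap.toMatrix' ((LinearMap.ker ε).subtype ∘ₗ e.symm.toLinearMap)
  have hβ (v) : β.mulVecLin v = e.symm v := LinearMap.toMatrix'_mulVec _ v
  refine ⟨_, β, fun v w h => ?_, fun x => ⟨fun hx => ⟨e ⟨x, hx⟩, ?_⟩, ?_⟩⟩
  · rw [hβ, hβ] at h
    exact e.symm.injective (Subtype.ext h)
  · rw [hβ, e.symm_apply_apply]
  · rintro ⟨v, rfl⟩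
    rw [hβ]
    exact (e.symm v).2

lemma range_resKer_self_eq_top (hc : 0 < c) (hε : Function.Surjective ε)
    (hβ : Function.Injective β.mulVecLin) (hβε : Function.Exact β.mulVecLin ε)
    (hβm : ∀ j k, β j k ∈ maximalIdeal R) (hres : LinearMap.range (resKer q N) = ⊤) :
    LinearMap.range (resKer q R) = ⊤ := by
  rw [eq_top_iff]
  refine Submodule.le_of_le_smul_of_le_jacobson_bot (I := maximalIdeal R) Module.Finite.fg_top
    (maximalIdeal_le_jacobson _) fun g _ => ?_
  let j : Fin c := ⟨0, hc⟩
  let G : LinearMap.ker q →ₗ[R] (Fin c → R) := LinearMap.single R (fun _ => R) j ∘ₗ g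
  obtain ⟨g', hg'⟩ := exists_lift_of_range_resKer_eq_top hres hε (ε ∘ₗ G)
  obtain ⟨D, hD⟩ := exists_mulVecLin_comp_eq hβ hβε
    (D := G - g' ∘ₗ (LinearMap.ker q).subtype) (by rw [LinearMap.comp_sub, hg', sub_self])
  have hg : g = resKer q R (LinearMap.proj j ∘ₗ g') + ∑ k, β j k • (LinearMap.proj k ∘ₗ D) := by
    ext x
    have hx := congrFun (LinearMap.congr_fun hD x) j
    simp only [G, LinearMap.comp_apply, Matrix.mulVecLin_apply, Matrix.mulVec, dotProduct,
      LinearMap.sub_apply, Pi.sub_apply, LinearMap.single_apply, Pi.single_eq_same] at hx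
    simp [hx]
  rw [hg]
  exact Submodule.add_mem_sup ⟨_, rfl⟩
    (Submodule.sum_mem _ fun k _ => Submodule.smul_mem_smul (hβm j k) trivial)

end FreeSyzygy

section Presentation

variable {S X T : Type*} [CommRing S] [AddCommGroup X] [Module S X] [AddCommGroup T] [Module S T]
  {c s p : ℕ} {β : Matrix (Fin c) (Fin s) S} {pr : (Fin c → X) →ₗ[S] T}
  {π : (Fin p → S) →ₗ[S] X}

/-- The first map of the presentation `Fˢ × Kᶜ → Fᶜ → T` obtained from the exact sequence
`Xˢ → Xᶜ → T` with first map `β` and from a presentation `0 → K → F → X → 0`. -/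
noncomputable def presentationMap (β : Matrix (Fin c) (Fin s) S) (π : (Fin p → S) →ₗ[S] X) :
    (Fin s → Fin p → S) × (Fin c → LinearMap.ker π) →ₗ[S] (Fin c → Fin p → S) :=
  (matrixAct (Fin p → S) β).coprod ((LinearMap.ker π).subtype.compLeft (Fin c))

lemma compLeft_presentationMap (w : Fin s → Fin p → S) (k : Fin c → LinearMap.ker π) :
    π.compLeft (Fin c) (presentationMap β π (w, k)) = matrixAct X β (π.compLeft (Fin s) w) := by
  have hk : π.compLeft (Fin c) ((LinearMap.ker π).subtype.compLeft (Fin c) k) = 0 :=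
    funext fun i => (k i).2
  rw [presentationMap, LinearMap.coprod_apply, map_add, hk, add_zero, compLeft_matrixAct]

lemma exact_presentationMap (hπ : Function.Surjective π)
    (hβpr : Function.Exact (matrixAct X β) pr) :
    Function.Exact (presentationMap β π) (pr ∘ₗ π.compLeft (Fin c)) := by
  refine fun v => ⟨fun hv => ?_, ?_⟩
  · obtain ⟨u, hu⟩ := (hβpr _).1 hv
    obtain ⟨w, rfl⟩ := hπ.comp_left u
    have hk (i) : v i - matrixAct (Fin p → S) β w i ∈ LinearMap.ker π := by
      rw [LinearMap.mem_ker, map_sub, sub_eq_zero]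
      exact (congrFun ((compLeft_matrixAct π β w).trans hu) i).symm
    exact ⟨(w, fun i => ⟨_, hk i⟩), funext fun i => add_sub_cancel _ _⟩
  · rintro ⟨⟨w, k⟩, rfl⟩
    rw [LinearMap.comp_apply, compLeft_presentationMap]
    exact hβpr.apply_apply_eq_zero _

lemma presentationMap_eq_zero_iff (hβ : Function.Injective (matrixAct X β))
    {z : (Fin s → Fin p → S) × (Fin c → LinearMap.ker π)} :
    presentationMap β π z = 0 ↔ ∃ x : Fin s → LinearMap.ker π,
      z = ((LinearMap.ker π).subtype.compLeft (Fin s) x, -matrixAct (LinearMap.ker π) β x) := by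
  have hsub := compLeft_matrixAct (LinearMap.ker π).subtype β
  constructor
  · obtain ⟨w, k⟩ := z
    intro hz
    have hw : π.compLeft (Fin s) w = 0 :=
      (map_eq_zero_iff _ hβ).1 (by rw [← compLeft_presentationMap w k, hz, map_zero])
    let x : Fin s → LinearMap.ker π := fun i => ⟨w i, congrFun hw i⟩
    refine ⟨x, Prod.ext rfl ((Submodule.injective_subtype _).comp_left ?_)⟩
    exact (eq_neg_of_add_eq_zero_right hz).trans (congrArg Neg.neg (hsub x)).symm
  · rintro ⟨x, rfl⟩
    rw [presentationMap, LinearMap.coprod_apply, map_neg, hsub, add_neg_cancel]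

end Presentation

section Minimal

lemma matrixAct_mem_smul_top {S X : Type*} [CommRing S] [AddCommGroup X] [Module S X] {I : Ideal S}
    {c s : ℕ} {β : Matrix (Fin c) (Fin s) S} (hβ : ∀ i j, β i j ∈ I) (v : Fin s → X) :
    matrixAct X β v ∈ I • (⊤ : Submodule S (Fin c → X)) :=
  mem_smul_top_pi_iff.2 fun i => by
    rw [matrixAct_apply]
    exact Submodule.sum_mem _ fun j _ => Submodule.smul_mem_smul (hβ i j) trivial

variable {S : Type u} [CommRing S] [IsLocalRing S]

lemma ker_presentationMap_le {X : Type*} [AddCommGroup X] [Module S X] {c s p : ℕ}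
    {β : Matrix (Fin c) (Fin s) S} {π : (Fin p → S) →ₗ[S] X}
    (hβ : Function.Injective (matrixAct X β)) (hβm : ∀ i j, β i j ∈ maximalIdeal S)
    (hπm : ∀ v, π v = 0 → ∀ i, v i ∈ maximalIdeal S) :
    LinearMap.ker (presentationMap β π) ≤ maximalIdeal S • ⊤ := by
  intro z hz
  obtain ⟨x, rfl⟩ := (presentationMap_eq_zero_iff hβ).1 hz
  exact mk_mem_smul_top_prod
    (mem_smul_top_pi_iff.2 fun i => mem_smul_top_fun_iff.2 (hπm _ (x i).2))
    (neg_mem (matrixAct_mem_smul_top hβm x))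

/- Minimal presentations `K → F → X` and `β` induce a minimal presentation of `T`, which must be
injective as `T` has projective dimension at most one; it is not unless `Kˢ = 0`. -/
theorem eq_zero_or_projective_of_exact_matrixAct [IsNoetherianRing S] {X T : Type u}
    [AddCommGroup X] [Module S X] [Module.Finite S X] [AddCommGroup T] [Module S T] {c s : ℕ}
    {β : Matrix (Fin c) (Fin s) S} (hβ : Function.Injective (matrixAct X β))
    (hβm : ∀ i j, β i j ∈ maximalIdeal S) {pr : (Fin c → X) →ₗ[S] T}
    (hβpr : Function.Exact (matrixAct X β) pr) (hpr : Function.Surjective pr)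
    (hT : ProjDimLT S T 2) : s = 0 ∨ Module.Projective S X := by
  obtain ⟨p, π, hπ, hπm⟩ := exists_minimal_cover S X
  have hexact := exact_presentationMap hπ hβpr
  let cover := pr ∘ₗ π.compLeft (Fin c)
  have : Module.Projective S (LinearMap.ker cover) :=
    ProjDimLT.one_iff.1 (ProjDimLT.ker (hpr.comp hπ.comp_left) hT)
  have hinj : Function.Injective (presentationMap β π) := by
    let f := (presentationMap β π).codRestrict (LinearMap.ker cover)
      hexact.apply_apply_eq_zero
    have hf : Function.Surjective f := fun v => by
      obtain ⟨z, hz⟩ := (hexact v).1 v.2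
      exact ⟨z, Subtype.ext hz⟩
    refine fun z z' hz => injective_of_surjective_of_ker_le_smul_top le_rfl hf ?_ (Subtype.ext hz)
    rw [LinearMap.ker_codRestrict _ _ hexact.apply_apply_eq_zero]
    exact ker_presentationMap_le hβ hβm hπm
  refine s.eq_zero_or_pos.imp_right fun hs => ?_
  have hker : Subsingleton (LinearMap.ker π) := subsingleton_of_forall_eq 0 fun x => by
    have hz := (presentationMap_eq_zero_iff (π := π) hβ).2 ⟨fun _ => x, rfl⟩
    have hx := congrArg Prod.fst ((map_eq_zero_iff _ hinj).1 hz)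
    exact Subtype.ext (congrFun hx ⟨0, hs⟩)
  exact .of_equiv (LinearEquiv.ofBijective π ⟨injective_of_subsingleton_ker hker, hπ⟩)

end Minimal

/-! ### Negativity of theta over a hypersurface of dimension three -/

/-- The matrices `φ` and `ψ` are the differentials of a free resolution
`⋯ → Rⁿ → Rⁿ → Rⁿ → Rᶜ → N` of `N`, which is periodic from degree one on: `φ` is a presentation
matrix of the first syzygy of `N`. -/
structure IsPeriodicResolution {R : Type*} [CommRing R] {n : ℕ} (φ ψ : Matrix (Fin n) (Fin n) R)
    (N : Type*) [AddCommGroup N] [Module R N] : Prop where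
  isExactPair : IsExactPair φ ψ
  exists_isCokerOf : ∃ (c : ℕ) (ε : (Fin c → R) →ₗ[R] N),
    Function.Surjective ε ∧ IsCokerOf φ (LinearMap.ker ε)

namespace IsHypersurfaceQuotient

variable {S R : Type u} [CommRing S] [CommRing R] [Algebra S R] {f : S}

lemma mem_maximalIdeal_of_algebraMap [IsLocalRing S] [IsLocalRing R] {s : S}
    (hs : algebraMap S R s ∈ maximalIdeal R) : s ∈ maximalIdeal S :=
  (mem_maximalIdeal s).2 fun hu => (mem_maximalIdeal _).1 hs (hu.map (algebraMap S R))

section Syzygy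

variable {L : Type u} [AddCommGroup L] [Module S L] [Module R L] [IsScalarTower S R L]
  [Module.Finite R L]

lemma exists_isMatrixFactorization_isCokerOf [IsLocalRing S] (hR : IsHypersurfaceQuotient S R f)
    (hL : ProjDimLT S L 2) :
    ∃ (n : ℕ) (Φ Ψ : Matrix (Fin n) (Fin n) S), IsMatrixFactorization f Φ Ψ ∧
      (∀ i j, Φ i j ∈ maximalIdeal S) ∧ IsCokerOf (Φ.map (algebraMap S R)) L := by
  let := hR.isRegularLocalRing
  have := hR.finite_of_finite L
  obtain ⟨n, Φ, Ψ, π, hΦ, hπ, hΦπ, hΦm⟩ :=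
    exists_isMatrixFactorization hR.ne_zero hR.smul_eq_zero hL
  exact ⟨n, Φ, Ψ, hΦ, hΦm, (hΦ.isCokerOf_map_iff hR).2 ⟨π, hπ, hΦπ⟩⟩

lemma exists_isExactPair_isCokerOf (hR : IsHypersurfaceQuotient S R f) (hL : ProjDimLT S L 2) :
    ∃ (n : ℕ) (φ ψ : Matrix (Fin n) (Fin n) R), IsExactPair φ ψ ∧ IsCokerOf φ L := by
  let := hR.isRegularLocalRing
  obtain ⟨n, Φ, Ψ, hΦ, -, hL⟩ := hR.exists_isMatrixFactorization_isCokerOf hL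
  exact ⟨n, _, _, hΦ.isExactPair hR, hL⟩

lemma projDimLT_two_dual (hR : IsHypersurfaceQuotient S R f) (hL : ProjDimLT S L 2) :
    ProjDimLT S (Dual R L) 2 := by
  let := hR.isRegularLocalRing
  obtain ⟨n, Φ, Ψ, hΦ, -, hL⟩ := hR.exists_isMatrixFactorization_isCokerOf hL
  have hdual := (hΦ.isExactPair hR).isCokerOf_dual hL
  rw [← Matrix.transpose_map, hΦ.transpose.isCokerOf_map_iff hR] at hdual
  exact hΦ.transpose.projDimLT_two hR.ne_zero hdual

lemma projective_of_dual (hR : IsHypersurfaceQuotient S R f) (hL : ProjDimLT S L 2)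
    (h : Module.Projective R (Dual R L)) : Module.Projective R L := by
  obtain ⟨n, φ, ψ, hφ, hL⟩ := hR.exists_isExactPair_isCokerOf hL
  exact hφ.projective_of_dual hL h

end Syzygy

lemma subsingleton_of_projective (hR : IsHypersurfaceQuotient S R f) (X : Type u)
    [AddCommGroup X] [Module S X] [Module R X] [IsScalarTower S R X] [Module.Finite R X]
    [Module.Projective S X] : Subsingleton X := by
  let := hR.isRegularLocalRing
  have := hR.finite_of_finite X
  have : Module.Free S X := Module.free_of_flat_of_isLocalRing
  refine subsingleton_of_forall_eq 0 fun x => ?_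
  exact (_root_.smul_eq_zero.1 (hR.smul_eq_zero x)).resolve_left hR.ne_zero

/- `Ext¹(M, N) = 0` makes every homomorphism from the syzygy of `M` to `N` extend to the cover of
`M`, hence lift to the cover of `N`; this kills one of the two homology modules. -/
lemma subsingleton_pairHomology_dual_ker (hR : IsHypersurfaceQuotient S R f) {M N : Type u}
    [AddCommGroup M] [Module R M] [AddCommGroup N] [Module R N] {m c n : ℕ}
    {q : (Fin m → R) →ₗ[R] M} {ε : (Fin c → R) →ₗ[R] N} {φ ψ : Matrix (Fin n) (Fin n) R}
    (hL : ProjDimLT S (LinearMap.ker q) 2) (hε : Function.Surjective ε) (h : IsExactPair φ ψ)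
    (hφ : IsCokerOf φ (LinearMap.ker ε)) (hres : LinearMap.range (resKer q N) = ⊤) :
    Subsingleton (PairHomology ψ φ (Dual R (LinearMap.ker q))) := by
  have := hR.isNoetherianRing
  obtain ⟨p, α, β, hα, hαL⟩ := hR.exists_isExactPair_isCokerOf hL
  refine subsingleton_pairHomology_dual_of_lift hα h hαL hφ fun g => ?_
  obtain ⟨g', hg'⟩ := exists_lift_of_range_resKer_eq_top hres hε g
  exact ⟨_, hg'⟩

variable [IsLocalRing R] {M N : Type u} [AddCommGroup M] [Module R M] [AddCommGroup N]
  [Module S N] [Module R N] [IsScalarTower S R N] [Module.Finite R M]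

lemma eq_zero_or_subsingleton_dual (hR : IsHypersurfaceQuotient S R f) {c s : ℕ}
    {ε : (Fin c → R) →ₗ[R] N} {β : Matrix (Fin c) (Fin s) R} (hβ : Function.Injective β.mulVecLin)
    (hβε : Function.Exact β.mulVecLin ε) (hβm : ∀ j k, β j k ∈ maximalIdeal R)
    (hsurj : Function.Surjective (compPi M ε)) (hMN : ProjDimLT S (M →ₗ[R] N) 2) :
    s = 0 ∨ Subsingleton (Dual R M) := by
  let := hR.isRegularLocalRing
  have := hR.isNoetherianRing
  have := hR.finite_of_finite (Dual R M)
  choose b hb using fun j k => hR.surjective (β j k)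
  obtain rfl : (Matrix.of b).map (algebraMap S R) = β := Matrix.ext hb
  have hact : ⇑(matrixAct (Dual R M) (Matrix.of b)) =
      matrixAct (Dual R M) ((Matrix.of b).map (algebraMap S R)) :=
    funext fun v => (matrixAct_map_algebraMap _ v).symm
  exact (eq_zero_or_projective_of_exact_matrixAct (X := Dual R M)
    (pr := (compPi M ε).restrictScalars S) (hact ▸ matrixAct_dual_injective hβ)
    (fun j k => mem_maximalIdeal_of_algebraMap (hβm j k)) (hact ▸ exact_matrixAct_compPi hβ hβε)
    hsurj hMN).imp_right fun (_ : Module.Projective S (Dual R M)) =>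
      hR.subsingleton_of_projective (Dual R M)

/- Homomorphisms from the syzygy of `M` to `R` extend to the free cover, hence `Hom(M, N)` is the
cokernel of `(M*)ˢ → (M*)ᶜ`, where `0 → Rˢ → Rᶜ → N → 0` is the free resolution of `N`. -/
lemma free_or_free_of_projective_ker (hR : IsHypersurfaceQuotient S R f) {m c a : ℕ}
    {q : (Fin m → R) →ₗ[R] M} {ε : (Fin c → R) →ₗ[R] N} {i : M →ₗ[R] (Fin a → R)}
    (hq : Function.Surjective q) (hε : Function.Surjective ε)
    (hεm : ∀ v, ε v = 0 → ∀ i, v i ∈ maximalIdeal R) (hi : Function.Injective i)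
    (hres : LinearMap.range (resKer q N) = ⊤) (hMN : ProjDimLT S (M →ₗ[R] N) 2)
    [Module.Projective R (LinearMap.ker ε)] : Module.Free R M ∨ Module.Free R N := by
  have := hR.isNoetherianRing
  rcases c.eq_zero_or_pos with rfl | hc
  · have := hε.subsingleton
    exact .inr (.of_subsingleton R N)
  obtain ⟨s, β, hβ, hβε⟩ := exists_injective_mulVecLin_exact (ε := ε)
  have hβm := apply_mem_maximalIdeal_of_exact hεm hβε
  have hsurj := compPi_surjective hq hε hβ hβε
    (range_resKer_self_eq_top hc hε hβ hβε hβm hres)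
  rcases hR.eq_zero_or_subsingleton_dual hβ hβε hβm hsurj hMN with rfl | hdual
  · have hinj : Function.Injective ε := (injective_iff_map_eq_zero ε).2 fun x hx => by
      obtain ⟨v, rfl⟩ := (hβε x).1 hx
      rw [Subsingleton.elim v 0, map_zero]
    exact .inr (.of_equiv (LinearEquiv.ofBijective ε ⟨hinj, hε⟩))
  · have : Subsingleton M := subsingleton_of_forall_eq 0 fun x => hi <| funext fun j =>
      (LinearMap.congr_fun (hdual.elim (LinearMap.proj j ∘ₗ i) 0) x).trans
        (by rw [map_zero, LinearMap.zero_apply, Pi.zero_apply])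
    exact .inl (.of_subsingleton R M)

lemma free_or_free_of_subsingleton_pairHomology [IsLocalRing S]
    (hR : IsHypersurfaceQuotient S R f) [Module.Finite R N] {m c n a : ℕ}
    {q : (Fin m → R) →ₗ[R] M} {ε : (Fin c → R) →ₗ[R] N} {i : M →ₗ[R] (Fin a → R)}
    (hq : Function.Surjective q) (hqm : ∀ v, q v = 0 → ∀ i, v i ∈ maximalIdeal R)
    (hε : Function.Surjective ε) (hεm : ∀ v, ε v = 0 → ∀ i, v i ∈ maximalIdeal R)
    (hi : Function.Injective i) (hres : LinearMap.range (resKer q N) = ⊤)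
    (hL : ProjDimLT S (LinearMap.ker q) 2) (hMN : ProjDimLT S (M →ₗ[R] N) 2)
    {Φ Ψ : Matrix (Fin n) (Fin n) S} (hΦ : IsMatrixFactorization f Φ Ψ)
    (hΦm : ∀ i j, Φ i j ∈ maximalIdeal S)
    (hY : IsCokerOf (Φ.map (algebraMap S R)) (LinearMap.ker ε))
    (h : Subsingleton (PairHomology (Φ.map (algebraMap S R)) (Ψ.map (algebraMap S R))
      (Dual R (LinearMap.ker q)))) : Module.Free R M ∨ Module.Free R N := by
  let := hR.isRegularLocalRing
  have := hR.isNoetherianRing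
  have := hR.finite_of_finite (Dual R (LinearMap.ker q))
  have h' := hR.subsingleton_pairHomology_dual_ker hL hε (hΦ.isExactPair hR) hY hres
  rcases projective_or_projective_of_subsingleton_pairHomology hR hΦ hΦm hY
    (hR.projDimLT_two_dual hL) h h' with hdual | hker
  · have := hR.projective_of_dual hL hdual
    rcases subsingleton_ker_or_of_projective_ker hqm hres with hker | hN
    · have hinj := injective_of_subsingleton_ker hker
      exact .inl (.of_equiv (LinearEquiv.ofBijective q ⟨hinj, hq⟩))
    · exact .inr (.of_subsingleton R N)
  · exact hR.free_or_free_of_projective_ker hq hε hεm hi hres hMN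

theorem exists_isPeriodicResolution_pairTheta_nonpos [IsLocalRing S]
    (hR : IsHypersurfaceQuotient S R f) [Module S M] [IsScalarTower S R M] [Module.Finite R N]
    (hd : (maximalIdeal S).spanFinrank = 4) (hdim : ∃ p : Ideal R, p.IsPrime ∧ p ≠ maximalIdeal R)
    {a k : ℕ} {i : M →ₗ[R] (Fin a → R)} (hi : Function.Injective i)
    (hM : ProjDimLT S M 3) (hN : ProjDimLT S N 3) (hMN : ProjDimLT S (M →ₗ[R] N) 2)
    (hkM : ∀ r ∈ maximalIdeal R ^ k, SMulFactorsThroughFree R M r)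
    (hkN : ∀ r ∈ maximalIdeal R ^ k, SMulFactorsThroughFree R N r) :
    ∃ (n : ℕ) (φ ψ : Matrix (Fin n) (Fin n) R), IsPeriodicResolution φ ψ N ∧
      HasFiniteHomology φ ψ ∧ pairTheta φ ψ (Dual R M) ≤ 0 ∧
      (pairTheta φ ψ (Dual R M) = 0 ↔ Module.Free R M ∨ Module.Free R N) := by
  let := hR.isRegularLocalRing
  have := hR.isNoetherianRing
  obtain ⟨m, q, hq, hqm⟩ := exists_minimal_cover R M
  obtain ⟨c, ε, hε, hεm⟩ := exists_minimal_cover R N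
  have hL := hR.projDimLT_two_ker hM hq
  have hres := hR.range_resKer_eq_top hd hN hMN hkM hq
  obtain ⟨n, Φ, Ψ, hΦ, hΦm, hY⟩ :=
    hR.exists_isMatrixFactorization_isCokerOf (hR.projDimLT_two_ker hN hε)
  let φ := Φ.map (algebraMap S R)
  let ψ := Ψ.map (algebraMap S R)
  have hφ : IsExactPair φ ψ := hΦ.isExactPair hR
  have hfin := hφ.hasFiniteHomology hε hY hkN
  have hθ : pairTheta φ ψ (Dual R M) =
      -(Module.length R (PairHomology φ ψ (Dual R (LinearMap.ker q)))).toNat := by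
    have := hR.subsingleton_pairHomology_dual_ker hL hε hφ hY hres
    rw [hφ.pairTheta_dual_eq_neg hfin hdim hkM hq, pairTheta,
      Module.length_eq_zero_iff.2 this, ENat.toNat_zero, Nat.cast_zero, sub_zero]
  refine ⟨n, φ, ψ, ⟨hφ, c, ε, hε, hY⟩, hfin, by simp [hθ], fun h => ?_, ?_⟩
  · rw [hθ, neg_eq_zero, Nat.cast_eq_zero, ENat.toNat_eq_zero] at h
    exact hR.free_or_free_of_subsingleton_pairHomology hq hqm hε hεm hi hres hL hMN hΦ hΦm hY
      (Module.length_eq_zero_iff.1 (h.resolve_right (hfin _).1))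
  · rintro (_ | _)
    · exact hφ.pairTheta_eq_zero_of_free _
    · exact hφ.pairTheta_eq_zero_of_free_of_isCokerOf hε hY _

end IsHypersurfaceQuotient

/-! ### Tor from an explicit resolution -/

section Tor

open TensorProduct

lemma length_moduleCatLeftHomologyData_H {A : Type u} [CommRing A]
    (T : ShortComplex (ModuleCat.{u} A)) :
    Module.length A T.moduleCatLeftHomologyData.H =
      Module.length A (MiddleHomology T.f.hom T.g.hom) := by
  obtain ⟨e⟩ := MiddleHomology.nonempty_equiv (f := T.f.hom)
    (g := T.g.hom) (k := (LinearMap.ker T.g.hom).subtype)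
    (q := (LinearMap.range T.moduleCatToCycles).mkQ)
    (Submodule.injective_subtype _) (LinearMap.exact_subtype_ker_map _)
    (Submodule.mkQ_surjective _) (fun x => by
      rw [Submodule.mkQ_apply, Submodule.Quotient.mk_eq_zero]
      exact ⟨fun ⟨y, hy⟩ => ⟨y, congrArg Subtype.val hy⟩, fun ⟨y, hy⟩ => ⟨y, Subtype.ext hy⟩⟩)
  exact e.length_eq

lemma torLength_congr {A : Type u} [CommRing A] {Y Y' N : Type u} [AddCommGroup Y] [Module A Y]
    [AddCommGroup Y'] [Module A Y'] [AddCommGroup N] [Module A N] (e : Y ≃ₗ[A] Y') (n : ℕ) :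
    torLength A Y N n = torLength A Y' N n :=
  (((Tor (ModuleCat.{u} A) n).mapIso e.toModuleIso).app (ModuleCat.of A N)).toLinearEquiv.length_eq

/-- A projective resolution `⋯ → X 1 → X 0 → N → 0` given by linear maps, for computations that
need the differentials explicitly. -/
structure LinearResolution (A : Type u) [CommRing A] (N : Type u) [AddCommGroup N]
    [Module A N] where
  X : ℕ → ModuleCat.{u} A
  projective : ∀ n, Projective A (X n)
  d : ∀ n, X (n + 1) →ₗ[A] X n
  ε : X 0 →ₗ[A] N
  surjective : Function.Surjective ε
  exact_zero : Function.Exact (d 0) ε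
  exact_succ : ∀ n, Function.Exact (d (n + 1)) (d n)

namespace LinearResolution

variable {A : Type u} [CommRing A] {N : Type u} [AddCommGroup N] [Module A N]

variable (A N) in
lemma nonempty : Nonempty (LinearResolution A N) := by
  let P := projectiveResolution (ModuleCat.of A N)
  exact ⟨{
    X := P.complex.X
    projective := fun n => (IsProjective.iff_projective (P.complex.X n)).2 (P.projective n)
    d := fun n => (P.complex.d (n + 1) n).hom
    ε := (P.π.f 0).hom
    surjective := (ModuleCat.epi_iff_surjective (P.π.f 0)).1 inferInstance
    exact_zero := (ShortComplex.ShortExact.moduleCat_exact_iff_function_exact _).1 P.exact₀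
    exact_succ := fun n =>
      (ShortComplex.ShortExact.moduleCat_exact_iff_function_exact _).1 (P.exact_succ n) }⟩

variable (P : LinearResolution A N)

/-- The chain complex `⋯ → X 1 → X 0` underlying a resolution. -/
noncomputable def complex : ChainComplex (ModuleCat.{u} A) ℕ :=
  ChainComplex.of P.X (fun n => ModuleCat.ofHom (P.d n)) fun n => by
    ext x
    exact (P.exact_succ n).apply_apply_eq_zero x

lemma complex_d (n : ℕ) : P.complex.d (n + 1) n = ModuleCat.ofHom (P.d n) :=
  ChainComplex.of_d P.X (fun n => ModuleCat.ofHom (P.d n)) n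

/-- The augmentation `ε` as a morphism from the underlying complex to `N` in degree zero. -/
noncomputable def π : P.complex ⟶ (ChainComplex.single₀ (ModuleCat.{u} A)).obj (ModuleCat.of A N) :=
  (P.complex.toSingle₀Equiv _).symm ⟨ModuleCat.ofHom P.ε, by
    rw [P.complex_d]
    ext x
    exact P.exact_zero.apply_apply_eq_zero x⟩

lemma π_f_zero : P.π.f 0 = ModuleCat.ofHom P.ε :=
  ChainComplex.toSingle₀Equiv_symm_apply_f_zero _ _

lemma quasiIsoAt_zero : QuasiIsoAt P.π 0 := by
  rw [ChainComplex.quasiIsoAt₀_iff, ShortComplex.quasiIso_iff_of_zeros' _ rfl rfl rfl]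
  constructor
  · rw [ShortComplex.moduleCat_exact_iff]
    intro x hx
    have hεx : (P.π.f 0).hom x = 0 := hx
    rw [P.π_f_zero] at hεx
    obtain ⟨y, hy⟩ := (P.exact_zero x).1 hεx
    refine ⟨y, ?_⟩
    change (P.complex.d 1 0).hom y = x
    rw [P.complex_d]
    exact hy
  · change Epi (P.π.f 0)
    rw [ModuleCat.epi_iff_surjective, P.π_f_zero]
    exact P.surjective

lemma quasiIsoAt_succ (n : ℕ) : QuasiIsoAt P.π (n + 1) := by
  rw [quasiIsoAt_iff_exactAt' (hL := ChainComplex.exactAt_succ_single_obj ..),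
    HomologicalComplex.exactAt_iff' _ (n + 2) (n + 1) n (by simp) (by simp),
    ShortComplex.moduleCat_exact_iff]
  intro x hx
  have hdx : (P.complex.d (n + 1) n).hom x = 0 := hx
  rw [P.complex_d] at hdx
  obtain ⟨y, hy⟩ := (P.exact_succ n x).1 hdx
  refine ⟨y, ?_⟩
  change (P.complex.d (n + 2) (n + 1)).hom y = x
  rw [P.complex_d]
  exact hy

/-- A resolution by linear maps as a projective resolution in the category of modules. -/
noncomputable def toProjectiveResolution : ProjectiveResolution (ModuleCat.of A N) where
  complex := P.complex
  projective n := (IsProjective.iff_projective (P.X n)).1 (P.projective n)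
  π := P.π
  quasiIso := ⟨fun n => n.casesOn P.quasiIsoAt_zero P.quasiIsoAt_succ⟩

theorem torLength_succ (Y : Type u) [AddCommGroup Y] [Module A Y] (n : ℕ) :
    torLength A Y N (n + 1) = Module.length A
      (MiddleHomology ((P.d (n + 1)).lTensor Y) ((P.d n).lTensor Y)) := by
  let F := (MonoidalCategory.tensoringLeft (ModuleCat.{u} A)).obj (ModuleCat.of A Y)
  let K := (F.mapHomologicalComplex (ComplexShape.down ℕ)).obj P.complex
  let T := K.sc' (n + 2) (n + 1) n
  have hKT : K.homology (n + 1) ≅ T.homology :=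
    ShortComplex.homologyMapIso (K.isoSc' (n + 2) (n + 1) n (by simp) (by simp))
  have hTor : torLength A Y N (n + 1) = Module.length A T.moduleCatLeftHomologyData.H :=
    (P.toProjectiveResolution.isoLeftDerivedObj F (n + 1) ≪≫ hKT ≪≫
      T.moduleCatHomologyIso).toLinearEquiv.length_eq
  have hd : ∀ m, (K.d (m + 1) m).hom = (P.d m).lTensor Y := fun m => by
    have hKd : K.d (m + 1) m = F.map (ModuleCat.ofHom (P.d m)) := by rw [← P.complex_d]; rfl
    rw [hKd]
    rfl
  rw [hTor, length_moduleCatLeftHomologyData_H]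
  change Module.length A (MiddleHomology (K.d (n + 2) (n + 1)).hom (K.d (n + 1) n).hom) = _
  rw [hd, hd]
  rfl

end LinearResolution

section BaseChange

variable {A : Type*} [CommRing A] (B : Type*) [CommRing B] [Algebra A B]
  {U V W : Type*} [AddCommGroup U] [Module A U] [AddCommGroup V] [Module A V] [AddCommGroup W]
  [Module A W] {f : U →ₗ[A] V} {g : V →ₗ[A] W}

lemma exact_baseChange [Flat A B] (h : Function.Exact f g) :
    Function.Exact (f.baseChange B) (g.baseChange B) := by
  simpa only [← LinearMap.baseChange_eq_ltensor] using Module.Flat.lTensor_exact B h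

lemma injective_baseChange [Flat A B] (h : Function.Injective f) :
    Function.Injective (f.baseChange B) := by
  simpa only [← LinearMap.baseChange_eq_ltensor] using
    Module.Flat.lTensor_preserves_injective_linearMap (M := B) f h

lemma MiddleHomology.nonempty_baseChange_equiv [Flat A B] (h : ∀ x, g (f x) = 0) :
    Nonempty (B ⊗[A] MiddleHomology f g ≃ₗ[B]
      MiddleHomology (f.baseChange B) (g.baseChange B)) := by
  let f' : U →ₗ[A] LinearMap.ker g := f.codRestrict _ h
  have hf' : (LinearMap.ker g).subtype ∘ₗ f' = f := rfl
  have hex : Function.Exact f' ((LinearMap.range f).comap (LinearMap.ker g).subtype).mkQ := by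
    rw [LinearMap.exact_iff, Submodule.ker_mkQ]
    ext x
    exact ⟨fun ⟨y, hy⟩ => ⟨y, Subtype.ext hy⟩, fun ⟨y, hy⟩ => ⟨y, congrArg Subtype.val hy⟩⟩
  have hinj := injective_baseChange B (Submodule.injective_subtype (LinearMap.ker g))
  refine nonempty_equiv (k := (LinearMap.ker g).subtype.baseChange B)
    (q := ((LinearMap.range f).comap (LinearMap.ker g).subtype).mkQ.baseChange B) hinj
    (exact_baseChange B (LinearMap.exact_subtype_ker_map g))
    (LinearMap.baseChange_surjective B (Submodule.mkQ_surjective _)) fun x => ?_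
  rw [exact_baseChange B hex x, ← hf', LinearMap.baseChange_comp]
  exact ⟨fun ⟨y, hy⟩ => ⟨y, hy ▸ rfl⟩, fun ⟨y, hy⟩ => ⟨y, hinj hy⟩⟩

lemma distribBaseChange_baseChange_lTensor (Y : Type*) [AddCommGroup Y] [Module A Y]
    (x : B ⊗[A] (Y ⊗[A] U)) :
    AlgebraTensorModule.distribBaseChange A B Y V ((f.lTensor Y).baseChange B x) =
      (f.baseChange B).lTensor (B ⊗[A] Y) (AlgebraTensorModule.distribBaseChange A B Y U x) := by
  induction x with
  | zero => simp only [map_zero]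
  | add x y hx hy => simp only [map_add, hx, hy]
  | tmul b x =>
    induction x with
    | zero => simp only [map_zero, tmul_zero]
    | add x y hx hy => simp only [map_add, tmul_add, hx, hy]
    | tmul y x => simp

end BaseChange

section FlatBaseChange

variable {A : Type u} [CommRing A] (B : Type u) [CommRing B] [Algebra A B] [Flat A B]
  {N : Type u} [AddCommGroup N] [Module A N]

/-- Flat base change of a resolution. -/
noncomputable def LinearResolution.baseChange (P : LinearResolution A N) :
    LinearResolution B (B ⊗[A] N) where
  X n := ModuleCat.of B (B ⊗[A] P.X n)
  projective n := by
    have := P.projective n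
    exact inferInstanceAs (Projective B (B ⊗[A] P.X n))
  d n := (P.d n).baseChange B
  ε := P.ε.baseChange B
  surjective := LinearMap.baseChange_surjective B P.surjective
  exact_zero := exact_baseChange B P.exact_zero
  exact_succ n := exact_baseChange B (P.exact_succ n)

variable [IsLocalRing A] [IsLocalRing B] [IsLocalHom (algebraMap A B)]
  (Y N : Type u) [AddCommGroup Y] [Module A Y] [AddCommGroup N] [Module A N]

theorem torLength_baseChange (n : ℕ) :
    torLength B (B ⊗[A] Y) (B ⊗[A] N) (n + 1) = torLength A Y N (n + 1) *
      Module.length B (B ⧸ (maximalIdeal A).map (algebraMap A B)) := by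
  obtain ⟨P⟩ := LinearResolution.nonempty A N
  obtain ⟨e⟩ := MiddleHomology.nonempty_baseChange_equiv B (f := (P.d (n + 1)).lTensor Y)
    (g := (P.d n).lTensor Y) (fun x => by
      rw [← LinearMap.comp_apply, ← LinearMap.lTensor_comp,
        (P.exact_succ n).linearMap_comp_eq_zero, LinearMap.lTensor_zero, LinearMap.zero_apply])
  rw [(P.baseChange B).torLength_succ, P.torLength_succ, ← IsLocalRing.length_baseChange,
    e.length_eq]
  exact (MiddleHomology.length_eq_of_comm
    (AlgebraTensorModule.distribBaseChange A B Y (P.X (n + 2)))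
    (AlgebraTensorModule.distribBaseChange A B Y (P.X (n + 1)))
    (AlgebraTensorModule.distribBaseChange A B Y (P.X n))
    (distribBaseChange_baseChange_lTensor B Y) (distribBaseChange_baseChange_lTensor B Y)).symm

end FlatBaseChange

/-! ### Periodic resolutions -/

section Periodic

variable {R : Type u} [CommRing R] {n : ℕ} {φ ψ : Matrix (Fin n) (Fin n) R}

variable (φ ψ) in
/-- The linear maps `φ, ψ, φ, ψ, …`: the differentials of a 2-periodic complex. -/
def altMulVecLin (k : ℕ) : (Fin n → R) →ₗ[R] (Fin n → R) :=
  if Even k then φ.mulVecLin else ψ.mulVecLin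

lemma IsExactPair.exact_altMulVecLin (h : IsExactPair φ ψ) (k : ℕ) :
    Function.Exact (altMulVecLin φ ψ (k + 1)) (altMulVecLin φ ψ k) := by
  unfold altMulVecLin
  by_cases hk : Even k
  · rw [if_neg (not_not.2 hk ∘ Nat.even_add_one.1), if_pos hk]
    exact h.exact
  · rw [if_pos (Nat.even_add_one.2 hk), if_neg hk]
    exact h.exact'

lemma piScalarRight_lTensor_mulVecLin (Y : Type*) [AddCommGroup Y] [Module R Y]
    (x : Y ⊗[R] (Fin n → R)) :
    piScalarRight R R Y (Fin n) (φ.mulVecLin.lTensor Y x) =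
      matrixAct Y φ (piScalarRight R R Y (Fin n) x) := by
  induction x with
  | zero => simp only [map_zero]
  | add x y hx hy => simp only [map_add, hx, hy]
  | tmul y x =>
    ext i
    simp [matrixAct_apply, Matrix.mulVec, dotProduct, Finset.sum_smul, smul_smul]

lemma length_middleHomology_lTensor (φ ψ : Matrix (Fin n) (Fin n) R) (Y : Type*) [AddCommGroup Y]
    [Module R Y] :
    Module.length R (MiddleHomology (ψ.mulVecLin.lTensor Y) (φ.mulVecLin.lTensor Y)) =
      Module.length R (PairHomology φ ψ Y) :=
  MiddleHomology.length_eq_of_comm (piScalarRight R R Y (Fin n)) (piScalarRight R R Y (Fin n))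
    (piScalarRight R R Y (Fin n)) (piScalarRight_lTensor_mulVecLin Y)
    (piScalarRight_lTensor_mulVecLin Y)

namespace IsPeriodicResolution

variable {N : Type u} [AddCommGroup N] [Module R N]

lemma torLength_add_two (h : IsPeriodicResolution φ ψ N) (Y : Type u) [AddCommGroup Y]
    [Module R Y] (k : ℕ) :
    torLength R Y N (k + 2) = Module.length R
      (MiddleHomology ((altMulVecLin φ ψ (k + 1)).lTensor Y) ((altMulVecLin φ ψ k).lTensor Y)) := by
  obtain ⟨c, ε, hε, hφ⟩ := h.exists_isCokerOf
  obtain ⟨ι, hφι, hιε⟩ := hφ.exists_exact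
  let P : LinearResolution R N :=
    { X := fun k => k.casesOn (ModuleCat.of R (Fin c → R)) fun _ => ModuleCat.of R (Fin n → R)
      projective := by
        rintro (_ | k)
        · exact inferInstanceAs (Projective R (Fin c → R))
        · exact inferInstanceAs (Projective R (Fin n → R))
      d := fun k => k.casesOn ι.mulVecLin (altMulVecLin φ ψ)
      ε := ε
      surjective := hε
      exact_zero := hιε
      exact_succ := fun k => k.casesOn hφι h.isExactPair.exact_altMulVecLin }
  exact P.torLength_succ Y (k + 1)

variable (Y : Type u) [AddCommGroup Y] [Module R Y]

theorem torLength_even (h : IsPeriodicResolution φ ψ N) (e : ℕ) :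
    torLength R Y N (2 * e + 2) = Module.length R (PairHomology φ ψ Y) := by
  rw [h.torLength_add_two Y (2 * e), ← length_middleHomology_lTensor, altMulVecLin, altMulVecLin,
    if_pos (even_two_mul e), if_neg (by simp)]

theorem torLength_odd (h : IsPeriodicResolution φ ψ N) (e : ℕ) :
    torLength R Y N (2 * (e + 1) + 1) = Module.length R (PairHomology ψ φ Y) := by
  rw [show 2 * (e + 1) + 1 = 2 * e + 1 + 2 by ring, h.torLength_add_two Y (2 * e + 1),
    ← length_middleHomology_lTensor, altMulVecLin, altMulVecLin, if_pos (by simp [parity_simps]),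
    if_neg (by simp)]

end IsPeriodicResolution

end Periodic

end Tor

/-! ### Second syzygies and local freeness on the punctured spectrum -/

section SecondSyzygy

open TensorProduct

variable (R : Type*) [CommRing R] (M : Type*) [AddCommGroup M] [Module R M]

/-- `M` is a second syzygy module: the kernel of a linear map between finite free modules. For
finitely generated modules over a Noetherian ring this is implied by reflexivity and, unlike
reflexivity, it is visibly preserved by flat base change. -/
def IsSecondSyzygy : Prop :=
  ∃ (a b : ℕ) (i : M →ₗ[R] (Fin a → R)) (g : (Fin a → R) →ₗ[R] (Fin b → R)),
    Function.Injective i ∧ Function.Exact i g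

variable {R M}

lemma IsSecondSyzygy.of_exact_of_injective {F G : Type*} [AddCommGroup F] [Module R F]
    [Module.Free R F] [Module.Finite R F] [AddCommGroup G] [Module R G] [Module.Free R G]
    [Module.Finite R G]
    {i : M →ₗ[R] F} {g : F →ₗ[R] G} (hi : Function.Injective i) (hig : Function.Exact i g) :
    IsSecondSyzygy R M := by
  let eF := ((Module.Free.chooseBasis R F).reindex (Fintype.equivFin _)).equivFun
  let eG := ((Module.Free.chooseBasis R G).reindex (Fintype.equivFin _)).equivFun
  refine ⟨_, _, eF.toLinearMap ∘ₗ i, eG.toLinearMap ∘ₗ g ∘ₗ eF.symm.toLinearMap,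
    eF.injective.comp hi, fun y => ?_⟩
  obtain ⟨x, rfl⟩ := eF.surjective y
  simp only [LinearMap.comp_apply, LinearEquiv.coe_coe, LinearEquiv.symm_apply_apply,
    eG.map_eq_zero_iff, Set.mem_range, eF.injective.eq_iff]
  exact hig x

lemma IsSecondSyzygy.of_isReflexive [IsNoetherianRing R] [Module.Finite R M] [IsReflexive R M] :
    IsSecondSyzygy R M := by
  have := finitePresentation_of_finite R (Dual R M)
  obtain ⟨a, b, q, T, hq, hT⟩ := FinitePresentation.exists_fin' R (Dual R M)
  have hinj := LinearMap.lcomp_injective_of_surjective (S := R) (N := R) q hq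
  refine .of_exact_of_injective (i := q.lcomp R R ∘ₗ (evalEquiv R M).toLinearMap)
    (g := T.lcomp R R) (hinj.comp (evalEquiv R M).injective) ?_
  rw [LinearMap.exact_iff, LinearMap.range_comp, LinearEquiv.range, Submodule.map_top]
  exact (LinearMap.exact_lcomp_of_exact_of_surjective R hT hq).linearMap_ker_eq

lemma IsSecondSyzygy.baseChange (h : IsSecondSyzygy R M) (B : Type*) [CommRing B] [Algebra R B]
    [Flat R B] : IsSecondSyzygy B (B ⊗[R] M) := by
  obtain ⟨a, b, i, g, hi, hig⟩ := h
  exact .of_exact_of_injective (injective_baseChange B hi) (exact_baseChange B hig)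

end SecondSyzygy

section SMulFactorsThroughFree

open TensorProduct

variable (R : Type u) [CommRing R] (M : Type u) [AddCommGroup M] [Module R M]

variable {R M} in
lemma SMulFactorsThroughFree.of_finite_free {F : Type u} [AddCommGroup F] [Module R F]
    [Module.Free R F] [Module.Finite R F] {r : R} (u : M →ₗ[R] F) (v : F →ₗ[R] M)
    (h : ∀ x, v (u x) = r • x) : SMulFactorsThroughFree R M r := by
  let b := (Module.Free.chooseBasis R F).reindex (Fintype.equivFin _)
  exact ⟨_, b.equivFun.toLinearMap ∘ₗ u, v ∘ₗ b.equivFun.symm.toLinearMap, fun x => by simp [h]⟩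

/-- The ideal of ring elements whose action on `M` factors through a finite free module. For
finitely presented `M` it cuts out the locus where `M` is not locally free. -/
def smulFactorsIdeal : Ideal R where
  carrier := {r | SMulFactorsThroughFree R M r}
  zero_mem' := ⟨0, 0, 0, fun x => by simp⟩
  add_mem' := by
    rintro r s ⟨n, u, v, h⟩ ⟨n', u', v', h'⟩
    refine .of_finite_free (F := (Fin n → R) × (Fin n' → R)) (u.prod u') (v.coprod v') fun x => ?_
    simp [h, h', add_smul]
  smul_mem' := by
    rintro c r ⟨n, u, v, h⟩
    exact ⟨n, c • u, v, fun x => by simp [h, smul_smul]⟩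

variable {R M}

lemma SMulFactorsThroughFree.baseChange (B : Type u) [CommRing B] [Algebra R B] {r : R}
    (h : SMulFactorsThroughFree R M r) :
    SMulFactorsThroughFree B (B ⊗[R] M) (algebraMap R B r) := by
  obtain ⟨n, u, v, h⟩ := h
  refine .of_finite_free (F := B ⊗[R] (Fin n → R)) (u.baseChange B) (v.baseChange B) fun x => ?_
  induction x with
  | zero => simp
  | add x y hx hy => simp only [map_add, hx, hy, smul_add]
  | tmul b x => simp [h]

lemma map_smulFactorsIdeal_le (B : Type u) [CommRing B] [Algebra R B] :
    (smulFactorsIdeal R M).map (algebraMap R B) ≤ smulFactorsIdeal B (B ⊗[R] M) :=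
  Ideal.map_le_iff_le_comap.2 fun _ h => SMulFactorsThroughFree.baseChange B h

lemma exists_mem_smulFactorsThroughFree [FinitePresentation R M] (T : Submonoid R)
    [Module.Free (Localization T) (LocalizedModule T M)] :
    ∃ s ∈ T, SMulFactorsThroughFree R M s := by
  let f := LocalizedModule.mkLinearMap T M
  let b := (Module.Free.chooseBasis (Localization T) (LocalizedModule T M)).reindex
    (Fintype.equivFin _)
  let e := b.equivFun.restrictScalars R
  let n := Fintype.card (Module.Free.ChooseBasisIndex (Localization T) (LocalizedModule T M))
  let j : (Fin n → R) →ₗ[R] (Fin n → Localization T) :=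
    LinearMap.pi fun k => Algebra.linearMap R (Localization T) ∘ₗ LinearMap.proj k
  have : IsLocalizedModule T j := inferInstance
  obtain ⟨u, s₁, hu⟩ := FinitePresentation.exists_lift_of_isLocalizedModule T j
    (e.toLinearMap ∘ₗ f)
  obtain ⟨v, s₂, hv⟩ := FinitePresentation.exists_lift_of_isLocalizedModule T f
    (e.symm.toLinearMap ∘ₗ j)
  have hvu : f ∘ₗ v ∘ₗ u = f ∘ₗ ((s₂ * s₁) • LinearMap.id) := by
    ext x
    have hu' : j (u x) = s₁ • e (f x) := LinearMap.congr_fun hu x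
    have hv' : f (v (u x)) = s₂ • e.symm (j (u x)) := LinearMap.congr_fun hv (u x)
    simp only [Submonoid.smul_def] at hu' hv'
    simp only [LinearMap.comp_apply, LinearMap.smul_apply, LinearMap.id_apply, Submonoid.smul_def,
      map_smul, hv', hu', LinearEquiv.symm_apply_apply, smul_smul, Submonoid.coe_mul]
  obtain ⟨s₃, hs⟩ := Module.Finite.exists_smul_of_comp_eq_of_isLocalizedModule T f _ _ hvu
  refine ⟨s₃ * (s₂ * s₁), (s₃ * (s₂ * s₁)).2, n, s₃.1 • u, v, fun x => ?_⟩
  have hx : s₃ • v (u x) = s₃ • (s₂ * s₁) • x := LinearMap.congr_fun hs x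
  rw [LinearMap.smul_apply, map_smul, mul_smul]
  exact hx

lemma IsLocallyFreeOnPuncturedSpectrum.exists_pow_maximalIdeal_le [IsLocalRing R]
    [IsNoetherianRing R] [Module.Finite R M] (h : IsLocallyFreeOnPuncturedSpectrum R M) :
    ∃ k, maximalIdeal R ^ k ≤ smulFactorsIdeal R M := by
  refine Ideal.exists_pow_le_of_le_radical_of_fg ?_ (IsNoetherian.noetherian _)
  rw [Ideal.radical_eq_sInf]
  refine le_sInf fun p ⟨hle, hp⟩ => ?_
  by_contra hne
  have hpc : (⟨p, hp⟩ : PrimeSpectrum R) ≠ closedPoint R := fun hpc =>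
    hne (congrArg PrimeSpectrum.asIdeal hpc).ge
  have := finitePresentation_of_finite R M
  have := mem_freeLocus.1 (h hpc)
  obtain ⟨s, hs, hsM⟩ := exists_mem_smulFactorsThroughFree (M := M) p.primeCompl
  exact hs (hle hsM)

lemma pow_maximalIdeal_le_smulFactorsIdeal_baseChange [IsLocalRing R] {B : Type u} [CommRing B]
    [IsLocalRing B] [Algebra R B] (hB : (maximalIdeal R).map (algebraMap R B) = maximalIdeal B)
    {k : ℕ} (h : maximalIdeal R ^ k ≤ smulFactorsIdeal R M) :
    maximalIdeal B ^ k ≤ smulFactorsIdeal B (B ⊗[R] M) := by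
  rw [← hB, ← Ideal.map_pow]
  exact (Ideal.map_mono h).trans (map_smulFactorsIdeal_le B)

end SMulFactorsThroughFree

/-! ### Dimension, depth and flat base change -/

section FlatLocal

open TensorProduct RingTheory.Sequence

section Depth

variable {R : Type*} [CommRing R]

lemma isWeaklyRegular_of_subsingleton (M : Type*) [AddCommGroup M] [Module R M] [Subsingleton M]
    (rs : List R) : IsWeaklyRegular M rs :=
  (isWeaklyRegular_iff_Fin M rs).2 fun _ => Function.injective_of_subsingleton _

variable {A : Type u} [CommRing A] [IsLocalRing A] {M : Type u} [AddCommGroup M] [Module A M]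

lemma exists_isWeaklyRegular_of_le_localDepth {n : ℕ} (h : (n : ℕ∞) ≤ localDepth A M) :
    ∃ rs : List A, rs.length = n ∧ (∀ r ∈ rs, r ∈ maximalIdeal A) ∧ IsWeaklyRegular M rs := by
  obtain rfl | hn := Nat.eq_zero_or_pos n
  · exact ⟨[], rfl, by simp, IsWeaklyRegular.nil _ _⟩
  have hlt : ((n - 1 : ℕ) : ℕ∞) < localDepth A M :=
    lt_of_lt_of_le (by exact_mod_cast Nat.sub_one_lt_of_lt hn) h
  simp only [localDepth, lt_iSup_iff] at hlt
  obtain ⟨rs, hrs, hreg, hlen⟩ := hlt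
  have hnrs : n ≤ rs.length := Nat.le_of_pred_lt (by exact_mod_cast hlen)
  have htake := hreg.toIsWeaklyRegular
  rw [← List.take_append_drop n rs, isWeaklyRegular_append_iff] at htake
  exact ⟨rs.take n, by simp [hnrs], fun r hr => hrs r (List.mem_of_mem_take hr), htake.1⟩

lemma IsMaximalCohenMacaulay.exists_isWeaklyRegular {d : ℕ} (hA : ringKrullDim A = d)
    (h : IsMaximalCohenMacaulay A M) :
    ∃ rs : List A, rs.length = d ∧ (∀ r ∈ rs, r ∈ maximalIdeal A) ∧ IsWeaklyRegular M rs := by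
  obtain hM | hdepth := h.2
  · exact ⟨List.replicate d 0, List.length_replicate,
      fun r hr => List.eq_of_mem_replicate hr ▸ zero_mem _, isWeaklyRegular_of_subsingleton M _⟩
  · rw [hA] at hdepth
    have hd : localDepth A M = d := by exact_mod_cast hdepth
    exact exists_isWeaklyRegular_of_le_localDepth hd.ge

end Depth

section Dimension

variable {A B : Type*} [CommRing A] [IsLocalRing A] [CommRing B] [IsLocalRing B]

lemma exists_isPrime_ne_maximalIdeal (h : 0 < ringKrullDim A) :
    ∃ p : Ideal A, p.IsPrime ∧ p ≠ maximalIdeal A := by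
  by_contra! H
  refine h.not_ge ?_
  have : Ring.KrullDimLE 0 A := Ring.KrullDimLE.mk₀ fun I hI => H I hI ▸ maximalIdeal.isMaximal A
  exact (Ring.krullDimLE_iff (n := 0)).1 this

lemma ringKrullDim_eq_of_flat_of_map_maximalIdeal [IsNoetherianRing A] [IsNoetherianRing B]
    [Algebra A B] [Flat A B] (h : (maximalIdeal A).map (algebraMap A B) = maximalIdeal B) :
    ringKrullDim B = ringKrullDim A := by
  have : (maximalIdeal B).LiesOver (maximalIdeal A) := ⟨by
    refine le_antisymm (Ideal.map_le_iff_le_comap.1 h.le) (le_maximalIdeal ?_)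
    exact Ideal.comap_ne_top _ (Ideal.IsPrime.ne_top')⟩
  have : Nontrivial (B ⧸ maximalIdeal B) := Ideal.Quotient.nontrivial_iff.2 Ideal.IsPrime.ne_top'
  have hbot : (⊥ : Ideal (B ⧸ maximalIdeal B)).height = 0 := by simp
  rw [← maximalIdeal_height_eq_ringKrullDim, ← maximalIdeal_height_eq_ringKrullDim,
    Ideal.height_eq_height_add_of_liesOver_of_hasGoingDown (maximalIdeal A) (maximalIdeal B), h,
    Ideal.map_quotient_self, hbot, add_zero]

lemma length_quotient_maximalIdeal : Module.length A (A ⧸ maximalIdeal A) = 1 :=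
  length_eq_one_iff.2 (isSimpleModule_iff_isCoatom.2 (maximalIdeal.isMaximal A).out)

end Dimension

section Hom

variable (A B : Type u) [CommRing A] [CommRing B] [Algebra A B] [Flat A B]
  (M N : Type u) [AddCommGroup M] [Module A M] [AddCommGroup N] [Module A N]
  [FinitePresentation A M]

/-- Formation of `Hom` from a finitely presented module commutes with flat base change. -/
noncomputable def homBaseChangeEquiv :
    B ⊗[A] (M →ₗ[A] N) ≃ₗ[B] (B ⊗[A] M →ₗ[B] B ⊗[A] N) :=
  (FinitePresentation.isBaseChange_map A M N B).equiv

/-- Formation of the dual of a finitely presented module commutes with flat base change. -/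
noncomputable def dualBaseChangeEquiv : B ⊗[A] Dual A M ≃ₗ[B] Dual B (B ⊗[A] M) :=
  (homBaseChangeEquiv A B M A).trans (AlgebraTensorModule.rid A B B).congrRight

variable {A M N}

lemma exists_isWeaklyRegular_hom_baseChange [IsLocalRing A] [IsLocalRing B]
    [IsLocalHom (algebraMap A B)] {rs : List A} (hrs : ∀ r ∈ rs, r ∈ maximalIdeal A)
    (hreg : IsWeaklyRegular (M →ₗ[A] N) rs) :
    ∃ ss : List B, ss.length = rs.length ∧ (∀ s ∈ ss, s ∈ maximalIdeal B) ∧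
      IsWeaklyRegular (B ⊗[A] M →ₗ[B] B ⊗[A] N) ss := by
  refine ⟨rs.map (algebraMap A B), rs.length_map _, fun s hs => ?_,
    ((homBaseChangeEquiv A B M N).isWeaklyRegular_congr _).1
      (hreg.of_flat_of_isBaseChange (TensorProduct.isBaseChange A (M →ₗ[A] N) B))⟩
  obtain ⟨r, hr, rfl⟩ := List.mem_map.1 hs
  exact (map_mem_nonunits_iff (algebraMap A B) r).2 (hrs r hr)

end Hom

lemma free_baseChange_iff {A B : Type*} [CommRing A] [IsLocalRing A] [CommRing B] [IsLocalRing B]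
    [Algebra A B] [Flat A B] [IsLocalHom (algebraMap A B)] (M : Type*) [AddCommGroup M]
    [Module A M] [FinitePresentation A M] : Module.Free B (B ⊗[A] M) ↔ Module.Free A M := by
  refine ⟨fun _ => ?_, fun _ => inferInstance⟩
  have := FaithfullyFlat.of_flat_of_isLocalHom (A := A) (B := B)
  have : Flat A M := Flat.of_flat_tensorProduct A M B
  exact free_of_flat_of_isLocalRing

end FlatLocal

/-! ### Hochster's theta invariant -/

section HochsterTheta

open TensorProduct

lemma HasHochsterTheta.congr_left {A : Type u} [CommRing A] {Y Y' N : Type u} [AddCommGroup Y]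
    [Module A Y] [AddCommGroup Y'] [Module A Y'] [AddCommGroup N] [Module A N] {t : ℤ}
    (e : Y ≃ₗ[A] Y') (h : HasHochsterTheta A Y N t) : HasHochsterTheta A Y' N t := fun k hk => by
  simpa only [torLength_congr e] using h k hk

lemma hasHochsterTheta_baseChange_iff {A B : Type u} [CommRing A] [IsLocalRing A]
    [IsNoetherianRing A] [CommRing B] [IsLocalRing B] [IsNoetherianRing B] [Algebra A B] [Flat A B]
    [IsLocalHom (algebraMap A B)]
    (hB : (maximalIdeal A).map (algebraMap A B) = maximalIdeal B)
    {Y N : Type u} [AddCommGroup Y] [Module A Y] [AddCommGroup N] [Module A N] {t : ℤ} :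
    HasHochsterTheta B (B ⊗[A] Y) (B ⊗[A] N) t ↔ HasHochsterTheta A Y N t := by
  have htor (j : ℕ) : torLength B (B ⊗[A] Y) (B ⊗[A] N) (j + 1) = torLength A Y N (j + 1) := by
    rw [torLength_baseChange, hB, length_quotient_maximalIdeal, mul_one]
  simp only [HasHochsterTheta, htor, ringKrullDim_eq_of_flat_of_map_maximalIdeal hB]

lemma IsPeriodicResolution.hasHochsterTheta {R : Type u} [CommRing R] (hdim : 0 < ringKrullDim R)
    {n : ℕ} {φ ψ : Matrix (Fin n) (Fin n) R} {N : Type u} [AddCommGroup N] [Module R N]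
    (h : IsPeriodicResolution φ ψ N) (hfin : HasFiniteHomology φ ψ) (Y : Type u) [AddCommGroup Y]
    [Module R Y] [Module.Finite R Y] : HasHochsterTheta R Y N (pairTheta φ ψ Y) := by
  rintro (_ | e) he
  · exact absurd hdim (not_lt.2 (by simpa using he))
  · exact ⟨_, _, (h.torLength_even Y (e + 1)).trans (ENat.natCast_toNat (hfin Y).1).symm,
      (h.torLength_odd Y e).trans (ENat.natCast_toNat (hfin Y).2).symm, rfl⟩

namespace IsHypersurfaceQuotient

variable {S R : Type u} [CommRing S] [CommRing R] [Algebra S R] {f : S}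

lemma ringKrullDim_add_one (hR : IsHypersurfaceQuotient S R f) :
    ringKrullDim R + 1 = ringKrullDim S := by
  have := hR.isRegularLocalRing
  have hker : RingHom.ker (algebraMap S R) = Ideal.span {f} := by
    ext s
    rw [RingHom.mem_ker, hR.algebraMap_eq_zero_iff, Ideal.mem_span_singleton]
  rw [← ringKrullDim_eq_of_ringEquiv (RingHom.quotientKerEquivOfSurjective hR.surjective), hker]
  exact ringKrullDim_quotient_span_singleton_succ_eq_ringKrullDim_of_mem_nonZeroDivisors
    (mem_nonZeroDivisors_of_ne_zero hR.ne_zero) ((mem_maximalIdeal f).2 hR.not_isUnit)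

lemma spanFinrank_maximalIdeal [IsLocalRing S] (hR : IsHypersurfaceQuotient S R f) {d : ℕ}
    (h : ringKrullDim R = d) : (maximalIdeal S).spanFinrank = d + 1 := by
  have := hR.isRegularLocalRing
  have hS := hR.ringKrullDim_add_one
  rw [h, ← IsRegularLocalRing.spanFinrank_maximalIdeal] at hS
  exact_mod_cast hS.symm

theorem exists_hasHochsterTheta [IsLocalRing R] (hR : IsHypersurfaceQuotient S R f)
    (hdim : ringKrullDim R = 3) {M N : Type u} [AddCommGroup M] [Module R M] [AddCommGroup N]
    [Module R N] [Module.Finite R M] [Module.Finite R N]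
    (hM : IsSecondSyzygy R M) (hN : IsSecondSyzygy R N) {k l : ℕ}
    (hkM : maximalIdeal R ^ k ≤ smulFactorsIdeal R M)
    (hlN : maximalIdeal R ^ l ≤ smulFactorsIdeal R N) {rs : List R} (hlen : rs.length = 3)
    (hrs : ∀ r ∈ rs, r ∈ maximalIdeal R)
    (hreg : RingTheory.Sequence.IsWeaklyRegular (M →ₗ[R] N) rs) :
    ∃ t : ℤ, HasHochsterTheta R (Dual R M) N t ∧ t ≤ 0 ∧
      (t = 0 ↔ Module.Free R M ∨ Module.Free R N) := by
  let : Module S M := Module.compHom M (algebraMap S R)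
  let : Module S N := Module.compHom N (algebraMap S R)
  have : IsScalarTower S R M := .of_algebraMap_smul fun _ _ => rfl
  have : IsScalarTower S R N := .of_algebraMap_smul fun _ _ => rfl
  have := hR.isRegularLocalRing
  have := hR.isNoetherianRing
  have hS : (maximalIdeal S).spanFinrank = 4 := hR.spanFinrank_maximalIdeal (d := 3) hdim
  have hpos : 0 < ringKrullDim R := by rw [hdim]; norm_num
  obtain ⟨a, b, i, g, hi, hig⟩ := hM
  obtain ⟨a', b', i', g', hi', hig'⟩ := hN
  obtain ⟨n, φ, ψ, hφψ, hfin, hnonpos, hzero⟩ :=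
    hR.exists_isPeriodicResolution_pairTheta_nonpos hS (exists_isPrime_ne_maximalIdeal hpos) hi
      (hR.projDimLT_of_exact_fin hS hi hig) (hR.projDimLT_of_exact_fin hS hi' hig')
      (hR.projDimLT_of_isWeaklyRegular (by rw [hS, hlen]) hrs hreg)
      (fun r hr => hkM (Ideal.pow_le_pow_right (le_max_left k l) hr))
      (fun r hr => hlN (Ideal.pow_le_pow_right (le_max_right k l) hr))
  exact ⟨_, hφψ.hasHochsterTheta hpos hfin (Dual R M), hnonpos, hzero⟩

end IsHypersurfaceQuotient

lemma IsAbstractHypersurface.exists_isHypersurfaceQuotient {A : Type u} [CommRing A]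
    [IsLocalRing A] (hA : IsAbstractHypersurface A) :
    ∃ (S : Type u) (_ : CommRing S) (_ : Algebra S (AdicCompletion (maximalIdeal A) A)) (f : S),
      IsHypersurfaceQuotient S (AdicCompletion (maximalIdeal A) A) f := by
  obtain ⟨-, S, _, hS, f, hf, hfu, ⟨e⟩⟩ := hA
  let : Algebra S (AdicCompletion (maximalIdeal A) A) :=
    (e.symm.toRingHom.comp (Ideal.Quotient.mk (Ideal.span {f}))).toAlgebra
  exact ⟨S, inferInstance, this, f,
    { isRegularLocalRing := hS
      surjective := e.symm.surjective.comp Ideal.Quotient.mk_surjective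
      algebraMap_eq_zero_iff := fun s => by
        change e.symm (Ideal.Quotient.mk (Ideal.span {f}) s) = 0 ↔ f ∣ s
        rw [EmbeddingLike.map_eq_zero_iff, Ideal.Quotient.eq_zero_iff_dvd]
      ne_zero := hf
      not_isUnit := hfu }⟩

end HochsterTheta

theorem mainTheorem8 (A : Type u) [CommRing A] [IsLocalRing A]
    (hA : IsAbstractHypersurface A) (hdim : ringKrullDim A = 3)
    (M N : Type u) [AddCommGroup M] [Module A M] [AddCommGroup N] [Module A N]
    [Module.Finite A M] [Module.Finite A N]
    [Module.IsReflexive A M] [Module.IsReflexive A N]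
    (hM : IsLocallyFreeOnPuncturedSpectrum A M) (hN : IsLocallyFreeOnPuncturedSpectrum A N)
    (hMN : IsMaximalCohenMacaulay A (M →ₗ[A] N)) :
    ∃ t : ℤ, HasHochsterTheta A (Module.Dual A M) N t ∧
      t ≤ 0 ∧ (t = 0 ↔ Module.Free A M ∨ Module.Free A N) := by
  have := hA.1
  have := finitePresentation_of_finite A M
  have := finitePresentation_of_finite A N
  obtain ⟨S, _, _, f, hB⟩ := hA.exists_isHypersurfaceQuotient
  let B := AdicCompletion (maximalIdeal A) A
  have := hB.isNoetherianRing
  have hmap : (maximalIdeal A).map (algebraMap A B) = maximalIdeal B :=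
    (AdicCompletion.maximalIdeal_eq_map (R := A)).symm
  obtain ⟨k, hk⟩ := hM.exists_pow_maximalIdeal_le
  obtain ⟨l, hl⟩ := hN.exists_pow_maximalIdeal_le
  obtain ⟨rs, hlen, hrs, hreg⟩ := hMN.exists_isWeaklyRegular (d := 3) hdim
  obtain ⟨ss, hlen', hss, hreg'⟩ := exists_isWeaklyRegular_hom_baseChange B hrs hreg
  obtain ⟨t, ht, hnonpos, hzero⟩ := hB.exists_hasHochsterTheta
    ((ringKrullDim_eq_of_flat_of_map_maximalIdeal hmap).trans hdim)
    (IsSecondSyzygy.of_isReflexive.baseChange B) (IsSecondSyzygy.of_isReflexive.baseChange B)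
    (pow_maximalIdeal_le_smulFactorsIdeal_baseChange hmap hk)
    (pow_maximalIdeal_le_smulFactorsIdeal_baseChange hmap hl) (hlen'.trans hlen) hss hreg'
  exact ⟨t, (hasHochsterTheta_baseChange_iff hmap).1
    (ht.congr_left (dualBaseChangeEquiv A B M).symm), hnonpos,
    by rw [hzero, free_baseChange_iff, free_baseChange_iff]⟩
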